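/- Let $(M^n,\langle\cdot,\cdot\rangle)$ be a smooth Riemannian manifold with Levi-Civita connection $\overline\nabla$, and let $\Sigma$ be a smooth manifold of dimension $m$ (any dimension and codimension $n-m\ge 0$). Let $F:\Sigma\times[0,T)\to M$ be a smooth mean curvature flow, i.e. $F$ is smooth, each $F_t=F(\cdot,t)$ is an immersion, and $\frac{dF}{dt}=H$. Conventions. In local coordinates $x^1,\dots,x^m$ of $\Sigma$ put $\partial_i=\partial F_t/\partial x^i$, $g_{ij}=\langle\partial_i,\partial_j\rangle$, with inverse $g^{ij}$. The second fundamental form is $A(\partial_i,\partial_j)=(\overline\nabla_{\partial_i}\partial_j)^N$, where $N$ and $T$ denote the normal and the tangential part, and $H=g^{kl}A(\partial_k,\partial_l)$. The induced connection on $\Sigma$ is $(\overline\nabla_{\partial_i}\partial_j)^T$, and the covariant derivative of $A$ is $$(\nabla_{\partial_l}A)(\partial_i,\partial_j)=(\overline\nabla_{\partial_l}(A(\partial_i,\partial_j)))^N-A((\overline\nabla_{\partial_l}\partial_i)^T,\partial_j)-A(\partial_i,(\overline\nabla_{\partial_l}\partial_j)^T).$$ Let $\nabla^2A$ be the second covariant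 derivative (formed with the induced connection and the normal connection) and $\Delta A=g^{kl}\nabla_{\partial_l}\nabla_{\partial_k}A$. On functions $\Delta$ is the Laplace–Beltrami operator of $g_{ij}$. The norms are $|A|^2=g^{ik}g^{jl}\langle A(\partial_i,\partial_j),A(\partial_k,\partial_l)\rangle$ and similarly $|\nabla A|^2$. The curvature of $M$ is $K(X,Y)Z=-\overline\nabla_X\overline\nabla_YZ+\overline\nabla_Y\overline\nabla_XZ+\overline\nabla_{[X,Y]}Z$, $K_{ABCD}=\langle K(e_A,e_B)e_C,e_D\rangle$, so that $K_{ABAB}>0$ in positive sectional curvature. Fix $(p,t)\in\Sigma\times[0,T)$ and local coordinates of $\Sigma$ near $p$ with $g_{ij}(p,t)=\delta_{ij}$. The indices $i,j,k,l,q$ stand for the tangent vectors $\partial_i$ and $\alpha,\beta,\gamma$ for an orthonormal basis $e_\alpha$ of the normal space; repeated indices are summed. Time derivatives are taken at fixed $p$ (one-sided at $t=0$). (1) Let $e_\alpha(s)$, for $s\in[0,T)$ near $t$, be an orthonormal basis of the normal space of $F_s$ at $F(p,s)$, differentiable at $s=t$. Put $h_{\alpha ij}=\langle A(\partial_i,\partial_j),e_\alpha\rangle$,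 $h_\alpha=\sum_kh_{\alpha kk}$, $\Delta h_{\alpha ij}=\langle(\Delta A)(\partial_i,\partial_j),e_\alpha\rangle$, and let $\overline\nabla_He_\alpha$ be the covariant derivative of $e_\alpha$ along $s\mapsto F(p,s)$. Then for all $\alpha,i,j$, at $(p,t)$, $$\begin{aligned} \tfrac{d}{dt}h_{\alpha ij}={}&\Delta h_{\alpha ij}+(\overline\nabla_{\partial_k}K)_{\alpha ijk}+(\overline\nabla_{\partial_j}K)_{\alpha kik} -2K_{lijk}h_{\alpha lk}+2K_{\alpha\beta jk}h_{\beta ik}+2K_{\alpha\beta ik}h_{\beta jk}\\ &-K_{lkik}h_{\alpha lj}-K_{lkjk}h_{\alpha li}+K_{\alpha k\beta k}h_{\beta ij} -h_{\alpha iq}(h_{\gamma qj}h_\gamma-h_{\gamma qk}h_{\gamma jk})\\ &-h_{\alpha qk}(h_{\gamma qj}h_{\gamma ik}-h_{\gamma qk}h_{\gamma ij}) -h_{\beta ik}(h_{\beta lj}h_{\alpha lk}-h_{\beta lk}h_{\alpha lj}) -h_{\alpha jk}h_{\beta ik}h_\beta+h_{\beta ij}\langle e_\beta,\overline\nabla_He_\alpha\rangle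 . \end{aligned}$$ (2) For every orthonormal basis $e_\alpha$ of the normal space of $F_t$ at $F(p,t)$, at $(p,t)$, $$\begin{aligned} \tfrac{d}{dt}|A|^2={}&\Delta|A|^2-2|\nabla A|^2+2[(\overline\nabla_{\partial_k}K)_{\alpha ijk}+(\overline\nabla_{\partial_j}K)_{\alpha kik}]h_{\alpha ij} -4K_{lijk}h_{\alpha lk}h_{\alpha ij}+8K_{\alpha\beta jk}h_{\beta ik}h_{\alpha ij}\\ &-4K_{lkik}h_{\alpha lj}h_{\alpha ij}+2K_{\alpha k\beta k}h_{\beta ij}h_{\alpha ij} +2\sum_{\alpha,\gamma,i,q}\Big(\sum_k(h_{\alpha ik}h_{\gamma qk}-h_{\alpha qk}h_{\gamma ik})\Big)^2 +2\sum_{i,j,q,k}\Big(\sum_\alpha h_{\alpha ij}h_{\alpha qk}\Big)^2 . \end{aligned}$$ -/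

import Mathlib

open Set Filter Topology Manifold
open scoped ContDiff

noncomputable section

namespace MCF

/-- Coordinate space `ℝᵏ`. -/
abbrev Coord (k : ℕ) : Type := EuclideanSpace ℝ (Fin k)

/-- Partial derivative `∂ᵢ u` at `x`. -/
def partialDeriv {k : ℕ} (i : Fin k) (u : Coord k → ℝ) (x : Coord k) : ℝ :=
  fderiv ℝ u x (EuclideanSpace.single i 1)

/-! ### Riemannian geometry of the ambient space in local coordinates

`G y` is the matrix `G_{AB}(y)` of the ambient metric in local coordinates `y¹, …, yⁿ`; a tangent
vector at `y` is given by its components `v : Fin n → ℝ`. -/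

section Ambient

variable {n : ℕ} (G : Coord n → Matrix (Fin n) (Fin n) ℝ)

/-- The scalar product `⟨u, v⟩ = G_{AB} u^A v^B` of tangent vectors at `y`. -/
def inner (y : Coord n) (u v : Fin n → ℝ) : ℝ :=
  ∑ A, ∑ B, G y A B * u A * v B

/-- Christoffel symbols `Γ^A_{BC}` of the Levi-Civita connection. -/
def christoffel (A B C : Fin n) (y : Coord n) : ℝ :=
  (1 / 2) * ∑ D, (G y)⁻¹ A D *
    (partialDeriv B (fun z => G z D C) y + partialDeriv C (fun z => G z D B) y
      - partialDeriv D (fun z => G z B C) y)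

/-- The component along `∂_E` of
`K(∂_A, ∂_B) ∂_C = - ∇_A ∇_B ∂_C + ∇_B ∇_A ∂_C`. -/
def curvatureUp (E A B C : Fin n) (y : Coord n) : ℝ :=
  partialDeriv B (christoffel G E A C) y - partialDeriv A (christoffel G E B C) y
    + ∑ D, (christoffel G E B D y * christoffel G D A C y
        - christoffel G E A D y * christoffel G D B C y)

/-- `K_{ABCD} = ⟨K(∂_A, ∂_B) ∂_C, ∂_D⟩`; with this sign `K_{ABAB} > 0` in positive sectional
curvature. -/
def curvature (A B C D : Fin n) (y : Coord n) : ℝ :=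
  ∑ E, curvatureUp G E A B C y * G y E D

/-- `(∇_E K)_{ABCD}`, components of the covariant derivative of the curvature tensor. -/
def covDerivCurvature (E A B C D : Fin n) (y : Coord n) : ℝ :=
  partialDeriv E (curvature G A B C D) y
    - ∑ P, (christoffel G P E A y * curvature G P B C D y
        + christoffel G P E B y * curvature G A P C D y
        + christoffel G P E C y * curvature G A B P D y
        + christoffel G P E D y * curvature G A B C P y)

/-- `K(u, v, w, z) = ⟨K(u, v) w, z⟩` for tangent vectors at `y`. -/
def curvatureOn (y : Coord n) (u v w z : Fin n → ℝ) : ℝ :=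
  ∑ A, ∑ B, ∑ C, ∑ D, curvature G A B C D y * u A * v B * w C * z D

/-- `(∇_X K)(u, v, w, z)` for tangent vectors at `y`. -/
def covDerivCurvatureOn (y : Coord n) (X u v w z : Fin n → ℝ) : ℝ :=
  ∑ E, ∑ A, ∑ B, ∑ C, ∑ D,
    covDerivCurvature G E A B C D y * X E * u A * v B * w C * z D

end Ambient

/-! ### Geometry of an immersion in local coordinates

`f` is an immersion written in local coordinates `x¹, …, xᵐ` of the source and `y¹, …, yⁿ` of the
target.  A vector field along `f` is given by its components `V : Coord m → Fin n → ℝ`. -/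

section Immersion

variable {m n : ℕ} (G : Coord n → Matrix (Fin n) (Fin n) ℝ) (f : Coord m → Coord n)

/-- The tangent vector `∂ᵢ = ∂f/∂xⁱ`. -/
def tangent (i : Fin m) (x : Coord m) : Fin n → ℝ :=
  fun A => partialDeriv i (fun z => f z A) x

/-- The induced metric `g_{ij} = ⟨∂ᵢ, ∂ⱼ⟩`. -/
def inducedMetric (x : Coord m) : Matrix (Fin m) (Fin m) ℝ :=
  Matrix.of fun i j => inner G (f x) (tangent f i x) (tangent f j x)

/-- The inverse `g^{ij}` of the induced metric. -/
def inducedInv (i j : Fin m) (x : Coord m) : ℝ :=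
  (inducedMetric G f x)⁻¹ i j

/-- The ambient covariant derivative in direction `∂ᵢ` of a vector field along `f`. -/
def covDeriv (i : Fin m) (V : Coord m → Fin n → ℝ) (x : Coord m) : Fin n → ℝ :=
  fun A => partialDeriv i (fun z => V z A) x
    + ∑ B, ∑ C, christoffel G A B C (f x) * tangent f i x B * V x C

/-- The coefficient of `∂ₖ` in the tangential part of `v`. -/
def tangentialCoeff (x : Coord m) (v : Fin n → ℝ) (k : Fin m) : ℝ :=
  ∑ l, inducedInv G f k l x * inner G (f x) v (tangent f l x)

/-- The normal part `v^N` of `v`. -/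
def normalPart (x : Coord m) (v : Fin n → ℝ) : Fin n → ℝ :=
  fun A => v A - ∑ k, tangentialCoeff G f x v k * tangent f k x A

/-- The coefficient of `∂ₖ` in the induced connection `∇_{∂ᵢ} ∂ⱼ`, the tangential part of the
ambient derivative. -/
def inducedConn (k i j : Fin m) (x : Coord m) : ℝ :=
  tangentialCoeff G f x (covDeriv G f i (tangent f j) x) k

/-- The second fundamental form `A(∂ᵢ, ∂ⱼ)`, the normal part of the ambient derivative of `∂ⱼ` in
direction `∂ᵢ`. -/
def secondFF (i j : Fin m) (x : Coord m) : Fin n → ℝ :=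
  normalPart G f x (covDeriv G f i (tangent f j) x)

/-- The mean curvature vector `H = g^{kl} A(∂ₖ, ∂ₗ)`. -/
def meanCurvature (x : Coord m) : Fin n → ℝ :=
  fun A => ∑ k, ∑ l, inducedInv G f k l x * secondFF G f k l x A

/-- The covariant derivative `(∇_{∂ₖ} A)(∂ᵢ, ∂ⱼ)`, a normal vector. -/
def covDerivSFF (k i j : Fin m) (x : Coord m) : Fin n → ℝ :=
  fun B => normalPart G f x (covDeriv G f k (secondFF G f i j) x) B
    - ∑ q, inducedConn G f q k i x * secondFF G f q j x B
    - ∑ q, inducedConn G f q k j x * secondFF G f i q x B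

/-- The second covariant derivative `(∇_{∂ₗ} ∇_{∂ₖ} A)(∂ᵢ, ∂ⱼ)` (a tensor in all four arguments),
a normal vector. -/
def covDeriv2SFF (l k i j : Fin m) (x : Coord m) : Fin n → ℝ :=
  fun B => normalPart G f x (covDeriv G f l (covDerivSFF G f k i j) x) B
    - ∑ q, inducedConn G f q l k x * covDerivSFF G f q i j x B
    - ∑ q, inducedConn G f q l i x * covDerivSFF G f k q j x B
    - ∑ q, inducedConn G f q l j x * covDerivSFF G f k i q x B

/-- The Laplacian `(ΔA)(∂ᵢ, ∂ⱼ) = g^{kl} (∇_{∂ₗ} ∇_{∂ₖ} A)(∂ᵢ, ∂ⱼ)`. -/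
def laplacianSFF (i j : Fin m) (x : Coord m) : Fin n → ℝ :=
  fun B => ∑ k, ∑ l, inducedInv G f k l x * covDeriv2SFF G f l k i j x B

/-- `|A|² = g^{ik} g^{jl} ⟨A(∂ᵢ, ∂ⱼ), A(∂ₖ, ∂ₗ)⟩`. -/
def normSqSFF (x : Coord m) : ℝ :=
  ∑ i, ∑ j, ∑ k, ∑ l, inducedInv G f i k x * inducedInv G f j l x *
    inner G (f x) (secondFF G f i j x) (secondFF G f k l x)

/-- `|∇A|²`. -/
def normSqCovDerivSFF (x : Coord m) : ℝ :=
  ∑ a, ∑ i, ∑ j, ∑ b, ∑ k, ∑ l,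
    inducedInv G f a b x * inducedInv G f i k x * inducedInv G f j l x *
      inner G (f x) (covDerivSFF G f a i j x) (covDerivSFF G f b k l x)

/-- The Laplace-Beltrami operator of the induced metric on functions,
`Δu = g^{kl} (∂ₖ ∂ₗ u - Γ^q_{kl} ∂_q u)`. -/
def laplaceBeltrami (u : Coord m → ℝ) (x : Coord m) : ℝ :=
  ∑ k, ∑ l, inducedInv G f k l x *
    (partialDeriv k (partialDeriv l u) x
      - ∑ q, inducedConn G f q k l x * partialDeriv q u x)

/-- `ν` is an orthonormal family of vectors normal to the immersed submanifold at `f x` (hence an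
orthonormal basis of the normal space when `r` is the codimension `n - m`). -/
structure IsNormalFrame {r : ℕ} (x : Coord m) (ν : Fin r → Fin n → ℝ) : Prop where
  orthonormal : ∀ α β, inner G (f x) (ν α) (ν β) = if α = β then 1 else 0
  normal : ∀ α i, inner G (f x) (ν α) (tangent f i x) = 0

/-- Coefficient `h_{αij} = ⟨A(∂ᵢ, ∂ⱼ), e_α⟩`, with `e_α = ν α`. -/
def hCoeff {r : ℕ} (x : Coord m) (ν : Fin r → Fin n → ℝ) (α : Fin r) (i j : Fin m) : ℝ :=
  inner G (f x) (secondFF G f i j x) (ν α)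

/-- Right-hand side of the evolution equation of `h_{αij}` at a point where the coordinate vectors
`∂ᵢ` are orthonormal; `ν` is the normal frame `e_α` and `dν α` is the ambient covariant derivative
`∇_H e_α` at that point. -/
def hEvolution {r : ℕ} (x : Coord m) (ν dν : Fin r → Fin n → ℝ) (α : Fin r) (i j : Fin m) : ℝ :=
  let K := curvatureOn G (f x)
  let DK := covDerivCurvatureOn G (f x)
  let E : Fin m → Fin n → ℝ := fun a => tangent f a x
  let h : Fin r → Fin m → Fin m → ℝ := hCoeff G f x ν
  let tr : Fin r → ℝ := fun β => ∑ k, h β k k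
  inner G (f x) (laplacianSFF G f i j x) (ν α)
    + ∑ k, DK (E k) (ν α) (E i) (E j) (E k)
    + ∑ k, DK (E j) (ν α) (E k) (E i) (E k)
    - 2 * ∑ l, ∑ k, K (E l) (E i) (E j) (E k) * h α l k
    + 2 * ∑ β, ∑ k, K (ν α) (ν β) (E j) (E k) * h β i k
    + 2 * ∑ β, ∑ k, K (ν α) (ν β) (E i) (E k) * h β j k
    - ∑ l, ∑ k, K (E l) (E k) (E i) (E k) * h α l j
    - ∑ l, ∑ k, K (E l) (E k) (E j) (E k) * h α l i
    + ∑ β, ∑ k, K (ν α) (E k) (ν β) (E k) * h β i j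
    - ∑ q, h α i q * ∑ γ, (h γ q j * tr γ - ∑ k, h γ q k * h γ j k)
    - ∑ q, ∑ k, h α q k * ∑ γ, (h γ q j * h γ i k - h γ q k * h γ i j)
    - ∑ β, ∑ k, h β i k * ∑ l, (h β l j * h α l k - h β l k * h α l j)
    - ∑ β, ∑ k, h α j k * h β i k * tr β
    + ∑ β, h β i j * inner G (f x) (ν β) (dν α)

/-- Right-hand side of the evolution equation of `|A|²` at a point where the coordinate vectors
`∂ᵢ` are orthonormal; `ν` is an orthonormal basis of the normal space there. -/
def normSqEvolution {r : ℕ} (x : Coord m) (ν : Fin r → Fin n → ℝ) : ℝ :=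
  let K := curvatureOn G (f x)
  let DK := covDerivCurvatureOn G (f x)
  let E : Fin m → Fin n → ℝ := fun a => tangent f a x
  let h : Fin r → Fin m → Fin m → ℝ := hCoeff G f x ν
  laplaceBeltrami G f (normSqSFF G f) x - 2 * normSqCovDerivSFF G f x
    + 2 * ∑ α, ∑ i, ∑ j, (∑ k, (DK (E k) (ν α) (E i) (E j) (E k)
        + DK (E j) (ν α) (E k) (E i) (E k))) * h α i j
    - 4 * ∑ α, ∑ i, ∑ j, ∑ l, ∑ k, K (E l) (E i) (E j) (E k) * h α l k * h α i j
    + 8 * ∑ α, ∑ i, ∑ j, ∑ β, ∑ k, K (ν α) (ν β) (E j) (E k) * h β i k * h α i j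
    - 4 * ∑ α, ∑ i, ∑ j, ∑ l, ∑ k, K (E l) (E k) (E i) (E k) * h α l j * h α i j
    + 2 * ∑ α, ∑ i, ∑ j, ∑ β, ∑ k, K (ν α) (E k) (ν β) (E k) * h β i j * h α i j
    + 2 * ∑ α, ∑ γ, ∑ i, ∑ q, (∑ k, (h α i k * h γ q k - h α q k * h γ i k)) ^ 2
    + 2 * ∑ i, ∑ j, ∑ q, ∑ k, (∑ α, h α i j * h α q k) ^ 2

end Immersion

/-! ### Mean curvature flow in a Riemannian manifold -/

section Flow

variable {m n : ℕ}
  {S : Type*} [TopologicalSpace S] [ChartedSpace (Coord m) S]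
  {M : Type*} [TopologicalSpace M] [ChartedSpace (Coord n) M] [IsManifold (𝓡 n) ∞ M]

/-- The matrix `G_{AB}` of a Riemannian metric in the chart `ψ`. -/
def metricInChart
    (g : Bundle.ContMDiffRiemannianMetric (𝓡 n) ∞ (Coord n) (fun y : M => TangentSpace (𝓡 n) y))
    (ψ : OpenPartialHomeomorph M (Coord n)) (y : Coord n) : Matrix (Fin n) (Fin n) ℝ :=
  Matrix.of fun A B => g.inner (ψ.symm y)
    (mfderiv (𝓡 n) (𝓡 n) ψ.symm y (EuclideanSpace.single A 1))
    (mfderiv (𝓡 n) (𝓡 n) ψ.symm y (EuclideanSpace.single B 1))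

/-- The map `F_s` written in the charts `φ` of the source and `ψ` of the target. -/
def inCharts (φ : OpenPartialHomeomorph S (Coord m)) (ψ : OpenPartialHomeomorph M (Coord n))
    (F : S → ℝ → M) (s : ℝ) (x : Coord m) : Coord n :=
  ψ (F (φ.symm x) s)

/-- `F : S × [0, T) → M` is a mean curvature flow: a smooth one-parameter family of immersions with
`dF/dt = H`, the last equation being read in local coordinates. -/
structure IsMeanCurvatureFlow
    (g : Bundle.ContMDiffRiemannianMetric (𝓡 n) ∞ (Coord n) (fun y : M => TangentSpace (𝓡 n) y))
    (T : ℝ) (F : S → ℝ → M) : Prop where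
  smooth : ContMDiffOn ((𝓡 m).prod 𝓘(ℝ, ℝ)) (𝓡 n) ∞ (fun q : S × ℝ => F q.1 q.2)
    (univ ×ˢ Ico 0 T)
  immersion : ∀ s ∈ Ico 0 T, ∀ p : S,
    Function.Injective (mfderiv (𝓡 m) (𝓡 n) (fun q : S => F q s) p)
  flow : ∀ φ ∈ IsManifold.maximalAtlas (𝓡 m) ∞ S, ∀ ψ ∈ IsManifold.maximalAtlas (𝓡 n) ∞ M,
    ∀ p ∈ φ.source, ∀ s ∈ Ico 0 T, F p s ∈ ψ.source → ∀ A : Fin n,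
      HasDerivWithinAt (fun s' => ψ (F p s') A)
        (meanCurvature (metricInChart g ψ) (inCharts φ ψ F s) (φ p) A) (Ico 0 T) s

/-- The ambient covariant derivative at time `t` of a vector field `s ↦ V s` along a curve passing
through `y` at time `t` with velocity `H` (the curve being defined for times in `I`). -/
def covDerivTime (G : Coord n → Matrix (Fin n) (Fin n) ℝ) (I : Set ℝ) (y : Coord n)
    (H : Fin n → ℝ) (V : ℝ → Fin n → ℝ) (t : ℝ) : Fin n → ℝ :=
  fun A => derivWithin (fun s => V s A) I t + ∑ B, ∑ C, christoffel G A B C y * H B * V t C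

end Flow

end MCF

end

/-! Everything is computed in charts, with `G` the matrix of the ambient metric. The device that
keeps the computation short is to treat A as a tensor with values in the pulled-back ambient tangent
bundle: `ambientDerivSFF` and `ambientDeriv2SFF` differentiate it with the ambient connection on
values and the induced connection on indices, without projecting onto the normal bundle. Commutators
then involve only the ambient curvature K and the induced curvature R, and the curvature of the
normal bundle need not be introduced.

Time derivative. Torsion-freeness gives D_t ∂_i = ∇_i H, and commuting D_t with ∇_j gives D_t ∇_j
∂_i = ∇_j ∇_i H − K(H, ∂_j)∂_i. Hence the normal part of D_t A(∂_i, ∂_j) is that of Hess H(∂_j, ∂_i)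
− K(H, ∂_j)∂_i (`IsFlowAt.exists_hasCovDerivWithinAt_secondFF`). Pairing with a moving normal frame
adds ⟨A(∂_i, ∂_j), ∇_H e_α⟩.

Simons' equation. The inverse metric is parallel, so Hess H is the trace of ∇_j ∇_i A_kk. Starting
from ∇_k ∇_k A_ij, the differentiated Codazzi equation leads to ∇_k ∇_j A_ki, the commutator to ∇_j
∇_k A_ki, and Codazzi again to ∇_j ∇_i A_kk (`sum_ambientDeriv2SFF`). The trace of K(A_kk, ∂_j)∂_i
is K(H, ∂_j)∂_i and cancels the curvature term of the time derivative. The Gauss equation turns R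
into K plus products of A, and passing from the ambient to the normal second derivative costs one
more cubic term (`inner_covDeriv2SFF`). Collecting these gives `simons`, hence part (1).

Squared norm. Under the flow g^{ij} has derivative 2⟨H, A_ij⟩ in orthonormal coordinates. Its
contribution to d|A|²/dt cancels the terms containing H among the cubic terms contracted with A; the
rest form the two sums of squares (`quartic_terms`). The Bochner formula
`laplaceBeltrami_sub_normSqCovDerivSFF` replaces 2⟨ΔA, A⟩ by Δ|A|² − 2|∇A|². No moving frame is
needed here, because |A|² is differentiated through the vectors A(∂_i, ∂_j) themselves. -/

noncomputable section

namespace MCF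

/-! ### Partial derivatives -/

section PartialDeriv

variable {k : ℕ} {U : Set (Coord k)} {u v : Coord k → ℝ} {x : Coord k} {i j : Fin k}

lemma partialDeriv_add (hu : DifferentiableAt ℝ u x) (hv : DifferentiableAt ℝ v x) :
    partialDeriv i (fun z => u z + v z) x = partialDeriv i u x + partialDeriv i v x := by
  simp [partialDeriv, fderiv_fun_add hu hv]

lemma partialDeriv_sub (hu : DifferentiableAt ℝ u x) (hv : DifferentiableAt ℝ v x) :
    partialDeriv i (fun z => u z - v z) x = partialDeriv i u x - partialDeriv i v x := by
  simp [partialDeriv, fderiv_fun_sub hu hv]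

lemma partialDeriv_mul (hu : DifferentiableAt ℝ u x) (hv : DifferentiableAt ℝ v x) :
    partialDeriv i (fun z => u z * v z) x
      = partialDeriv i u x * v x + u x * partialDeriv i v x := by
  simp [partialDeriv, fderiv_fun_mul hu hv]; ring

lemma partialDeriv_sum {ι : Type*} {s : Finset ι} {w : ι → Coord k → ℝ}
    (hw : ∀ a, DifferentiableAt ℝ (w a) x) :
    partialDeriv i (fun z => ∑ a ∈ s, w a z) x = ∑ a ∈ s, partialDeriv i (w a) x := by
  simp [partialDeriv, fderiv_fun_sum (fun a _ => hw a)]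

lemma partialDeriv_const (c : ℝ) : partialDeriv i (fun _ => c) x = 0 := by
  simp [partialDeriv]

lemma partialDeriv_congr (hU : IsOpen U) (hx : x ∈ U) (h : ∀ z ∈ U, u z = v z) :
    partialDeriv i u x = partialDeriv i v x := by
  have : u =ᶠ[𝓝 x] v := by filter_upwards [hU.mem_nhds hx] using h
  simp [partialDeriv, this.fderiv_eq]

lemma diffAt (hU : IsOpen U) (hu : ContDiffOn ℝ ∞ u U) (hx : x ∈ U) : DifferentiableAt ℝ u x :=
  (hu.contDiffAt (hU.mem_nhds hx)).differentiableAt (by simp)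

lemma contDiffOn_partialDeriv (hU : IsOpen U) (hu : ContDiffOn ℝ ∞ u U) (i : Fin k) :
    ContDiffOn ℝ ∞ (partialDeriv i u) U :=
  (hu.fderiv_of_isOpen hU (m := ∞) (by simp)).clm_apply contDiffOn_const

lemma partialDeriv_comm (hU : IsOpen U) (hu : ContDiffOn ℝ ∞ u U) (hx : x ∈ U) :
    partialDeriv i (partialDeriv j u) x = partialDeriv j (partialDeriv i u) x := by
  have hd : DifferentiableAt ℝ (fderiv ℝ u) x :=
    ((hu.fderiv_of_isOpen hU (m := ∞) (by simp)).contDiffAt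
      (hU.mem_nhds hx)).differentiableAt (by simp)
  have key : ∀ a b : Fin k, partialDeriv a (partialDeriv b u) x
      = fderiv ℝ (fderiv ℝ u) x (EuclideanSpace.single a 1) (EuclideanSpace.single b 1) := by
    intro a b
    unfold partialDeriv
    rw [fderiv_clm_apply hd (differentiableAt_const _)]
    simp
  rw [key, key]
  exact (hu.contDiffAt (hU.mem_nhds hx)).isSymmSndFDerivAt
    (by simpa using (WithTop.coe_le_coe.2 le_top : ((2 : ℕ∞) : WithTop ℕ∞) ≤ ∞)) _ _

lemma fderiv_eq_sum_partialDeriv (v : Coord k) :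
    fderiv ℝ u x v = ∑ a, partialDeriv a u x * v a := by
  conv_lhs => rw [← (EuclideanSpace.basisFun (Fin k) ℝ).sum_repr v]
  simp [partialDeriv, mul_comm]

end PartialDeriv

/-! ### The scalar product -/

section Inner

variable {n : ℕ} (G : Coord n → Matrix (Fin n) (Fin n) ℝ) (y : Coord n)

/-- The scalar product at `y` as a bilinear map. -/
def innerₗ : (Fin n → ℝ) →ₗ[ℝ] (Fin n → ℝ) →ₗ[ℝ] ℝ := Matrix.toBilin' (G y)

lemma inner_eq (u v : Fin n → ℝ) : inner G y u v = innerₗ G y u v := by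
  simp only [innerₗ, Matrix.toBilin'_apply, inner]
  exact Finset.sum_congr rfl fun A _ => Finset.sum_congr rfl fun B _ => by ring

variable {G y}

lemma inner_add_left (u u' v : Fin n → ℝ) :
    inner G y (u + u') v = inner G y u v + inner G y u' v := by simp [inner_eq]

lemma inner_sub_left (u u' v : Fin n → ℝ) :
    inner G y (u - u') v = inner G y u v - inner G y u' v := by simp [inner_eq]

lemma inner_neg_left (u v : Fin n → ℝ) : inner G y (-u) v = - inner G y u v := by simp [inner_eq]

lemma inner_smul_left (c : ℝ) (u v : Fin n → ℝ) : inner G y (c • u) v = c * inner G y u v := by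
  simp [inner_eq]

lemma inner_sum_left {ι : Type*} (s : Finset ι) (u : ι → Fin n → ℝ) (v : Fin n → ℝ) :
    inner G y (∑ a ∈ s, u a) v = ∑ a ∈ s, inner G y (u a) v := by simp [inner_eq]

lemma inner_add_right (u v v' : Fin n → ℝ) :
    inner G y u (v + v') = inner G y u v + inner G y u v' := by simp [inner_eq]

lemma inner_sub_right (u v v' : Fin n → ℝ) :
    inner G y u (v - v') = inner G y u v - inner G y u v' := by simp [inner_eq]

lemma inner_smul_right (c : ℝ) (u v : Fin n → ℝ) : inner G y u (c • v) = c * inner G y u v := by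
  simp [inner_eq]

lemma inner_sum_right {ι : Type*} (s : Finset ι) (u : Fin n → ℝ) (v : ι → Fin n → ℝ) :
    inner G y u (∑ a ∈ s, v a) = ∑ a ∈ s, inner G y u (v a) := by simp [inner_eq]

end Inner

/-! ### Christoffel symbols and curvature of a smooth metric -/

/-- `G` is a smooth nondegenerate symmetric matrix field on the open set `W`. -/
structure IsMetricOn {n : ℕ} (G : Coord n → Matrix (Fin n) (Fin n) ℝ) (W : Set (Coord n)) :
    Prop where
  isOpen : IsOpen W
  smooth : ∀ A B, ContDiffOn ℝ ∞ (fun y => G y A B) W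
  symm : ∀ y ∈ W, ∀ A B, G y A B = G y B A
  det_ne : ∀ y ∈ W, (G y).det ≠ 0

lemma contDiff_det (k : ℕ) :
    ContDiff ℝ ∞ (fun M : Fin k → Fin k → ℝ => (Matrix.of M).det) := by
  simp only [Matrix.det_apply, Matrix.of_apply]
  refine ContDiff.sum fun σ _ => ContDiff.const_smul _ ?_
  fun_prop

lemma contDiff_adjugate (k : ℕ) (i j : Fin k) :
    ContDiff ℝ ∞ (fun M : Fin k → Fin k → ℝ => (Matrix.of M).adjugate i j) := by
  simp only [Matrix.adjugate_apply]
  have h : ContDiff ℝ ∞ (fun M : Fin k → Fin k → ℝ =>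
      fun a b => ((Matrix.of M).updateRow j (Pi.single i 1)) a b) := by
    refine contDiff_pi.2 fun a => contDiff_pi.2 fun b => ?_
    simp only [Matrix.updateRow_apply, Matrix.of_apply]
    split_ifs <;> fun_prop
  exact (contDiff_det k).comp h

/-- Cramer's rule: an entry of the inverse is a polynomial divided by the determinant. Plain
functions of two indices serve as the domain because they carry a norm. -/
lemma contDiffAt_inv_apply {k : ℕ} (i j : Fin k) {M : Fin k → Fin k → ℝ}
    (hM : (Matrix.of M).det ≠ 0) :
    ContDiffAt ℝ ∞ (fun M : Fin k → Fin k → ℝ => (Matrix.of M)⁻¹ i j) M := by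
  have h : (fun M : Fin k → Fin k → ℝ => (Matrix.of M)⁻¹ i j)
      = fun M => ((Matrix.of M).det)⁻¹ * (Matrix.of M).adjugate i j := by
    funext M
    simp [Matrix.inv_def, Ring.inverse_eq_inv']
  rw [h]
  exact ((contDiff_det k).contDiffAt.inv hM).mul (contDiff_adjugate k i j).contDiffAt

lemma contDiffOn_inv_apply {E : Type*} [NormedAddCommGroup E] [NormedSpace ℝ E] {U : Set E} {k : ℕ}
    {M : E → Matrix (Fin k) (Fin k) ℝ} (hM : ∀ a b, ContDiffOn ℝ ∞ (fun x => M x a b) U)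
    (hd : ∀ x ∈ U, (M x).det ≠ 0) (i j : Fin k) : ContDiffOn ℝ ∞ (fun x => (M x)⁻¹ i j) U := by
  intro x hx
  have h1 : ContDiffWithinAt ℝ ∞ (fun x => (fun a b => M x a b : Fin k → Fin k → ℝ)) U x :=
    contDiffWithinAt_pi.2 fun a => contDiffWithinAt_pi.2 fun b => hM a b x hx
  exact (contDiffAt_inv_apply i j (M := fun a b => M x a b) (hd x hx)).comp_contDiffWithinAt x h1

section Ambient

variable {n : ℕ} {G : Coord n → Matrix (Fin n) (Fin n) ℝ} {W : Set (Coord n)} {y : Coord n}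

lemma inner_comm (hG : IsMetricOn G W) (hy : y ∈ W) (u v : Fin n → ℝ) :
    inner G y u v = inner G y v u := by
  unfold inner
  rw [Finset.sum_comm]
  refine Finset.sum_congr rfl fun A _ => Finset.sum_congr rfl fun B _ => ?_
  rw [hG.symm y hy]; ring

lemma contDiffOn_christoffel (hG : IsMetricOn G W) (A B C : Fin n) :
    ContDiffOn ℝ ∞ (christoffel G A B C) W := by
  have h1 := fun A B => contDiffOn_inv_apply hG.smooth hG.det_ne A B
  have h2 := fun A B C => contDiffOn_partialDeriv hG.isOpen (hG.smooth A B) C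
  unfold christoffel
  exact contDiffOn_const.mul (ContDiffOn.sum fun D _ =>
    (h1 _ _).mul (((h2 _ _ _).add (h2 _ _ _)).sub (h2 _ _ _)))

lemma christoffel_symm (hG : IsMetricOn G W) (hy : y ∈ W) (A B C : Fin n) :
    christoffel G A B C y = christoffel G A C B y := by
  unfold christoffel
  congr 1
  refine Finset.sum_congr rfl fun D _ => ?_
  rw [partialDeriv_congr (i := D) hG.isOpen hy fun z hz => hG.symm z hz B C]
  ring

/-- The Christoffel symbols of the first kind. -/
lemma sum_metric_mul_christoffel (hG : IsMetricOn G W) (hy : y ∈ W) (A B C : Fin n) :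
    ∑ E, G y A E * christoffel G E B C y = (1 / 2) *
      (partialDeriv B (fun z => G z A C) y + partialDeriv C (fun z => G z A B) y
        - partialDeriv A (fun z => G z B C) y) := by
  have h : G y * (G y)⁻¹ = 1 := Matrix.mul_nonsing_inv _ (hG.det_ne y hy).isUnit
  have h' : ∀ D, ∑ E, G y A E * (G y)⁻¹ E D = if A = D then 1 else 0 := by
    intro D
    rw [← Matrix.mul_apply, h, Matrix.one_apply]
  unfold christoffel
  simp only [Finset.mul_sum]
  rw [Finset.sum_comm]
  rw [Finset.sum_eq_single A]
  · have := h' A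
    simp only [if_true] at this
    rw [← one_mul (1 / 2 * _), ← this, Finset.sum_mul]
    exact Finset.sum_congr rfl fun E _ => by ring
  · intro D _ hD
    have := h' D
    rw [if_neg (Ne.symm hD)] at this
    trans (∑ E, G y A E * (G y)⁻¹ E D) * (1 / 2 * (partialDeriv B (fun z => G z D C) y
      + partialDeriv C (fun z => G z D B) y - partialDeriv D (fun z => G z B C) y))
    · rw [Finset.sum_mul]
      exact Finset.sum_congr rfl fun E _ => by ring
    · rw [this, zero_mul]
  · simp

/-- Metric compatibility in coordinates: in the sum of the two lowered Christoffel symbols all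
derivatives of `G` cancel but one. -/
lemma partialDeriv_metric (hG : IsMetricOn G W) (hy : y ∈ W) (A B C : Fin n) :
    partialDeriv C (fun z => G z A B) y
      = ∑ E, G y B E * christoffel G E C A y + ∑ E, G y A E * christoffel G E C B y := by
  rw [sum_metric_mul_christoffel hG hy, sum_metric_mul_christoffel hG hy,
    partialDeriv_congr (i := C) hG.isOpen hy fun z hz => hG.symm z hz B A,
    partialDeriv_congr (i := A) hG.isOpen hy fun z hz => hG.symm z hz B C,
    partialDeriv_congr (i := B) hG.isOpen hy fun z hz => hG.symm z hz A C]
  ring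

lemma contDiffOn_curvatureUp (hG : IsMetricOn G W) (E A B C : Fin n) :
    ContDiffOn ℝ ∞ (curvatureUp G E A B C) W := by
  have h1 := contDiffOn_christoffel hG
  have h2 := fun A B C D => contDiffOn_partialDeriv hG.isOpen (h1 A B C) D
  unfold curvatureUp
  exact ((h2 _ _ _ _).sub (h2 _ _ _ _)).add (ContDiffOn.sum fun D _ =>
    ((h1 _ _ _).mul (h1 _ _ _)).sub ((h1 _ _ _).mul (h1 _ _ _)))

lemma contDiffOn_curvature (hG : IsMetricOn G W) (A B C D : Fin n) :
    ContDiffOn ℝ ∞ (curvature G A B C D) W := by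
  unfold curvature
  exact ContDiffOn.sum fun E _ => (contDiffOn_curvatureUp hG _ _ _ _).mul (hG.smooth _ _)

lemma curvature_swap (A B C D : Fin n) : curvature G A B C D y = - curvature G B A C D y := by
  unfold curvature
  rw [← Finset.sum_neg_distrib]
  refine Finset.sum_congr rfl fun E _ => ?_
  unfold curvatureUp
  rw [← neg_mul]
  congr 1
  simp only [Finset.sum_sub_distrib]
  ring

/-- Torsion-freeness: with Γ symmetric in its lower indices, the ∂Γ terms and the ΓΓ terms cancel
separately in the cyclic sum, already before the index is lowered. -/
lemma curvature_bianchi (hG : IsMetricOn G W) (hy : y ∈ W) (A B C D : Fin n) :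
    curvature G A B C D y + curvature G B C A D y + curvature G C A B D y = 0 := by
  have hs := christoffel_symm hG hy
  have hd : ∀ P A B C, partialDeriv P (christoffel G A B C) y
      = partialDeriv P (christoffel G A C B) y := fun P A B C =>
    partialDeriv_congr hG.isOpen hy fun z hz => christoffel_symm hG hz A B C
  unfold curvature
  rw [← Finset.sum_add_distrib, ← Finset.sum_add_distrib]
  refine Finset.sum_eq_zero fun E _ => ?_
  unfold curvatureUp
  rw [← add_mul, ← add_mul]
  simp only [Finset.sum_sub_distrib]
  rw [hd B E A C, hd C E B A, hd A E C B]
  simp only [fun D => hs D C A, fun D => hs D B A, fun D => hs D C B]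
  ring

/-- The curvature tensor in terms of the Christoffel symbols of the first kind. -/
lemma curvature_eq_lower (hG : IsMetricOn G W) (hy : y ∈ W) (A B C D : Fin n) :
    curvature G A B C D y
      = partialDeriv B (fun z => ∑ E, G z D E * christoffel G E A C z) y
        - partialDeriv A (fun z => ∑ E, G z D E * christoffel G E B C z) y
        - ∑ E, (∑ P, G y E P * christoffel G P B D y) * christoffel G E A C y
        + ∑ E, (∑ P, G y E P * christoffel G P A D y) * christoffel G E B C y := by
  have hd : ∀ A B C, partialDeriv B (fun z => ∑ E, G z D E * christoffel G E A C z) y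
      = ∑ E, (∑ P, G y E P * christoffel G P B D y) * christoffel G E A C y
        + ∑ E, (∑ P, G y D P * christoffel G P B E y) * christoffel G E A C y
        + ∑ E, G y D E * partialDeriv B (christoffel G E A C) y := by
    intro A B C
    rw [partialDeriv_sum fun E => (diffAt hG.isOpen (hG.smooth D E) hy).fun_mul
      (diffAt hG.isOpen (contDiffOn_christoffel hG E A C) hy)]
    rw [← Finset.sum_add_distrib, ← Finset.sum_add_distrib]
    refine Finset.sum_congr rfl fun E _ => ?_
    rw [partialDeriv_mul (diffAt hG.isOpen (hG.smooth D E) hy)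
      (diffAt hG.isOpen (contDiffOn_christoffel hG E A C) hy), partialDeriv_metric hG hy]
    ring
  have hq : ∀ A B C, ∑ E, (∑ P, G y D P * christoffel G P B E y) * christoffel G E A C y
      = ∑ E, G y D E * ∑ P, christoffel G E B P y * christoffel G P A C y := by
    intro A B C
    simp only [Finset.mul_sum, Finset.sum_mul]
    rw [Finset.sum_comm]
    exact Finset.sum_congr rfl fun E _ => Finset.sum_congr rfl fun P _ => by ring
  rw [hd, hd, hq, hq]
  unfold curvature curvatureUp
  simp only [fun E => hG.symm y hy E D, Finset.sum_sub_distrib, add_mul, sub_mul,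
    Finset.sum_add_distrib]
  simp only [mul_comm _ (G y D _)]
  ring

/-- Symmetrising the lowered formula in `C` and `D` turns its first-order terms into second partial
derivatives of G_{CD}, which commute; the quadratic terms cancel because `G` is symmetric. -/
lemma curvature_swap_right (hG : IsMetricOn G W) (hy : y ∈ W) (A B C D : Fin n) :
    curvature G A B C D y = - curvature G A B D C y := by
  have hsm : ∀ A B D, DifferentiableAt ℝ (fun z => ∑ E, G z D E * christoffel G E A B z) y :=
    fun A B D => diffAt hG.isOpen (ContDiffOn.sum fun E _ => (hG.smooth D E).mul
      (contDiffOn_christoffel hG E A B)) hy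
  have h1 : ∀ A B, partialDeriv B (fun z => ∑ E, G z D E * christoffel G E A C z) y
      + partialDeriv B (fun z => ∑ E, G z C E * christoffel G E A D z) y
      = partialDeriv B (partialDeriv A (fun z => G z C D)) y := by
    intro A B
    rw [← partialDeriv_add (hsm _ _ _) (hsm _ _ _)]
    exact partialDeriv_congr hG.isOpen hy fun z hz => (partialDeriv_metric hG hz C D A).symm
  have h2 : ∀ A B C D, ∑ E, (∑ P, G y E P * christoffel G P B D y) * christoffel G E A C y
      = ∑ E, (∑ P, G y E P * christoffel G P A C y) * christoffel G E B D y := by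
    intro A B C D
    simp only [Finset.sum_mul]
    rw [Finset.sum_comm]
    refine Finset.sum_congr rfl fun E _ => Finset.sum_congr rfl fun P _ => ?_
    rw [hG.symm y hy P E]; ring
  rw [curvature_eq_lower hG hy, curvature_eq_lower hG hy, h2 A B C D, h2 A B D C]
  have h3 := partialDeriv_comm (i := A) (j := B) hG.isOpen (hG.smooth C D) hy
  linarith [h1 A B, h1 B A]

/-- Pair symmetry combined with both antisymmetries, from the usual combination of four Bianchi
identities. Reversal is the convenient form: it moves a normal vector from the last slot, where
Codazzi puts it, to the first slot, where the evolution equations have it. -/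
lemma curvature_reverse (hG : IsMetricOn G W) (hy : y ∈ W) (A B C D : Fin n) :
    curvature G A B C D y = curvature G D C B A y := by
  have b := curvature_bianchi hG hy
  have s := fun A B C D => curvature_swap (G := G) (y := y) A B C D
  have r := curvature_swap_right hG hy
  linarith [b A B C D, b B C D A, b C D A B, b D A B C, s A B C D, s D C B A, r A B C D,
    r D C B A, s B C A D, r B C A D, s C A B D, r C A B D, s B C D A, s C D B A, r C D B A,
    s D B C A, r D B C A, s C D A B, r C D A B, s D A C B, r D A C B, s A C D B, r A C D B,
    s A B D C, s B D A C, r B D A C, s D A B C, r D A B C, s B D C A, s A C B D, r A C B D]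

lemma covDerivCurvature_reverse (hG : IsMetricOn G W) (hy : y ∈ W) (E A B C D : Fin n) :
    covDerivCurvature G E A B C D y = covDerivCurvature G E D C B A y := by
  unfold covDerivCurvature
  have h := curvature_reverse hG hy
  rw [partialDeriv_congr hG.isOpen hy fun z hz => curvature_reverse hG hz A B C D]
  congr 1
  refine Finset.sum_congr rfl fun P _ => ?_
  rw [h P B C D, h A P C D, h A B P D, h A B C P]
  ring

end Ambient

/-! ### Contractions of the Christoffel symbols and of the curvature tensor -/

section Contractions

variable {n : ℕ} (G : Coord n → Matrix (Fin n) (Fin n) ℝ) (y : Coord n)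

/-- The vector `Γ^A_{BC} u^B v^C`. -/
def christoffelOn (u v : Fin n → ℝ) : Fin n → ℝ :=
  fun A => ∑ B, ∑ C, christoffel G A B C y * u B * v C

/-- The vector `∂_D Γ^A_{BC} a^D u^B v^C`. -/
def christoffelDerivOn (a u v : Fin n → ℝ) : Fin n → ℝ :=
  fun A => ∑ B, ∑ C, (∑ D, partialDeriv D (christoffel G A B C) y * a D) * u B * v C

/-- The vector `K(u, v) w`. -/
def curvatureVec (u v w : Fin n → ℝ) : Fin n → ℝ :=
  fun E => ∑ A, ∑ B, ∑ C, curvatureUp G E A B C y * u A * v B * w C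

variable {G y}

lemma christoffelOn_add_right (u v v' : Fin n → ℝ) :
    christoffelOn G y u (v + v') = christoffelOn G y u v + christoffelOn G y u v' := by
  funext A
  simp [christoffelOn, mul_add, Finset.sum_add_distrib]

lemma christoffelOn_sub_right (u v v' : Fin n → ℝ) :
    christoffelOn G y u (v - v') = christoffelOn G y u v - christoffelOn G y u v' := by
  funext A
  simp [christoffelOn, mul_sub, Finset.sum_sub_distrib]

lemma christoffelOn_smul_right (c : ℝ) (u v : Fin n → ℝ) :
    christoffelOn G y u (c • v) = c • christoffelOn G y u v := by
  funext A
  simp only [christoffelOn, Pi.smul_apply, smul_eq_mul, Finset.mul_sum]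
  exact Finset.sum_congr rfl fun _ _ => Finset.sum_congr rfl fun _ _ => by ring

lemma christoffelOn_sum_right {ι : Type*} (s : Finset ι) (u : Fin n → ℝ) (v : ι → Fin n → ℝ) :
    christoffelOn G y u (∑ a ∈ s, v a) = ∑ a ∈ s, christoffelOn G y u (v a) := by
  classical
  induction s using Finset.induction_on with
  | empty => funext A; simp [christoffelOn]
  | insert a s ha ih => rw [Finset.sum_insert ha, Finset.sum_insert ha,
      christoffelOn_add_right, ih]

lemma christoffelOn_comm {W : Set (Coord n)} (hG : IsMetricOn G W) (hy : y ∈ W)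
    (u v : Fin n → ℝ) : christoffelOn G y u v = christoffelOn G y v u := by
  funext A
  unfold christoffelOn
  rw [Finset.sum_comm]
  refine Finset.sum_congr rfl fun B _ => Finset.sum_congr rfl fun C _ => ?_
  rw [christoffel_symm hG hy]; ring

lemma christoffelDerivOn_comm {W : Set (Coord n)} (hG : IsMetricOn G W) (hy : y ∈ W)
    (a u v : Fin n → ℝ) : christoffelDerivOn G y a u v = christoffelDerivOn G y a v u := by
  funext A
  unfold christoffelDerivOn
  rw [Finset.sum_comm]
  refine Finset.sum_congr rfl fun B _ => Finset.sum_congr rfl fun C _ => ?_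
  rw [mul_right_comm]
  congr 2
  exact Finset.sum_congr rfl fun D _ => by
    rw [partialDeriv_congr hG.isOpen hy fun z hz => christoffel_symm hG hz A C B]

/-- The curvature in terms of the connection matrices. -/
lemma curvatureVec_eq (a b v : Fin n → ℝ) :
    christoffelDerivOn G y a b v - christoffelDerivOn G y b a v
      + christoffelOn G y a (christoffelOn G y b v)
      - christoffelOn G y b (christoffelOn G y a v) = - curvatureVec G y a b v := by
  -- All contractions are written over the same ordered indices, so that the claim reduces to the
  -- coefficient formula defining `curvatureUp`.
  have h1 : ∀ E a b, christoffelDerivOn G y a b v E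
      = ∑ A, ∑ B, ∑ C, partialDeriv A (christoffel G E B C) y * a A * b B * v C := by
    intro E a b
    simp only [christoffelDerivOn, Finset.sum_mul]
    simp only [← Fintype.sum_prod_type']
    exact Finset.sum_nbij' (fun (B, C, A) => (A, B, C)) (fun (A, B, C) => (B, C, A))
      (by simp) (by simp) (by simp) (by simp) (fun _ _ => by ring)
  have h2 : ∀ E a b, christoffelOn G y a (christoffelOn G y b v) E
      = ∑ A, ∑ B, ∑ C, ∑ D, christoffel G E A D y * christoffel G D B C y * a A * b B * v C := by
    intro E a b
    simp only [christoffelOn, Finset.mul_sum]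
    simp only [← Fintype.sum_prod_type']
    exact Finset.sum_nbij' (fun (A, D, B, C) => (A, B, C, D)) (fun (A, B, C, D) => (A, D, B, C))
      (by simp) (by simp) (by simp) (by simp) (fun _ _ => by ring)
  have h3 : ∀ F : Fin n → Fin n → Fin n → ℝ,
      ∑ A, ∑ B, ∑ C, F A B C = ∑ B, ∑ A, ∑ C, F A B C := fun F => Finset.sum_comm
  funext E
  simp only [Pi.add_apply, Pi.sub_apply, Pi.neg_apply]
  rw [h1, h1, h2, h2, h3 fun A B C => partialDeriv A (christoffel G E B C) y * b A * a B * v C,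
    h3 fun A B C => ∑ D, christoffel G E A D y * christoffel G D B C y * b A * a B * v C]
  simp only [curvatureVec, ← Finset.sum_sub_distrib, ← Finset.sum_add_distrib,
    ← Finset.sum_neg_distrib]
  refine Finset.sum_congr rfl fun A _ => Finset.sum_congr rfl fun B _ =>
    Finset.sum_congr rfl fun C _ => ?_
  simp only [curvatureUp, Finset.sum_sub_distrib, add_mul, sub_mul, Finset.sum_mul]
  simp only [mul_right_comm _ (b B) (a A)]
  ring

lemma inner_curvatureVec (u v w z : Fin n → ℝ) :
    inner G y (curvatureVec G y u v w) z = curvatureOn G y u v w z := by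
  simp only [inner, curvatureVec, curvatureOn, curvature, Finset.mul_sum, Finset.sum_mul]
  simp only [← Fintype.sum_prod_type']
  exact Finset.sum_nbij' (fun (E, D, A, B, C) => (A, B, C, D, E))
    (fun (A, B, C, D, E) => (E, D, A, B, C)) (by simp) (by simp) (by simp) (by simp)
    (fun _ _ => by ring)

variable (G y)

/-- Linearity in each slot is what lets A(∂_i, ∂_j), H and ∇_i ∂_j be expanded in a frame inside K.
-/
lemma isLinearMap_curvatureOn₁ (v w z : Fin n → ℝ) :
    IsLinearMap ℝ fun u => curvatureOn G y u v w z where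
  map_add u u' := by simp [curvatureOn, mul_add, add_mul, Finset.sum_add_distrib]
  map_smul c u := by
    simp only [curvatureOn, Pi.smul_apply, smul_eq_mul, Finset.mul_sum]
    simp only [← Fintype.sum_prod_type']
    exact Finset.sum_congr rfl fun _ _ => by ring

lemma isLinearMap_curvatureOn₂ (u w z : Fin n → ℝ) :
    IsLinearMap ℝ fun v => curvatureOn G y u v w z where
  map_add v v' := by simp [curvatureOn, mul_add, add_mul, Finset.sum_add_distrib]
  map_smul c v := by
    simp only [curvatureOn, Pi.smul_apply, smul_eq_mul, Finset.mul_sum]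
    simp only [← Fintype.sum_prod_type']
    exact Finset.sum_congr rfl fun _ _ => by ring

lemma isLinearMap_curvatureOn₃ (u v z : Fin n → ℝ) :
    IsLinearMap ℝ fun w => curvatureOn G y u v w z where
  map_add w w' := by simp [curvatureOn, mul_add, add_mul, Finset.sum_add_distrib]
  map_smul c w := by
    simp only [curvatureOn, Pi.smul_apply, smul_eq_mul, Finset.mul_sum]
    simp only [← Fintype.sum_prod_type']
    exact Finset.sum_congr rfl fun _ _ => by ring

lemma isLinearMap_curvatureOn₄ (u v w : Fin n → ℝ) :
    IsLinearMap ℝ fun z => curvatureOn G y u v w z where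
  map_add z z' := by simp [curvatureOn, mul_add, Finset.sum_add_distrib]
  map_smul c z := by
    simp only [curvatureOn, Pi.smul_apply, smul_eq_mul, Finset.mul_sum]
    simp only [← Fintype.sum_prod_type']
    exact Finset.sum_congr rfl fun _ _ => by ring

/-- The derivative `∂_P K_{ABCD} a^P` contracted with four vectors. -/
def curvatureDerivOn (a u v w z : Fin n → ℝ) : ℝ :=
  ∑ A, ∑ B, ∑ C, ∑ D, (∑ P, partialDeriv P (curvature G A B C D) y * a P)
    * u A * v B * w C * z D

/-- Separates the componentwise derivative of K from one Christoffel correction per slot; along a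
curve these corrections are absorbed by the covariant derivatives of the four arguments. -/
lemma covDerivCurvatureOn_eq (a u v w z : Fin n → ℝ) :
    covDerivCurvatureOn G y a u v w z = curvatureDerivOn G y a u v w z
      - curvatureOn G y (christoffelOn G y a u) v w z
      - curvatureOn G y u (christoffelOn G y a v) w z
      - curvatureOn G y u v (christoffelOn G y a w) z
      - curvatureOn G y u v w (christoffelOn G y a z) := by
  have h0 : curvatureDerivOn G y a u v w z = ∑ E, ∑ A, ∑ B, ∑ C, ∑ D,
      partialDeriv E (curvature G A B C D) y * a E * u A * v B * w C * z D := by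
    simp only [curvatureDerivOn, Finset.sum_mul]
    simp only [← Fintype.sum_prod_type']
    exact Finset.sum_nbij' (fun (A, B, C, D, P) => (P, A, B, C, D))
      (fun (P, A, B, C, D) => (A, B, C, D, P)) (by simp) (by simp) (by simp) (by simp)
      (fun _ _ => by ring)
  have h1 : curvatureOn G y (christoffelOn G y a u) v w z = ∑ E, ∑ A, ∑ B, ∑ C, ∑ D,
      (∑ P, christoffel G P E A y * curvature G P B C D y)
        * a E * u A * v B * w C * z D := by
    simp only [curvatureOn, christoffelOn, Finset.mul_sum, Finset.sum_mul]
    simp only [← Fintype.sum_prod_type']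
    exact Finset.sum_nbij' (fun (P, B, C, D, E, A) => (E, A, B, C, D, P))
      (fun (E, A, B, C, D, P) => (P, B, C, D, E, A)) (by simp) (by simp) (by simp) (by simp)
      (fun _ _ => by ring)
  have h2 : curvatureOn G y u (christoffelOn G y a v) w z = ∑ E, ∑ A, ∑ B, ∑ C, ∑ D,
      (∑ P, christoffel G P E B y * curvature G A P C D y)
        * a E * u A * v B * w C * z D := by
    simp only [curvatureOn, christoffelOn, Finset.mul_sum, Finset.sum_mul]
    simp only [← Fintype.sum_prod_type']
    exact Finset.sum_nbij' (fun (A, P, C, D, E, B) => (E, A, B, C, D, P))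
      (fun (E, A, B, C, D, P) => (A, P, C, D, E, B)) (by simp) (by simp) (by simp) (by simp)
      (fun _ _ => by ring)
  have h3 : curvatureOn G y u v (christoffelOn G y a w) z = ∑ E, ∑ A, ∑ B, ∑ C, ∑ D,
      (∑ P, christoffel G P E C y * curvature G A B P D y)
        * a E * u A * v B * w C * z D := by
    simp only [curvatureOn, christoffelOn, Finset.mul_sum, Finset.sum_mul]
    simp only [← Fintype.sum_prod_type']
    exact Finset.sum_nbij' (fun (A, B, P, D, E, C) => (E, A, B, C, D, P))
      (fun (E, A, B, C, D, P) => (A, B, P, D, E, C)) (by simp) (by simp) (by simp) (by simp)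
      (fun _ _ => by ring)
  have h4 : curvatureOn G y u v w (christoffelOn G y a z) = ∑ E, ∑ A, ∑ B, ∑ C, ∑ D,
      (∑ P, christoffel G P E D y * curvature G A B C P y)
        * a E * u A * v B * w C * z D := by
    simp only [curvatureOn, christoffelOn, Finset.mul_sum]
    simp only [Finset.sum_mul]
    simp only [← Fintype.sum_prod_type']
    exact Finset.sum_nbij' (fun (A, B, C, P, E, D) => (E, A, B, C, D, P))
      (fun (E, A, B, C, D, P) => (A, B, C, P, E, D)) (by simp) (by simp) (by simp) (by simp)
      (fun _ _ => by ring)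
  rw [h0, h1, h2, h3, h4]
  simp only [covDerivCurvatureOn, covDerivCurvature, Finset.sum_add_distrib, sub_mul, add_mul,
    Finset.sum_sub_distrib]
  ring

variable {G y}

lemma curvatureOn_swap (u v w z : Fin n → ℝ) :
    curvatureOn G y u v w z = - curvatureOn G y v u w z := by
  unfold curvatureOn
  rw [Finset.sum_comm]
  simp only [← Finset.sum_neg_distrib]
  simp only [← Fintype.sum_prod_type']
  refine Finset.sum_congr rfl fun x _ => ?_
  rw [curvature_swap]; ring

lemma curvatureOn_reverse {W : Set (Coord n)} (hG : IsMetricOn G W) (hy : y ∈ W)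
    (u v w z : Fin n → ℝ) : curvatureOn G y u v w z = curvatureOn G y z w v u := by
  unfold curvatureOn
  simp only [← Fintype.sum_prod_type']
  refine Finset.sum_nbij' (fun (A, B, C, D) => (D, C, B, A))
    (fun (A, B, C, D) => (D, C, B, A)) (by simp) (by simp) (by simp) (by simp) (fun x _ => ?_)
  rw [curvature_reverse hG hy]; ring

lemma curvatureOn_bianchi {W : Set (Coord n)} (hG : IsMetricOn G W) (hy : y ∈ W)
    (u v w z : Fin n → ℝ) :
    curvatureOn G y u v w z + curvatureOn G y v w u z + curvatureOn G y w u v z = 0 := by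
  have h1 : curvatureOn G y v w u z
      = ∑ A, ∑ B, ∑ C, ∑ D, curvature G B C A D y * u A * v B * w C * z D := by
    unfold curvatureOn
    simp only [← Fintype.sum_prod_type']
    exact Finset.sum_nbij' (fun (B, C, A, D) => (A, B, C, D))
      (fun (A, B, C, D) => (B, C, A, D)) (by simp) (by simp) (by simp) (by simp)
      (fun x _ => by ring)
  have h2 : curvatureOn G y w u v z
      = ∑ A, ∑ B, ∑ C, ∑ D, curvature G C A B D y * u A * v B * w C * z D := by
    unfold curvatureOn
    simp only [← Fintype.sum_prod_type']
    exact Finset.sum_nbij' (fun (C, A, B, D) => (A, B, C, D))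
      (fun (A, B, C, D) => (C, A, B, D)) (by simp) (by simp) (by simp) (by simp)
      (fun x _ => by ring)
  rw [h1, h2]
  unfold curvatureOn
  simp only [← Finset.sum_add_distrib, ← add_mul, curvature_bianchi hG hy]
  simp

lemma covDerivCurvatureOn_reverse {W : Set (Coord n)} (hG : IsMetricOn G W) (hy : y ∈ W)
    (a u v w z : Fin n → ℝ) :
    covDerivCurvatureOn G y a u v w z = covDerivCurvatureOn G y a z w v u := by
  unfold covDerivCurvatureOn
  simp only [← Fintype.sum_prod_type']
  refine Finset.sum_nbij' (fun (E, A, B, C, D) => (E, D, C, B, A))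
    (fun (E, A, B, C, D) => (E, D, C, B, A)) (by simp) (by simp) (by simp) (by simp)
    (fun x _ => ?_)
  rw [covDerivCurvature_reverse hG hy]; ring

end Contractions

/-! ### Covariant derivatives along a curve -/

section Curve

variable {n : ℕ} {G : Coord n → Matrix (Fin n) (Fin n) ℝ} {W : Set (Coord n)}
  {J : Set ℝ} {t : ℝ} {c : ℝ → Coord n} {c' : Fin n → ℝ}

/-- Derivatives are taken within a set `J` so that one calculus serves both coordinate lines, with
`J = univ`, and trajectories on a half-open time interval. -/
lemma hasDerivWithinAt_comp_curve {w : Coord n → ℝ} (hw : DifferentiableAt ℝ w (c t))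
    (hc : ∀ A, HasDerivWithinAt (fun s => c s A) (c' A) J t) :
    HasDerivWithinAt (fun s => w (c s)) (∑ D, partialDeriv D w (c t) * c' D) J t := by
  have h1 : HasDerivWithinAt c (WithLp.toLp 2 c') J t := by
    have h0 : HasDerivWithinAt (fun s => (fun A => c s A : Fin n → ℝ)) c' J t :=
      hasDerivWithinAt_pi.2 hc
    exact (PiLp.continuousLinearEquiv 2 ℝ (fun _ : Fin n => ℝ)).symm.hasFDerivAt
      |>.comp_hasDerivWithinAt t h0
  have h2 := hw.hasFDerivAt.comp_hasDerivWithinAt t h1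
  rw [fderiv_eq_sum_partialDeriv] at h2
  exact h2

/-- The vector field `s ↦ V s` along the curve `c` has covariant derivative `V'` at time `t`, the
velocity of `c` there being `c'`. -/
def HasCovDerivWithinAt (G : Coord n → Matrix (Fin n) (Fin n) ℝ) (c : ℝ → Coord n)
    (c' : Fin n → ℝ) (V : ℝ → Fin n → ℝ) (V' : Fin n → ℝ) (J : Set ℝ) (t : ℝ) : Prop :=
  ∀ A, HasDerivWithinAt (fun s => V s A) (V' A - christoffelOn G (c t) c' (V t) A) J t

lemma sum_partialDeriv_metric (hG : IsMetricOn G W) {y : Coord n} (hy : y ∈ W)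
    (a u v : Fin n → ℝ) :
    ∑ A, ∑ B, (∑ D, partialDeriv D (fun z => G z A B) y * a D) * u A * v B
      = inner G y (christoffelOn G y a u) v + inner G y u (christoffelOn G y a v) := by
  have h1 : inner G y (christoffelOn G y a u) v
      = ∑ A, ∑ B, (∑ D, (∑ E, G y B E * christoffel G E D A y) * a D) * u A * v B := by
    rw [inner_comm hG hy]
    simp only [inner, christoffelOn, Finset.mul_sum, Finset.sum_mul]
    simp only [← Fintype.sum_prod_type']
    exact Finset.sum_nbij' (fun (B, E, D, A) => (A, B, D, E)) (fun (A, B, D, E) => (B, E, D, A))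
      (by simp) (by simp) (by simp) (by simp) (fun _ _ => by ring)
  have h2 : inner G y u (christoffelOn G y a v)
      = ∑ A, ∑ B, (∑ D, (∑ E, G y A E * christoffel G E D B y) * a D) * u A * v B := by
    simp only [inner, christoffelOn, Finset.mul_sum, Finset.sum_mul]
    simp only [← Fintype.sum_prod_type']
    exact Finset.sum_nbij' (fun (A, E, D, B) => (A, B, D, E)) (fun (A, B, D, E) => (A, E, D, B))
      (by simp) (by simp) (by simp) (by simp) (fun _ _ => by ring)
  rw [h1, h2]
  simp only [partialDeriv_metric hG hy, add_mul, Finset.sum_add_distrib]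

/-- The Levi-Civita connection is compatible with the metric. -/
lemma HasCovDerivWithinAt.inner (hG : IsMetricOn G W) (hc : c t ∈ W)
    (hc' : ∀ A, HasDerivWithinAt (fun s => c s A) (c' A) J t)
    {V X : ℝ → Fin n → ℝ} {V' X' : Fin n → ℝ}
    (hV : HasCovDerivWithinAt G c c' V V' J t) (hX : HasCovDerivWithinAt G c c' X X' J t) :
    HasDerivWithinAt (fun s => MCF.inner G (c s) (V s) (X s))
      (MCF.inner G (c t) V' (X t) + MCF.inner G (c t) (V t) X') J t := by
  have h : HasDerivWithinAt (fun s => MCF.inner G (c s) (V s) (X s))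
      (∑ A, ∑ B, (((∑ D, partialDeriv D (fun z => G z A B) (c t) * c' D) * V t A
        + G (c t) A B * (V' A - christoffelOn G (c t) c' (V t) A)) * X t B
        + G (c t) A B * V t A * (X' B - christoffelOn G (c t) c' (X t) B))) J t := by
    refine HasDerivWithinAt.fun_sum fun A _ => HasDerivWithinAt.fun_sum fun B _ => ?_
    exact ((hasDerivWithinAt_comp_curve (w := fun z => G z A B)
      (diffAt hG.isOpen (hG.smooth A B) hc) hc').fun_mul (hV A)).fun_mul (hX B)
  convert h using 1
  -- The derivative of `G` along the curve supplies exactly the two Christoffel terms that are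
  -- subtracted in the componentwise derivatives of `V` and `X`.
  have e := sum_partialDeriv_metric hG hc c' (V t) (X t)
  have e1 : MCF.inner G (c t) V' (X t) = MCF.inner G (c t) (V' - christoffelOn G (c t) c' (V t))
      (X t) + MCF.inner G (c t) (christoffelOn G (c t) c' (V t)) (X t) := by
    rw [inner_sub_left]; ring
  have e2 : MCF.inner G (c t) (V t) X' = MCF.inner G (c t) (V t)
      (X' - christoffelOn G (c t) c' (X t))
      + MCF.inner G (c t) (V t) (christoffelOn G (c t) c' (X t)) := by
    rw [inner_sub_right]; ring
  rw [e1, e2]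
  have e3 : ∀ p q r s : ℝ, p + q + (r + s) = p + r + (q + s) := fun p q r s => by ring
  rw [e3, ← e]
  simp only [MCF.inner, ← Finset.sum_add_distrib, Pi.sub_apply]
  exact Finset.sum_congr rfl fun A _ => Finset.sum_congr rfl fun B _ => by ring

end Curve

/-! ### Leibniz rules along a curve for Christoffel and curvature contractions -/

section CurveRules

variable {n : ℕ} {G : Coord n → Matrix (Fin n) (Fin n) ℝ} {W : Set (Coord n)}
  {J : Set ℝ} {t : ℝ} {c : ℝ → Coord n} {c' : Fin n → ℝ}

lemma hasDerivWithinAt_christoffelOn (hG : IsMetricOn G W) (hc : c t ∈ W)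
    (hc' : ∀ A, HasDerivWithinAt (fun s => c s A) (c' A) J t)
    {X Y : ℝ → Fin n → ℝ} {X' Y' : Fin n → ℝ}
    (hX : ∀ A, HasDerivWithinAt (fun s => X s A) (X' A) J t)
    (hY : ∀ A, HasDerivWithinAt (fun s => Y s A) (Y' A) J t) (A : Fin n) :
    HasDerivWithinAt (fun s => christoffelOn G (c s) (X s) (Y s) A)
      ((christoffelDerivOn G (c t) c' (X t) (Y t) + christoffelOn G (c t) X' (Y t)
        + christoffelOn G (c t) (X t) Y') A) J t := by
  have h : HasDerivWithinAt (fun s => christoffelOn G (c s) (X s) (Y s) A)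
      (∑ B, ∑ C, (((∑ D, partialDeriv D (christoffel G A B C) (c t) * c' D) * X t B
        + christoffel G A B C (c t) * X' B) * Y t C
        + christoffel G A B C (c t) * X t B * Y' C)) J t := by
    refine HasDerivWithinAt.fun_sum fun B _ => HasDerivWithinAt.fun_sum fun C _ => ?_
    exact ((hasDerivWithinAt_comp_curve
      (diffAt hG.isOpen (contDiffOn_christoffel hG A B C) hc) hc').fun_mul (hX B)).fun_mul (hY C)
  convert h using 1
  simp only [Pi.add_apply, christoffelDerivOn, christoffelOn, ← Finset.sum_add_distrib]
  exact Finset.sum_congr rfl fun A _ => Finset.sum_congr rfl fun B _ => by ring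

lemma hasDerivWithinAt_curvatureOn (hG : IsMetricOn G W) (hc : c t ∈ W)
    (hc' : ∀ A, HasDerivWithinAt (fun s => c s A) (c' A) J t)
    {X Y Z V : ℝ → Fin n → ℝ} {X' Y' Z' V' : Fin n → ℝ}
    (hX : HasCovDerivWithinAt G c c' X X' J t) (hY : HasCovDerivWithinAt G c c' Y Y' J t)
    (hZ : HasCovDerivWithinAt G c c' Z Z' J t) (hV : HasCovDerivWithinAt G c c' V V' J t) :
    HasDerivWithinAt (fun s => curvatureOn G (c s) (X s) (Y s) (Z s) (V s))
      (covDerivCurvatureOn G (c t) c' (X t) (Y t) (Z t) (V t)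
        + curvatureOn G (c t) X' (Y t) (Z t) (V t) + curvatureOn G (c t) (X t) Y' (Z t) (V t)
        + curvatureOn G (c t) (X t) (Y t) Z' (V t) + curvatureOn G (c t) (X t) (Y t) (Z t) V')
      J t := by
  have h : HasDerivWithinAt (fun s => curvatureOn G (c s) (X s) (Y s) (Z s) (V s))
      (∑ A, ∑ B, ∑ C, ∑ D, (((((∑ P, partialDeriv P (curvature G A B C D) (c t) * c' P) * X t A
        + curvature G A B C D (c t) * (X' - christoffelOn G (c t) c' (X t)) A) * Y t B
        + curvature G A B C D (c t) * X t A * (Y' - christoffelOn G (c t) c' (Y t)) B) * Z t C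
        + curvature G A B C D (c t) * X t A * Y t B * (Z' - christoffelOn G (c t) c' (Z t)) C)
          * V t D
        + curvature G A B C D (c t) * X t A * Y t B * Z t C
          * (V' - christoffelOn G (c t) c' (V t)) D)) J t := by
    refine HasDerivWithinAt.fun_sum fun A _ => HasDerivWithinAt.fun_sum fun B _ =>
      HasDerivWithinAt.fun_sum fun C _ => HasDerivWithinAt.fun_sum fun D _ => ?_
    exact ((((hasDerivWithinAt_comp_curve (diffAt hG.isOpen (contDiffOn_curvature hG A B C D) hc)
      hc').fun_mul (hX A)).fun_mul (hY B)).fun_mul (hZ C)).fun_mul (hV D)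
  convert h using 1
  trans curvatureDerivOn G (c t) c' (X t) (Y t) (Z t) (V t)
    + curvatureOn G (c t) (X' - christoffelOn G (c t) c' (X t)) (Y t) (Z t) (V t)
    + curvatureOn G (c t) (X t) (Y' - christoffelOn G (c t) c' (Y t)) (Z t) (V t)
    + curvatureOn G (c t) (X t) (Y t) (Z' - christoffelOn G (c t) c' (Z t)) (V t)
    + curvatureOn G (c t) (X t) (Y t) (Z t) (V' - christoffelOn G (c t) c' (V t))
  · rw [(isLinearMap_curvatureOn₁ G _ _ _ _).map_sub, (isLinearMap_curvatureOn₂ G _ _ _ _).map_sub,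
      (isLinearMap_curvatureOn₃ G _ _ _ _).map_sub, (isLinearMap_curvatureOn₄ G _ _ _ _).map_sub,
      covDerivCurvatureOn_eq]
    ring
  · simp only [curvatureDerivOn, curvatureOn, ← Finset.sum_add_distrib]
    simp only [← Fintype.sum_prod_type']
    exact Finset.sum_congr rfl fun _ _ => by ring

lemma map_sum_smul_of_isLinearMap {E ι : Type*} [AddCommGroup E] [Module ℝ E] {L : E → ℝ}
    (hL : IsLinearMap ℝ L) (s : Finset ι) (a : ι → ℝ) (u : ι → E) :
    L (∑ i ∈ s, a i • u i) = ∑ i ∈ s, a i * L (u i) := by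
  change IsLinearMap.mk' L hL _ = _
  rw [map_sum]
  simp

end CurveRules

/-! ### Vector fields along a map -/

/-- `f` maps the open set `U` smoothly into the open set `W` with metric `G`. -/
structure IsMapOn {m n : ℕ} (G : Coord n → Matrix (Fin n) (Fin n) ℝ) (f : Coord m → Coord n)
    (U : Set (Coord m)) (W : Set (Coord n)) : Prop where
  metric : IsMetricOn G W
  isOpen : IsOpen U
  mapsTo : ∀ x ∈ U, f x ∈ W
  smooth : ContDiffOn ℝ ∞ f U

/-- A vector field whose components are smooth on `U`. -/
def SmoothField {m n : ℕ} (U : Set (Coord m)) (V : Coord m → Fin n → ℝ) : Prop :=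
  ∀ A, ContDiffOn ℝ ∞ (fun x => V x A) U

section Fields

variable {m n : ℕ} {U : Set (Coord m)} {V V' : Coord m → Fin n → ℝ} {u : Coord m → ℝ}

lemma SmoothField.add (hV : SmoothField U V) (hV' : SmoothField U V') :
    SmoothField U (fun x => V x + V' x) := fun A => (hV A).add (hV' A)

lemma SmoothField.sub (hV : SmoothField U V) (hV' : SmoothField U V') :
    SmoothField U (fun x => V x - V' x) := fun A => (hV A).sub (hV' A)

lemma SmoothField.smul (hu : ContDiffOn ℝ ∞ u U) (hV : SmoothField U V) :
    SmoothField U (fun x => u x • V x) := fun A => hu.mul (hV A)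

lemma SmoothField.sum {ι : Type*} {s : Finset ι} {V : ι → Coord m → Fin n → ℝ}
    (hV : ∀ a, SmoothField U (V a)) : SmoothField U (fun x => ∑ a ∈ s, V a x) := by
  intro A
  simp only [Finset.sum_apply]
  exact ContDiffOn.sum fun a _ => hV a A

lemma SmoothField.const (v : Fin n → ℝ) : SmoothField U (fun _ : Coord m => v) :=
  fun _ => contDiffOn_const

lemma hasDerivWithinAt_line {x : Coord m} (hu : DifferentiableAt ℝ u x) (i : Fin m) :
    HasDerivWithinAt (fun s : ℝ => u (x + s • EuclideanSpace.single i 1))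
      (partialDeriv i u x) univ 0 := by
  have h1 : HasDerivAt (fun s : ℝ => x + s • (EuclideanSpace.single i 1 : Coord m))
      (EuclideanSpace.single i 1) 0 := by
    simpa using ((hasDerivAt_id (0 : ℝ)).smul_const
      (EuclideanSpace.single i 1 : Coord m)).const_add x
  have h2 : HasFDerivAt u (fderiv ℝ u x) (x + (0 : ℝ) • (EuclideanSpace.single i 1 : Coord m)) := by
    simpa using hu.hasFDerivAt
  exact (h2.comp_hasDerivAt 0 h1).hasDerivWithinAt

lemma partialDeriv_eq_of_line {x : Coord m} (hu : DifferentiableAt ℝ u x) {i : Fin m} {d : ℝ}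
    (h : HasDerivWithinAt (fun s : ℝ => u (x + s • EuclideanSpace.single i 1)) d univ 0) :
    partialDeriv i u x = d :=
  ((hasDerivWithinAt_line hu i).hasDerivAt univ_mem).unique (h.hasDerivAt univ_mem)

/-- The componentwise derivative of a vector field. -/
def fieldDeriv (i : Fin m) (V : Coord m → Fin n → ℝ) (x : Coord m) : Fin n → ℝ :=
  fun A => partialDeriv i (fun z => V z A) x

variable {G : Coord n → Matrix (Fin n) (Fin n) ℝ} {f : Coord m → Coord n} {W : Set (Coord n)}
  {x : Coord m} {i j k l : Fin m}

lemma covDeriv_eq : covDeriv G f i V x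
    = fieldDeriv i V x + christoffelOn G (f x) (tangent f i x) (V x) := rfl

lemma smoothField_map (hf : IsMapOn G f U W) (A : Fin n) : ContDiffOn ℝ ∞ (fun x => f x A) U :=
  contDiffOn_piLp _ |>.1 hf.smooth A

lemma contDiffOn_comp_map (hf : IsMapOn G f U W) {w : Coord n → ℝ} (hw : ContDiffOn ℝ ∞ w W) :
    ContDiffOn ℝ ∞ (fun x => w (f x)) U := hw.comp hf.smooth hf.mapsTo

lemma smoothField_tangent (hf : IsMapOn G f U W) (i : Fin m) : SmoothField U (tangent f i) :=
  fun A => contDiffOn_partialDeriv hf.isOpen (smoothField_map hf A) i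

lemma SmoothField.fieldDeriv (hf : IsMapOn G f U W) (hV : SmoothField U V) (i : Fin m) :
    SmoothField U (fieldDeriv i V) :=
  fun A => contDiffOn_partialDeriv hf.isOpen (hV A) i

lemma SmoothField.christoffelOn (hf : IsMapOn G f U W) (hV : SmoothField U V)
    (hV' : SmoothField U V') : SmoothField U (fun x => christoffelOn G (f x) (V x) (V' x)) :=
  fun A => ContDiffOn.sum fun B _ => ContDiffOn.sum fun C _ =>
    ((contDiffOn_comp_map hf (contDiffOn_christoffel hf.metric A B C)).mul (hV B)).mul (hV' C)

lemma SmoothField.covDeriv (hf : IsMapOn G f U W) (hV : SmoothField U V) (i : Fin m) :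
    SmoothField U (covDeriv G f i V) :=
  (hV.fieldDeriv hf i).add ((smoothField_tangent hf i).christoffelOn hf hV)

lemma contDiffOn_inner (hf : IsMapOn G f U W) (hV : SmoothField U V) (hV' : SmoothField U V') :
    ContDiffOn ℝ ∞ (fun x => inner G (f x) (V x) (V' x)) U :=
  ContDiffOn.sum fun A _ => ContDiffOn.sum fun B _ =>
    ((contDiffOn_comp_map hf (hf.metric.smooth A B)).mul (hV A)).mul (hV' B)

lemma contDiffOn_curvatureOn (hf : IsMapOn G f U W) {X Y Z V : Coord m → Fin n → ℝ}
    (hX : SmoothField U X) (hY : SmoothField U Y) (hZ : SmoothField U Z) (hV : SmoothField U V) :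
    ContDiffOn ℝ ∞ (fun x => curvatureOn G (f x) (X x) (Y x) (Z x) (V x)) U :=
  ContDiffOn.sum fun A _ => ContDiffOn.sum fun B _ => ContDiffOn.sum fun C _ =>
    ContDiffOn.sum fun D _ =>
    ((((contDiffOn_comp_map hf (contDiffOn_curvature hf.metric A B C D)).mul (hX A)).mul
      (hY B)).mul (hZ C)).mul (hV D)

lemma SmoothField.curvatureVec (hf : IsMapOn G f U W) {X Y Z : Coord m → Fin n → ℝ}
    (hX : SmoothField U X) (hY : SmoothField U Y) (hZ : SmoothField U Z) :
    SmoothField U (fun x => curvatureVec G (f x) (X x) (Y x) (Z x)) :=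
  fun E => ContDiffOn.sum fun A _ => ContDiffOn.sum fun B _ => ContDiffOn.sum fun C _ =>
    (((contDiffOn_comp_map hf (contDiffOn_curvatureUp hf.metric E A B C)).mul (hX A)).mul
      (hY B)).mul (hZ C)

lemma fieldDeriv_add (hU : IsOpen U) (hx : x ∈ U) (hV : SmoothField U V)
    (hV' : SmoothField U V') :
    fieldDeriv i (fun x => V x + V' x) x = fieldDeriv i V x + fieldDeriv i V' x :=
  funext fun A => partialDeriv_add (diffAt hU (hV A) hx) (diffAt hU (hV' A) hx)

lemma covDeriv_congr (hU : IsOpen U) (hx : x ∈ U) (h : ∀ z ∈ U, V z = V' z) :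
    covDeriv G f i V x = covDeriv G f i V' x := by
  rw [covDeriv_eq, covDeriv_eq, h x hx]
  congr 1
  exact funext fun A => partialDeriv_congr hU hx fun z hz => by rw [h z hz]

lemma covDeriv_add (hU : IsOpen U) (hx : x ∈ U) (hV : SmoothField U V)
    (hV' : SmoothField U V') :
    covDeriv G f i (fun x => V x + V' x) x = covDeriv G f i V x + covDeriv G f i V' x := by
  rw [covDeriv_eq, covDeriv_eq, covDeriv_eq, fieldDeriv_add hU hx hV hV',
    christoffelOn_add_right]
  abel

lemma covDeriv_smul (hU : IsOpen U) (hx : x ∈ U) (hu : ContDiffOn ℝ ∞ u U)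
    (hV : SmoothField U V) :
    covDeriv G f i (fun x => u x • V x) x
      = partialDeriv i u x • V x + u x • covDeriv G f i V x := by
  rw [covDeriv_eq, covDeriv_eq, christoffelOn_smul_right, smul_add, ← add_assoc]
  congr 1
  exact funext fun A => partialDeriv_mul (diffAt hU hu hx) (diffAt hU (hV A) hx)

lemma covDeriv_sub (hU : IsOpen U) (hx : x ∈ U) (hV : SmoothField U V)
    (hV' : SmoothField U V') :
    covDeriv G f i (fun x => V x - V' x) x = covDeriv G f i V x - covDeriv G f i V' x := by
  rw [covDeriv_eq, covDeriv_eq, covDeriv_eq, christoffelOn_sub_right]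
  have : fieldDeriv i (fun x => V x - V' x) x = fieldDeriv i V x - fieldDeriv i V' x :=
    funext fun A => partialDeriv_sub (diffAt hU (hV A) hx) (diffAt hU (hV' A) hx)
  rw [this]
  abel

lemma covDeriv_sum {ι : Type*} {s : Finset ι} {V : ι → Coord m → Fin n → ℝ} (hU : IsOpen U)
    (hx : x ∈ U) (hV : ∀ a, SmoothField U (V a)) :
    covDeriv G f i (fun x => ∑ a ∈ s, V a x) x = ∑ a ∈ s, covDeriv G f i (V a) x := by
  simp only [covDeriv_eq]
  rw [christoffelOn_sum_right, Finset.sum_add_distrib]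
  congr 1
  funext A
  simp only [fieldDeriv, Finset.sum_apply]
  exact partialDeriv_sum fun a => diffAt hU (hV a A) hx

lemma covDeriv_sum_smul {ι : Type*} {s : Finset ι} {u : ι → Coord m → ℝ}
    {V : ι → Coord m → Fin n → ℝ} (hU : IsOpen U) (hx : x ∈ U)
    (hu : ∀ a, ContDiffOn ℝ ∞ (u a) U) (hV : ∀ a, SmoothField U (V a)) :
    covDeriv G f i (fun x => ∑ a ∈ s, u a x • V a x) x
      = ∑ a ∈ s, partialDeriv i (u a) x • V a x + ∑ a ∈ s, u a x • covDeriv G f i (V a) x := by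
  rw [covDeriv_sum hU hx fun a => SmoothField.smul (hu a) (hV a), ← Finset.sum_add_distrib]
  exact Finset.sum_congr rfl fun a _ => covDeriv_smul hU hx (hu a) (hV a)

lemma hasDerivWithinAt_map_line (hf : IsMapOn G f U W) (hx : x ∈ U) (i : Fin m) (A : Fin n) :
    HasDerivWithinAt (fun s : ℝ => f (x + s • EuclideanSpace.single i 1) A)
      (tangent f i x A) univ 0 :=
  hasDerivWithinAt_line (diffAt hf.isOpen (smoothField_map hf A) hx) i

/-- Restricting a field to a coordinate line makes the spatial product rules special cases of the
rules along curves. -/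
lemma hasCovDerivWithinAt_line (hf : IsMapOn G f U W) (hx : x ∈ U) (hV : SmoothField U V)
    (i : Fin m) :
    HasCovDerivWithinAt G (fun s : ℝ => f (x + s • EuclideanSpace.single i 1)) (tangent f i x)
      (fun s => V (x + s • EuclideanSpace.single i 1)) (covDeriv G f i V x) univ 0 := by
  intro A
  convert hasDerivWithinAt_line (diffAt hf.isOpen (hV A) hx) i using 1
  simp only [zero_smul, add_zero, covDeriv_eq, Pi.add_apply, add_sub_cancel_right]
  rfl

/-- The Levi-Civita connection is compatible with the metric, for vector fields along a map. -/
lemma partialDeriv_inner (hf : IsMapOn G f U W) (hx : x ∈ U) (hV : SmoothField U V)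
    (hV' : SmoothField U V') (i : Fin m) :
    partialDeriv i (fun x => inner G (f x) (V x) (V' x)) x
      = inner G (f x) (covDeriv G f i V x) (V' x) + inner G (f x) (V x) (covDeriv G f i V' x) := by
  have h0 : x + (0 : ℝ) • (EuclideanSpace.single i 1 : Coord m) = x := by simp
  refine partialDeriv_eq_of_line (diffAt hf.isOpen (contDiffOn_inner hf hV hV') hx) ?_
  have := HasCovDerivWithinAt.inner hf.metric (t := (0 : ℝ)) (J := univ)
    (c := fun s : ℝ => f (x + s • EuclideanSpace.single i 1))
    (by simpa only [h0] using hf.mapsTo x hx) (hasDerivWithinAt_map_line hf hx i)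
    (hasCovDerivWithinAt_line hf hx hV i) (hasCovDerivWithinAt_line hf hx hV' i)
  simpa only [h0] using this

lemma partialDeriv_curvatureOn (hf : IsMapOn G f U W) (hx : x ∈ U)
    {X Y Z V : Coord m → Fin n → ℝ}
    (hX : SmoothField U X) (hY : SmoothField U Y) (hZ : SmoothField U Z) (hV : SmoothField U V)
    (i : Fin m) :
    partialDeriv i (fun x => curvatureOn G (f x) (X x) (Y x) (Z x) (V x)) x
      = covDerivCurvatureOn G (f x) (tangent f i x) (X x) (Y x) (Z x) (V x)
        + curvatureOn G (f x) (covDeriv G f i X x) (Y x) (Z x) (V x)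
        + curvatureOn G (f x) (X x) (covDeriv G f i Y x) (Z x) (V x)
        + curvatureOn G (f x) (X x) (Y x) (covDeriv G f i Z x) (V x)
        + curvatureOn G (f x) (X x) (Y x) (Z x) (covDeriv G f i V x) := by
  have h0 : x + (0 : ℝ) • (EuclideanSpace.single i 1 : Coord m) = x := by simp
  refine partialDeriv_eq_of_line (diffAt hf.isOpen (contDiffOn_curvatureOn hf hX hY hZ hV) hx) ?_
  have := hasDerivWithinAt_curvatureOn hf.metric (t := (0 : ℝ)) (J := univ)
    (c := fun s : ℝ => f (x + s • EuclideanSpace.single i 1))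
    (by simpa only [h0] using hf.mapsTo x hx) (hasDerivWithinAt_map_line hf hx i)
    (hasCovDerivWithinAt_line hf hx hX i) (hasCovDerivWithinAt_line hf hx hY i)
    (hasCovDerivWithinAt_line hf hx hZ i) (hasCovDerivWithinAt_line hf hx hV i)
  simpa only [h0] using this

/-- The covariant derivative of `K(X, Y) Z`. -/
lemma inner_covDeriv_curvatureVec (hf : IsMapOn G f U W) (hx : x ∈ U)
    {X Y Z : Coord m → Fin n → ℝ} (hX : SmoothField U X) (hY : SmoothField U Y)
    (hZ : SmoothField U Z) (i : Fin m) (ν : Fin n → ℝ) :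
    inner G (f x) (covDeriv G f i (fun x => curvatureVec G (f x) (X x) (Y x) (Z x)) x) ν
      = covDerivCurvatureOn G (f x) (tangent f i x) (X x) (Y x) (Z x) ν
        + curvatureOn G (f x) (covDeriv G f i X x) (Y x) (Z x) ν
        + curvatureOn G (f x) (X x) (covDeriv G f i Y x) (Z x) ν
        + curvatureOn G (f x) (X x) (Y x) (covDeriv G f i Z x) ν := by
  -- The vector is extended with constant components. Its covariant derivative need not vanish, but
  -- it enters both product rules in the same way and drops out of their difference.
  have hν : SmoothField U (fun _ : Coord m => ν) := SmoothField.const ν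
  have h1 := partialDeriv_curvatureOn hf hx hX hY hZ hν i
  have h2 := partialDeriv_inner hf hx (hX.curvatureVec hf hY hZ) hν i
  simp only [inner_curvatureVec] at h2
  linarith

lemma fieldDeriv_christoffelOn (hf : IsMapOn G f U W) (hx : x ∈ U)
    (hV : SmoothField U V) (hV' : SmoothField U V') (i : Fin m) :
    fieldDeriv i (fun x => christoffelOn G (f x) (V x) (V' x)) x
      = christoffelDerivOn G (f x) (tangent f i x) (V x) (V' x)
        + christoffelOn G (f x) (fieldDeriv i V x) (V' x)
        + christoffelOn G (f x) (V x) (fieldDeriv i V' x) := by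
  have h0 : x + (0 : ℝ) • (EuclideanSpace.single i 1 : Coord m) = x := by simp
  funext A
  refine partialDeriv_eq_of_line (diffAt hf.isOpen (hV.christoffelOn hf hV' A) hx) ?_
  have := hasDerivWithinAt_christoffelOn hf.metric (t := (0 : ℝ)) (J := univ)
    (c := fun s : ℝ => f (x + s • EuclideanSpace.single i 1))
    (by simpa only [h0] using hf.mapsTo x hx) (hasDerivWithinAt_map_line hf hx i)
    (fun A => hasDerivWithinAt_line (diffAt hf.isOpen (hV A) hx) i)
    (fun A => hasDerivWithinAt_line (diffAt hf.isOpen (hV' A) hx) i) A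
  simp only [h0] at this
  exact this

lemma fieldDeriv_comm (hU : IsOpen U) (hx : x ∈ U) (hV : SmoothField U V) (i j : Fin m) :
    fieldDeriv i (fieldDeriv j V) x = fieldDeriv j (fieldDeriv i V) x :=
  funext fun A => partialDeriv_comm hU (hV A) hx

lemma fieldDeriv_tangent_comm (hf : IsMapOn G f U W) (hx : x ∈ U) (i j : Fin m) :
    fieldDeriv i (tangent f j) x = fieldDeriv j (tangent f i) x :=
  funext fun A => partialDeriv_comm hf.isOpen (smoothField_map hf A) hx

/-- The Levi-Civita connection is torsion free. -/
lemma covDeriv_tangent_comm (hf : IsMapOn G f U W) (hx : x ∈ U) (i j : Fin m) :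
    covDeriv G f i (tangent f j) x = covDeriv G f j (tangent f i) x := by
  rw [covDeriv_eq, covDeriv_eq, fieldDeriv_tangent_comm hf hx,
    christoffelOn_comm hf.metric (hf.mapsTo x hx)]

/-- The expansion isolates what is symmetric in `l` and `k`: the flat second derivative of `V`, the
term with the second derivative of `f`, and the pair of mixed terms. Only ∂Γ and ΓΓ survive in the
commutator. -/
lemma covDeriv_covDeriv_eq (hf : IsMapOn G f U W) (hx : x ∈ U) (hV : SmoothField U V)
    (l k : Fin m) :
    covDeriv G f l (covDeriv G f k V) x
      = fieldDeriv l (fieldDeriv k V) x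
        + (christoffelDerivOn G (f x) (tangent f l x) (tangent f k x) (V x)
          + christoffelOn G (f x) (fieldDeriv l (tangent f k) x) (V x)
          + christoffelOn G (f x) (tangent f k x) (fieldDeriv l V x))
        + (christoffelOn G (f x) (tangent f l x) (fieldDeriv k V x)
          + christoffelOn G (f x) (tangent f l x)
            (christoffelOn G (f x) (tangent f k x) (V x))) := by
  rw [covDeriv_eq, ← fieldDeriv_christoffelOn hf hx (smoothField_tangent hf k) hV,
    ← christoffelOn_add_right, ← fieldDeriv_add hf.isOpen hx (hV.fieldDeriv hf k)
    ((smoothField_tangent hf k).christoffelOn hf hV)]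
  rfl

/-- The curvature is the commutator of covariant derivatives. -/
lemma covDeriv_comm (hf : IsMapOn G f U W) (hx : x ∈ U) (hV : SmoothField U V) (l k : Fin m) :
    covDeriv G f l (covDeriv G f k V) x - covDeriv G f k (covDeriv G f l V) x
      = - curvatureVec G (f x) (tangent f l x) (tangent f k x) (V x) := by
  rw [covDeriv_covDeriv_eq hf hx hV, covDeriv_covDeriv_eq hf hx hV, ← curvatureVec_eq,
    fieldDeriv_comm hf.isOpen hx hV k l, fieldDeriv_tangent_comm hf hx k l]
  abel

end Fields

/-! ### Immersions -/

/-- `f` is a smooth map on `U` whose induced metric is nondegenerate. -/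
structure IsImmersionOn {m n : ℕ} (G : Coord n → Matrix (Fin n) (Fin n) ℝ)
    (f : Coord m → Coord n) (U : Set (Coord m)) (W : Set (Coord n)) : Prop
    extends IsMapOn G f U W where
  det_ne : ∀ x ∈ U, (inducedMetric G f x).det ≠ 0

section Immersion

variable {m n : ℕ} {G : Coord n → Matrix (Fin n) (Fin n) ℝ} {f : Coord m → Coord n}
  {U : Set (Coord m)} {W : Set (Coord n)} {x : Coord m} {i j k l : Fin m}

lemma contDiffOn_inducedMetric (hf : IsMapOn G f U W) (i j : Fin m) :
    ContDiffOn ℝ ∞ (fun x => inducedMetric G f x i j) U :=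
  contDiffOn_inner hf (smoothField_tangent hf i) (smoothField_tangent hf j)

lemma contDiffOn_inducedInv (hf : IsImmersionOn G f U W) (i j : Fin m) :
    ContDiffOn ℝ ∞ (inducedInv G f i j) U :=
  contDiffOn_inv_apply (contDiffOn_inducedMetric hf.toIsMapOn) hf.det_ne i j

lemma inducedMetric_isSymm (hf : IsMapOn G f U W) (hx : x ∈ U) :
    (inducedMetric G f x).IsSymm := by
  ext i j
  exact inner_comm hf.metric (hf.mapsTo x hx) _ _

lemma inducedInv_symm (hf : IsMapOn G f U W) (hx : x ∈ U) (i j : Fin m) :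
    inducedInv G f i j x = inducedInv G f j i x := by
  have h := (inducedMetric_isSymm hf hx).inv
  exact (h.apply j i)

lemma sum_inducedInv_mul (hf : IsImmersionOn G f U W) (hx : x ∈ U) (i j : Fin m) :
    ∑ k, inducedInv G f i k x * inner G (f x) (tangent f k x) (tangent f j x)
      = if i = j then 1 else 0 := by
  have h := Matrix.nonsing_inv_mul _ (hf.det_ne x hx).isUnit
  have := congrFun (congrFun h i) j
  rwa [Matrix.mul_apply, Matrix.one_apply] at this

lemma sum_mul_inducedInv (hf : IsImmersionOn G f U W) (hx : x ∈ U) (i j : Fin m) :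
    ∑ k, inner G (f x) (tangent f i x) (tangent f k x) * inducedInv G f k j x
      = if i = j then 1 else 0 := by
  have h := Matrix.mul_nonsing_inv _ (hf.det_ne x hx).isUnit
  have := congrFun (congrFun h i) j
  rwa [Matrix.mul_apply, Matrix.one_apply] at this

lemma normalPart_eq (v : Fin n → ℝ) :
    normalPart G f x v = v - ∑ k, tangentialCoeff G f x v k • tangent f k x := by
  funext A
  simp [normalPart]

lemma sum_tangentialCoeff_mul (hf : IsImmersionOn G f U W) (hx : x ∈ U) (v : Fin n → ℝ)
    (l : Fin m) :
    ∑ k, tangentialCoeff G f x v k * inner G (f x) (tangent f k x) (tangent f l x)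
      = inner G (f x) v (tangent f l x) := by
  simp only [tangentialCoeff, Finset.sum_mul]
  rw [Finset.sum_comm]
  have h : ∀ q, ∑ k, inducedInv G f k q x * inner G (f x) v (tangent f q x)
      * inner G (f x) (tangent f k x) (tangent f l x)
      = inner G (f x) v (tangent f q x) * if q = l then 1 else 0 := by
    intro q
    rw [← sum_inducedInv_mul hf hx, Finset.mul_sum]
    refine Finset.sum_congr rfl fun k _ => ?_
    rw [inducedInv_symm hf.toIsMapOn hx]; ring
  simp [h]

lemma inner_normalPart_tangent (hf : IsImmersionOn G f U W) (hx : x ∈ U) (v : Fin n → ℝ)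
    (l : Fin m) : inner G (f x) (normalPart G f x v) (tangent f l x) = 0 := by
  rw [normalPart_eq, inner_sub_left, inner_sum_left]
  simp only [inner_smul_left]
  rw [sum_tangentialCoeff_mul hf hx, sub_self]

/-- `ν` is normal to the immersion at `f x`. -/
def IsNormal (G : Coord n → Matrix (Fin n) (Fin n) ℝ) (f : Coord m → Coord n) (x : Coord m)
    (ν : Fin n → ℝ) : Prop :=
  ∀ l, inner G (f x) (tangent f l x) ν = 0

lemma inner_sum_tangent {ν : Fin n → ℝ} (hν : IsNormal G f x ν) (a : Fin m → ℝ) :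
    inner G (f x) (∑ k, a k • tangent f k x) ν = 0 := by
  rw [inner_sum_left]
  exact Finset.sum_eq_zero fun k _ => by rw [inner_smul_left, hν k, mul_zero]

lemma inner_normalPart {ν : Fin n → ℝ} (hν : IsNormal G f x ν) (v : Fin n → ℝ) :
    inner G (f x) (normalPart G f x v) ν = inner G (f x) v ν := by
  rw [normalPart_eq, inner_sub_left, inner_sum_tangent hν, sub_zero]

/-! ### The second fundamental form -/

/-- The Gauss formula. It needs no nondegeneracy, since `secondFF` and `inducedConn` are built from
the same tangential coefficients. -/
lemma covDeriv_tangent_eq (i j : Fin m) (x : Coord m) :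
    covDeriv G f i (tangent f j) x
      = secondFF G f i j x + ∑ k, inducedConn G f k i j x • tangent f k x := by
  rw [secondFF, normalPart_eq]
  simp [inducedConn]

lemma secondFF_eq (i j : Fin m) : secondFF G f i j = fun x =>
    covDeriv G f i (tangent f j) x - ∑ k, inducedConn G f k i j x • tangent f k x := by
  funext x
  rw [covDeriv_tangent_eq, add_sub_cancel_right]

lemma isNormal_secondFF (hf : IsImmersionOn G f U W) (hx : x ∈ U) (i j : Fin m) :
    IsNormal G f x (secondFF G f i j x) := fun l => by
  rw [inner_comm hf.metric (hf.mapsTo x hx)]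
  exact inner_normalPart_tangent hf hx _ l

lemma secondFF_symm (hf : IsMapOn G f U W) (hx : x ∈ U) (i j : Fin m) :
    secondFF G f i j x = secondFF G f j i x := by
  rw [secondFF, covDeriv_tangent_comm hf hx, ← secondFF]

lemma inducedConn_symm (hf : IsMapOn G f U W) (hx : x ∈ U) (k i j : Fin m) :
    inducedConn G f k i j x = inducedConn G f k j i x := by
  rw [inducedConn, covDeriv_tangent_comm hf hx, ← inducedConn]

lemma contDiffOn_tangentialCoeff (hf : IsImmersionOn G f U W) {V : Coord m → Fin n → ℝ}
    (hV : SmoothField U V) (k : Fin m) :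
    ContDiffOn ℝ ∞ (fun x => tangentialCoeff G f x (V x) k) U :=
  ContDiffOn.sum fun l _ => (contDiffOn_inducedInv hf k l).mul
    (contDiffOn_inner hf.toIsMapOn hV (smoothField_tangent hf.toIsMapOn l))

lemma contDiffOn_inducedConn (hf : IsImmersionOn G f U W) (k i j : Fin m) :
    ContDiffOn ℝ ∞ (inducedConn G f k i j) U :=
  contDiffOn_tangentialCoeff hf
    ((smoothField_tangent hf.toIsMapOn j).covDeriv hf.toIsMapOn i) k

lemma smoothField_secondFF (hf : IsImmersionOn G f U W) (i j : Fin m) :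
    SmoothField U (secondFF G f i j) := by
  rw [secondFF_eq]
  exact ((smoothField_tangent hf.toIsMapOn j).covDeriv hf.toIsMapOn i).sub
    (SmoothField.sum fun k => SmoothField.smul (contDiffOn_inducedConn hf k i j)
      (smoothField_tangent hf.toIsMapOn k))

lemma inner_covDeriv_tangent {ν : Fin n → ℝ} (hν : IsNormal G f x ν) (i j : Fin m) :
    inner G (f x) (covDeriv G f i (tangent f j) x) ν = inner G (f x) (secondFF G f i j x) ν := by
  rw [covDeriv_tangent_eq, inner_add_left, inner_sum_tangent hν, add_zero]

/-- The Weingarten equation. -/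
lemma inner_covDeriv_of_isNormal (hf : IsMapOn G f U W) (hx : x ∈ U)
    {V : Coord m → Fin n → ℝ} (hV : SmoothField U V) (hn : ∀ z ∈ U, IsNormal G f z (V z))
    (k l : Fin m) :
    inner G (f x) (covDeriv G f k V x) (tangent f l x)
      = - inner G (f x) (V x) (secondFF G f k l x) := by
  have h1 := partialDeriv_inner hf hx (smoothField_tangent hf l) hV k
  rw [partialDeriv_congr (v := fun _ => 0) hf.isOpen hx fun z hz => hn z hz l,
    partialDeriv_const, inner_covDeriv_tangent (hn x hx)] at h1
  rw [inner_comm hf.metric (hf.mapsTo x hx), inner_comm hf.metric (hf.mapsTo x hx) (V x)]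
  linarith

/-- The induced metric is parallel for the induced connection. -/
lemma partialDeriv_inducedInv (hf : IsImmersionOn G f U W) (hx : x ∈ U) (k i j : Fin m) :
    partialDeriv k (inducedInv G f i j) x
      = - ∑ q, inducedConn G f i k q x * inducedInv G f q j x
        - ∑ q, inducedConn G f j k q x * inducedInv G f i q x := by
  have hm := hf.toIsMapOn
  have hE := smoothField_tangent hm
  -- Differentiate g^{ia} g_{ab} = δ_{ib}, using metric compatibility for g_{ab}; `h3` then solves
  -- for the derivative of the inverse.
  have h1 : ∀ b, ∑ a, partialDeriv k (inducedInv G f i a) x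
      * inner G (f x) (tangent f a x) (tangent f b x)
      = - ∑ a, inducedInv G f i a x
        * (inner G (f x) (covDeriv G f k (tangent f a) x) (tangent f b x)
          + inner G (f x) (tangent f a x) (covDeriv G f k (tangent f b) x)) := by
    intro b
    have h2 : partialDeriv k (fun z => ∑ a, inducedInv G f i a z
        * inner G (f z) (tangent f a z) (tangent f b z)) x = 0 := by
      rw [partialDeriv_congr hf.isOpen hx fun z hz => sum_inducedInv_mul hf hz i b,
        partialDeriv_const]
    have hd1 := fun a => diffAt hf.isOpen (contDiffOn_inducedInv hf i a) hx
    have hd2 := fun a => diffAt hf.isOpen (contDiffOn_inner hm (hE a) (hE b)) hx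
    rw [partialDeriv_sum fun a => (hd1 a).fun_mul (hd2 a)] at h2
    simp only [fun a => partialDeriv_mul (i := k) (hd1 a) (hd2 a),
      fun a => partialDeriv_inner hm hx (hE a) (hE b) k, Finset.sum_add_distrib] at h2
    linarith
  have h3 : partialDeriv k (inducedInv G f i j) x = ∑ b, (∑ a, partialDeriv k (inducedInv G f i a) x
      * inner G (f x) (tangent f a x) (tangent f b x)) * inducedInv G f b j x := by
    simp only [Finset.sum_mul]
    rw [Finset.sum_comm]
    simp only [mul_assoc, ← Finset.mul_sum, sum_mul_inducedInv hf hx]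
    simp
  rw [h3]
  simp only [h1, neg_mul, Finset.sum_neg_distrib, mul_add, Finset.sum_add_distrib, add_mul]
  have h4 : ∑ b, (∑ a, inducedInv G f i a x
      * inner G (f x) (covDeriv G f k (tangent f a) x) (tangent f b x)) * inducedInv G f b j x
      = ∑ q, inducedConn G f j k q x * inducedInv G f i q x := by
    simp only [inducedConn, tangentialCoeff, Finset.sum_mul]
    rw [Finset.sum_comm]
    refine Finset.sum_congr rfl fun a _ => Finset.sum_congr rfl fun b _ => ?_
    rw [inducedInv_symm hm hx b j]; ring
  have h5 : ∑ b, (∑ a, inducedInv G f i a x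
      * inner G (f x) (tangent f a x) (covDeriv G f k (tangent f b) x)) * inducedInv G f b j x
      = ∑ q, inducedConn G f i k q x * inducedInv G f q j x := by
    simp only [inducedConn, tangentialCoeff, Finset.sum_mul]
    refine Finset.sum_congr rfl fun a _ => Finset.sum_congr rfl fun b _ => ?_
    rw [inner_comm hf.metric (hf.mapsTo x hx)]
  rw [h4, h5]
  ring

/-! ### Derivatives of the second fundamental form in the ambient space -/

/-- The derivative `∇_{∂ₖ}` of a two-tensor with values in the vector fields along `f`, formed with
the induced connection and the ambient connection. -/
def tensorDeriv (G : Coord n → Matrix (Fin n) (Fin n) ℝ) (f : Coord m → Coord n)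
    (T : Fin m → Fin m → Coord m → Fin n → ℝ) (k i j : Fin m) (x : Coord m) : Fin n → ℝ :=
  covDeriv G f k (T i j) x - ∑ q, inducedConn G f q k i x • T q j x
    - ∑ q, inducedConn G f q k j x • T i q x

/-- The ambient derivative of the second fundamental form. -/
def ambientDerivSFF (G : Coord n → Matrix (Fin n) (Fin n) ℝ) (f : Coord m → Coord n)
    (k i j : Fin m) (x : Coord m) : Fin n → ℝ :=
  tensorDeriv G f (secondFF G f) k i j x

/-- The second ambient derivative of the second fundamental form. -/
def ambientDeriv2SFF (G : Coord n → Matrix (Fin n) (Fin n) ℝ) (f : Coord m → Coord n)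
    (l k i j : Fin m) (x : Coord m) : Fin n → ℝ :=
  tensorDeriv G f (ambientDerivSFF G f k) l i j x
    - ∑ q, inducedConn G f q l k x • ambientDerivSFF G f q i j x

/-- The curvature of the induced connection,
`∇ₖ ∇ᵢ ∂ⱼ - ∇ᵢ ∇ₖ ∂ⱼ = R^q_{kij} ∂_q`. -/
def inducedRiemann (G : Coord n → Matrix (Fin n) (Fin n) ℝ) (f : Coord m → Coord n)
    (q k i j : Fin m) (x : Coord m) : ℝ :=
  partialDeriv k (inducedConn G f q i j) x - partialDeriv i (inducedConn G f q k j) x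
    + ∑ p, inducedConn G f q k p x * inducedConn G f p i j x
    - ∑ p, inducedConn G f q i p x * inducedConn G f p k j x

lemma contDiffOn_inducedRiemann (hf : IsImmersionOn G f U W) (q k i j : Fin m) :
    ContDiffOn ℝ ∞ (inducedRiemann G f q k i j) U := by
  have h := contDiffOn_inducedConn hf
  have h' := fun q i j k => contDiffOn_partialDeriv hf.isOpen (h q i j) k
  exact (((h' _ _ _ _).sub (h' _ _ _ _)).add (ContDiffOn.sum fun p _ => (h _ _ _).mul
    (h _ _ _))).sub (ContDiffOn.sum fun p _ => (h _ _ _).mul (h _ _ _))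

lemma smoothField_tensorDeriv (hf : IsImmersionOn G f U W)
    {T : Fin m → Fin m → Coord m → Fin n → ℝ} (hT : ∀ i j, SmoothField U (T i j))
    (k i j : Fin m) : SmoothField U (tensorDeriv G f T k i j) :=
  (((hT i j).covDeriv hf.toIsMapOn k).sub
    (SmoothField.sum fun q => SmoothField.smul (contDiffOn_inducedConn hf q k i) (hT q j))).sub
    (SmoothField.sum fun q => SmoothField.smul (contDiffOn_inducedConn hf q k j) (hT i q))

lemma smoothField_ambientDerivSFF (hf : IsImmersionOn G f U W) (k i j : Fin m) :
    SmoothField U (ambientDerivSFF G f k i j) :=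
  smoothField_tensorDeriv hf (smoothField_secondFF hf) k i j

lemma ambientDerivSFF_symm (hf : IsMapOn G f U W) (hx : x ∈ U) (k i j : Fin m) :
    ambientDerivSFF G f k i j x = ambientDerivSFF G f k j i x := by
  unfold ambientDerivSFF tensorDeriv
  rw [covDeriv_congr hf.isOpen hx fun z hz => secondFF_symm hf hz i j]
  simp only [fun q => secondFF_symm hf hx q j, fun q => secondFF_symm hf hx i q]
  abel

lemma ambientDeriv2SFF_symm (hf : IsMapOn G f U W) (hx : x ∈ U) (l k i j : Fin m) :
    ambientDeriv2SFF G f l k i j x = ambientDeriv2SFF G f l k j i x := by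
  unfold ambientDeriv2SFF tensorDeriv
  rw [covDeriv_congr hf.isOpen hx fun z hz => ambientDerivSFF_symm hf hz k i j]
  simp only [fun k q => ambientDerivSFF_symm hf hx k q j,
    fun q => ambientDerivSFF_symm hf hx k i q]
  abel

/-- Gathers iterated connection terms into a single coefficient of each vector, the shape of the ΓΓ
part of `inducedRiemann`. -/
lemma sum_smul_sum_smul {E ι : Type*} [AddCommGroup E] [Module ℝ E] [Fintype ι]
    (a : ι → ℝ) (b : ι → ι → ℝ) (v : ι → E) :
    ∑ p, a p • ∑ q, b q p • v q = ∑ q, (∑ p, b q p * a p) • v q := by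
  simp only [Finset.smul_sum, Finset.sum_smul, smul_smul]
  rw [Finset.sum_comm]
  simp only [mul_comm]

/-- The Gauss and Codazzi equations, as one equation between vectors of the ambient space. -/
lemma ambientDerivSFF_sub (hf : IsImmersionOn G f U W) (hx : x ∈ U) (k i j : Fin m) :
    ambientDerivSFF G f k i j x - ambientDerivSFF G f i k j x
      = - curvatureVec G (f x) (tangent f k x) (tangent f i x) (tangent f j x)
        - ∑ q, inducedRiemann G f q k i j x • tangent f q x := by
  have hm := hf.toIsMapOn
  have hE := smoothField_tangent hm
  -- Differentiate A_ij = ∇_i ∂_j − Γ^q_{ij} ∂_q and split each ∇_k ∂_q by the Gauss formula. The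
  -- coefficients of ∂_q become R after antisymmetrisation, while the Γ·A terms cancel against the
  -- index corrections.
  have h : ∀ k i, covDeriv G f k (secondFF G f i j) x
      = covDeriv G f k (covDeriv G f i (tangent f j)) x
        - ∑ q, partialDeriv k (inducedConn G f q i j) x • tangent f q x
        - ∑ p, inducedConn G f p i j x • secondFF G f k p x
        - ∑ q, (∑ p, inducedConn G f q k p x * inducedConn G f p i j x) • tangent f q x := by
    intro k i
    rw [secondFF_eq i j, covDeriv_sub hf.isOpen hx ((hE j).covDeriv hm i)
      (SmoothField.sum fun q => SmoothField.smul (contDiffOn_inducedConn hf q i j) (hE q)),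
      covDeriv_sum_smul hf.isOpen hx (fun q => contDiffOn_inducedConn hf q i j) hE,
      ← sum_smul_sum_smul]
    simp only [covDeriv_tangent_eq k, smul_add, Finset.sum_add_distrib]
    abel
  rw [← covDeriv_comm hm hx (hE j) k i]
  unfold ambientDerivSFF tensorDeriv inducedRiemann
  rw [h, h]
  simp only [sub_smul, add_smul, Finset.sum_add_distrib, Finset.sum_sub_distrib,
    fun q => inducedConn_symm hm hx q k i, fun p => secondFF_symm hm hx k p,
    fun p => secondFF_symm hm hx i p]
  abel

/-- Commutation of the ambient derivatives of the second fundamental form. -/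
lemma ambientDeriv2SFF_sub (hf : IsImmersionOn G f U W) (hx : x ∈ U) (l k i j : Fin m) :
    ambientDeriv2SFF G f l k i j x - ambientDeriv2SFF G f k l i j x
      = - curvatureVec G (f x) (tangent f l x) (tangent f k x) (secondFF G f i j x)
        - ∑ q, inducedRiemann G f q l k i x • secondFF G f q j x
        - ∑ q, inducedRiemann G f q l k j x • secondFF G f i q x := by
  have hm := hf.toIsMapOn
  have hA := smoothField_secondFF hf
  -- In this full expansion the terms with one derivative of A, those with two different index
  -- corrections, and the correction in the slot `k` are symmetric in `l`, `k`. Antisymmetrising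
  -- leaves the ambient commutator and ∂Γ + ΓΓ on the indices `i` and `j`.
  have h : ∀ l k, ambientDeriv2SFF G f l k i j x
      = covDeriv G f l (covDeriv G f k (secondFF G f i j)) x
        - ∑ q, partialDeriv l (inducedConn G f q k i) x • secondFF G f q j x
        - ∑ q, inducedConn G f q k i x • covDeriv G f l (secondFF G f q j) x
        - ∑ q, partialDeriv l (inducedConn G f q k j) x • secondFF G f i q x
        - ∑ q, inducedConn G f q k j x • covDeriv G f l (secondFF G f i q) x
        - ∑ q, inducedConn G f q l i x • covDeriv G f k (secondFF G f q j) x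
        + ∑ q, (∑ p, inducedConn G f q k p x * inducedConn G f p l i x) • secondFF G f q j x
        + ∑ q, ∑ p, (inducedConn G f q l i x * inducedConn G f p k j x) • secondFF G f q p x
        - ∑ q, inducedConn G f q l j x • covDeriv G f k (secondFF G f i q) x
        + ∑ q, (∑ p, inducedConn G f q k p x * inducedConn G f p l j x) • secondFF G f i q x
        + ∑ q, ∑ p, (inducedConn G f q k i x * inducedConn G f p l j x) • secondFF G f q p x
        - ∑ q, inducedConn G f q l k x • ambientDerivSFF G f q i j x := by
    intro l k
    have hs : ∀ i' (T : Fin m → Coord m → Fin n → ℝ), (∀ q, SmoothField U (T q)) →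
        SmoothField U (fun x => ∑ q, inducedConn G f q k i' x • T q x) := fun i' T hT =>
      SmoothField.sum fun q => SmoothField.smul (contDiffOn_inducedConn hf q k i') (hT q)
    have h1 : covDeriv G f l (ambientDerivSFF G f k i j) x
        = covDeriv G f l (covDeriv G f k (secondFF G f i j)) x
        - (∑ q, partialDeriv l (inducedConn G f q k i) x • secondFF G f q j x
          + ∑ q, inducedConn G f q k i x • covDeriv G f l (secondFF G f q j) x)
        - (∑ q, partialDeriv l (inducedConn G f q k j) x • secondFF G f i q x
          + ∑ q, inducedConn G f q k j x • covDeriv G f l (secondFF G f i q) x) := by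
      rw [← covDeriv_sum_smul hf.isOpen hx (fun q => contDiffOn_inducedConn hf q k i)
          (fun q => hA q j),
        ← covDeriv_sum_smul hf.isOpen hx (fun q => contDiffOn_inducedConn hf q k j)
          (fun q => hA i q),
        ← covDeriv_sub hf.isOpen hx ((hA i j).covDeriv hm k) (hs i _ fun q => hA q j),
        ← covDeriv_sub hf.isOpen hx
          (((hA i j).covDeriv hm k).sub (hs i _ fun q => hA q j)) (hs j _ fun q => hA i q)]
      rfl
    -- Aligns the summation order of the two mixed corrections on `i` and `j`, which exchange under
    -- `l ↔ k`.
    have h2 : ∑ q, inducedConn G f q l j x • ∑ p, inducedConn G f p k i x • secondFF G f p q x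
        = ∑ q, ∑ p, (inducedConn G f q k i x * inducedConn G f p l j x) • secondFF G f q p x := by
      simp only [Finset.smul_sum, smul_smul]
      rw [Finset.sum_comm]
      simp only [mul_comm]
    rw [ambientDeriv2SFF, tensorDeriv, h1]
    simp only [ambientDerivSFF, tensorDeriv, smul_sub, Finset.sum_sub_distrib]
    rw [sum_smul_sum_smul, sum_smul_sum_smul, h2]
    simp only [Finset.smul_sum, smul_smul]
    abel
  rw [← covDeriv_comm hm hx (hA i j) l k, h l k, h k l]
  unfold inducedRiemann
  simp only [sub_smul, add_smul, Finset.sum_add_distrib, Finset.sum_sub_distrib,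
    fun q => inducedConn_symm hm hx q l k]
  abel

end Immersion

/-! ### Codazzi and Gauss equations, and the differentiated Codazzi equation -/

section Equations

variable {m n : ℕ} {G : Coord n → Matrix (Fin n) (Fin n) ℝ} {f : Coord m → Coord n}
  {U : Set (Coord m)} {W : Set (Coord n)} {x : Coord m} {i j k l : Fin m}

/-- The Codazzi equation. -/
lemma inner_ambientDerivSFF_sub (hf : IsImmersionOn G f U W) (hx : x ∈ U) {ν : Fin n → ℝ}
    (hν : IsNormal G f x ν) (k i j : Fin m) :
    inner G (f x) (ambientDerivSFF G f k i j x) ν - inner G (f x) (ambientDerivSFF G f i k j x) ν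
      = - curvatureOn G (f x) (tangent f k x) (tangent f i x) (tangent f j x) ν := by
  rw [← inner_sub_left, ambientDerivSFF_sub hf hx, inner_sub_left, inner_sum_tangent hν,
    inner_neg_left, inner_curvatureVec, sub_zero]

/-- By the Weingarten equation, since the index corrections are normal. This is the price of not
projecting, and the source of the quadratic terms in the Gauss equation. -/
lemma inner_ambientDerivSFF_tangent (hf : IsImmersionOn G f U W) (hx : x ∈ U) (k i j l : Fin m) :
    inner G (f x) (ambientDerivSFF G f k i j x) (tangent f l x)
      = - inner G (f x) (secondFF G f i j x) (secondFF G f k l x) := by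
  have hm := hf.toIsMapOn
  have h0 : ∀ i j, inner G (f x) (secondFF G f i j x) (tangent f l x) = 0 := fun i j => by
    rw [inner_comm hf.metric (hf.mapsTo x hx)]
    exact isNormal_secondFF hf hx i j l
  rw [ambientDerivSFF, tensorDeriv, inner_sub_left, inner_sub_left, inner_sum_left,
    inner_sum_left, inner_covDeriv_of_isNormal hm hx (smoothField_secondFF hf i j)
      fun z hz => isNormal_secondFF hf hz i j]
  simp [inner_smul_left, h0]

/-- The Gauss equation. -/
lemma sum_inducedRiemann_mul (hf : IsImmersionOn G f U W) (hx : x ∈ U) (k i j l : Fin m) :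
    ∑ q, inducedRiemann G f q k i j x * inner G (f x) (tangent f q x) (tangent f l x)
      = - curvatureOn G (f x) (tangent f k x) (tangent f i x) (tangent f j x) (tangent f l x)
        + inner G (f x) (secondFF G f i j x) (secondFF G f k l x)
        - inner G (f x) (secondFF G f k j x) (secondFF G f i l x) := by
  -- The tangential component of the equation whose normal component is Codazzi.
  have h := congrArg (fun v => inner G (f x) v (tangent f l x)) (ambientDerivSFF_sub hf hx k i j)
  simp only [inner_sub_left, inner_neg_left, inner_sum_left, inner_smul_left,
    inner_curvatureVec, inner_ambientDerivSFF_tangent hf hx] at h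
  linarith

/-- The derivative of the Codazzi equation. -/
lemma inner_ambientDeriv2SFF_sub (hf : IsImmersionOn G f U W) (hx : x ∈ U) {ν : Fin n → ℝ}
    (hν : IsNormal G f x ν) (l k i j : Fin m) :
    inner G (f x) (ambientDeriv2SFF G f l k i j x) ν
        - inner G (f x) (ambientDeriv2SFF G f l i k j x) ν
      = - (covDerivCurvatureOn G (f x) (tangent f l x) (tangent f k x) (tangent f i x)
            (tangent f j x) ν
          + curvatureOn G (f x) (secondFF G f l k x) (tangent f i x) (tangent f j x) ν
          + curvatureOn G (f x) (tangent f k x) (secondFF G f l i x) (tangent f j x) ν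
          + curvatureOn G (f x) (tangent f k x) (tangent f i x) (secondFF G f l j x) ν)
        - ∑ q, inducedRiemann G f q k i j x * inner G (f x) (secondFF G f l q x) ν := by
  have hm := hf.toIsMapOn
  have hE := smoothField_tangent hm
  have hB := smoothField_ambientDerivSFF hf
  have hR := fun q => contDiffOn_inducedRiemann hf q k i j
  have hZ := SmoothField.curvatureVec hm (hE k) (hE i) (hE j)
  -- The full vector equation is differentiated, not only its normal component: its tangential term
  -- R^q ∂_q contributes R^q A_lq, because ∇_l ∂_q has a normal part.
  have h1 : covDeriv G f l (ambientDerivSFF G f i k j) x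
      = covDeriv G f l (ambientDerivSFF G f k i j) x
        + (covDeriv G f l (fun x => curvatureVec G (f x) (tangent f k x) (tangent f i x)
            (tangent f j x)) x
          + (∑ q, partialDeriv l (inducedRiemann G f q k i j) x • tangent f q x
            + ∑ q, inducedRiemann G f q k i j x • covDeriv G f l (tangent f q) x)) := by
    rw [← covDeriv_sum_smul hf.isOpen hx hR hE,
      ← covDeriv_add hf.isOpen hx hZ (SmoothField.sum fun q => SmoothField.smul (hR q) (hE q)),
      ← covDeriv_add hf.isOpen hx (hB k i j)
        (hZ.add (SmoothField.sum fun q => SmoothField.smul (hR q) (hE q)))]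
    refine covDeriv_congr hf.isOpen hx fun z hz => ?_
    have h := ambientDerivSFF_sub hf hz k i j
    rw [sub_eq_iff_eq_add] at h
    rw [h]
    abel
  have hlin : ∀ a : Fin m → ℝ, ∀ v : Fin m → Fin n → ℝ,
      inner G (f x) (∑ q, a q • v q) ν = ∑ q, a q * inner G (f x) (v q) ν := fun a v => by
    rw [inner_sum_left]; simp only [inner_smul_left]
  have hC := inner_ambientDerivSFF_sub hf hx hν
  -- In each index correction, undifferentiated Codazzi exchanges the first two slots. The K terms
  -- so produced cancel the tangential parts of ∇_l ∂_k, ∇_l ∂_i and ∇_l ∂_j in the derivative of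
  -- K(∂_k, ∂_i)∂_j, leaving A in those slots.
  have e1 : ∑ q, inducedConn G f q l k x * inner G (f x) (ambientDerivSFF G f q i j x) ν
      = ∑ q, inducedConn G f q l k x * inner G (f x) (ambientDerivSFF G f i q j x) ν
        - ∑ q, inducedConn G f q l k x
          * curvatureOn G (f x) (tangent f q x) (tangent f i x) (tangent f j x) ν := by
    rw [← Finset.sum_sub_distrib]
    refine Finset.sum_congr rfl fun q _ => ?_
    linear_combination inducedConn G f q l k x * hC q i j
  have e2 : ∑ q, inducedConn G f q l i x * inner G (f x) (ambientDerivSFF G f k q j x) ν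
      = ∑ q, inducedConn G f q l i x * inner G (f x) (ambientDerivSFF G f q k j x) ν
        - ∑ q, inducedConn G f q l i x
          * curvatureOn G (f x) (tangent f k x) (tangent f q x) (tangent f j x) ν := by
    rw [← Finset.sum_sub_distrib]
    refine Finset.sum_congr rfl fun q _ => ?_
    linear_combination inducedConn G f q l i x * hC k q j
  have e3 : ∑ q, inducedConn G f q l j x * inner G (f x) (ambientDerivSFF G f k i q x) ν
      = ∑ q, inducedConn G f q l j x * inner G (f x) (ambientDerivSFF G f i k q x) ν
        - ∑ q, inducedConn G f q l j x
          * curvatureOn G (f x) (tangent f k x) (tangent f i x) (tangent f q x) ν := by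
    rw [← Finset.sum_sub_distrib]
    refine Finset.sum_congr rfl fun q _ => ?_
    linear_combination inducedConn G f q l j x * hC k i q
  have hD := inner_covDeriv_curvatureVec hm hx (hE k) (hE i) (hE j) l ν
  simp only [covDeriv_tangent_eq l] at hD
  rw [(isLinearMap_curvatureOn₁ G _ _ _ _).map_add, (isLinearMap_curvatureOn₂ G _ _ _ _).map_add,
    (isLinearMap_curvatureOn₃ G _ _ _ _).map_add,
    map_sum_smul_of_isLinearMap (isLinearMap_curvatureOn₁ G _ _ _ _),
    map_sum_smul_of_isLinearMap (isLinearMap_curvatureOn₂ G _ _ _ _),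
    map_sum_smul_of_isLinearMap (isLinearMap_curvatureOn₃ G _ _ _ _)] at hD
  simp only [ambientDeriv2SFF, tensorDeriv, inner_sub_left, hlin, e1, e2, e3, h1, inner_add_left,
    hD, inner_covDeriv_tangent hν]
  -- The derivative of R multiplies tangent vectors and is invisible to ν.
  rw [Finset.sum_eq_zero (f := fun q => partialDeriv l (inducedRiemann G f q k i j) x
    * inner G (f x) (tangent f q x) ν) fun q _ => by rw [hν q, mul_zero]]
  ring

/-! ### Comparison with the intrinsic derivatives -/

/-- The projection removes the tangential part of the ambient derivative, which the Weingarten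
equation expresses through A. -/
lemma covDerivSFF_eq (hf : IsImmersionOn G f U W) (hx : x ∈ U) (k i j : Fin m) :
    covDerivSFF G f k i j x = ambientDerivSFF G f k i j x
      + ∑ p, (∑ q, inducedInv G f p q x
        * inner G (f x) (secondFF G f i j x) (secondFF G f k q x)) • tangent f p x := by
  have h1 : covDerivSFF G f k i j x = normalPart G f x (covDeriv G f k (secondFF G f i j) x)
      - ∑ q, inducedConn G f q k i x • secondFF G f q j x
      - ∑ q, inducedConn G f q k j x • secondFF G f i q x := by
    funext B
    simp [covDerivSFF]
  have h2 : ∀ p, tangentialCoeff G f x (covDeriv G f k (secondFF G f i j) x) p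
      = - ∑ q, inducedInv G f p q x
        * inner G (f x) (secondFF G f i j x) (secondFF G f k q x) := by
    intro p
    simp only [tangentialCoeff, inner_covDeriv_of_isNormal hf.toIsMapOn hx
      (smoothField_secondFF hf i j) fun z hz => isNormal_secondFF hf hz i j, mul_neg,
      Finset.sum_neg_distrib]
  rw [h1, normalPart_eq, ambientDerivSFF, tensorDeriv]
  simp only [h2, neg_smul, Finset.sum_neg_distrib]
  abel

lemma inner_covDerivSFF (hf : IsImmersionOn G f U W) (hx : x ∈ U) {ν : Fin n → ℝ}
    (hν : IsNormal G f x ν) (k i j : Fin m) :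
    inner G (f x) (covDerivSFF G f k i j x) ν = inner G (f x) (ambientDerivSFF G f k i j x) ν := by
  rw [covDerivSFF_eq hf hx, inner_add_left, inner_sum_tangent hν, add_zero]

/-- The tangential correction from the first derivative is itself differentiated: ∇_l ∂_p has normal
part A_lp, so a term cubic in A remains. The trace of this term is the whole difference between the
normal and the ambient Laplacian of A. -/
lemma inner_covDeriv2SFF (hf : IsImmersionOn G f U W) (hx : x ∈ U) {ν : Fin n → ℝ}
    (hν : IsNormal G f x ν) (l k i j : Fin m) :
    inner G (f x) (covDeriv2SFF G f l k i j x) ν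
      = inner G (f x) (ambientDeriv2SFF G f l k i j x) ν
        + ∑ p, (∑ q, inducedInv G f p q x
          * inner G (f x) (secondFF G f i j x) (secondFF G f k q x))
          * inner G (f x) (secondFF G f l p x) ν := by
  have hm := hf.toIsMapOn
  have hA := smoothField_secondFF hf
  have hE := smoothField_tangent hm
  have h1 : covDeriv2SFF G f l k i j x
      = normalPart G f x (covDeriv G f l (covDerivSFF G f k i j) x)
      - ∑ q, inducedConn G f q l k x • covDerivSFF G f q i j x
      - ∑ q, inducedConn G f q l i x • covDerivSFF G f k q j x
      - ∑ q, inducedConn G f q l j x • covDerivSFF G f k i q x := by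
    funext B
    simp [covDeriv2SFF]
  have hc : ∀ p, ContDiffOn ℝ ∞ (fun x => ∑ q, inducedInv G f p q x
      * inner G (f x) (secondFF G f i j x) (secondFF G f k q x)) U := fun p =>
    ContDiffOn.sum fun q _ => (contDiffOn_inducedInv hf p q).mul
      (contDiffOn_inner hm (hA i j) (hA k q))
  have hlin : ∀ a : Fin m → ℝ, ∀ v : Fin m → Fin n → ℝ,
      inner G (f x) (∑ q, a q • v q) ν = ∑ q, a q * inner G (f x) (v q) ν := fun a v => by
    rw [inner_sum_left]; simp only [inner_smul_left]
  rw [h1]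
  simp only [inner_sub_left, hlin, inner_normalPart hν, inner_covDerivSFF hf hx hν]
  rw [covDeriv_congr hf.isOpen hx fun z hz => covDerivSFF_eq hf hz k i j,
    covDeriv_add hf.isOpen hx (smoothField_ambientDerivSFF hf k i j)
      (SmoothField.sum fun p => SmoothField.smul (hc p) (hE p)),
    covDeriv_sum_smul hf.isOpen hx hc hE]
  simp only [inner_add_left, inner_sum_tangent hν, ambientDeriv2SFF, tensorDeriv, inner_sub_left,
    hlin, inner_covDeriv_tangent hν]
  ring

/-! ### Traces -/

/-- The induced metric is parallel: the Γ terms from differentiating g^{kl} are, after relabelling,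
the index corrections in `tensorDeriv`. -/
lemma covDeriv_trace (hf : IsImmersionOn G f U W) (hx : x ∈ U)
    {T : Fin m → Fin m → Coord m → Fin n → ℝ} (hT : ∀ i j, SmoothField U (T i j)) (a : Fin m) :
    covDeriv G f a (fun x => ∑ k, ∑ l, inducedInv G f k l x • T k l x) x
      = ∑ k, ∑ l, inducedInv G f k l x • tensorDeriv G f T a k l x := by
  have hI := contDiffOn_inducedInv hf
  rw [covDeriv_sum hf.isOpen hx fun k => SmoothField.sum fun l => SmoothField.smul (hI k l) (hT k l)]
  simp only [fun k => covDeriv_sum_smul (i := a) (G := G) (f := f) (s := Finset.univ) hf.isOpen hx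
    (hI k) (hT k), tensorDeriv, smul_sub, Finset.sum_sub_distrib, Finset.sum_add_distrib,
    partialDeriv_inducedInv hf hx, sub_smul, neg_smul, Finset.sum_neg_distrib]
  have h1 : ∑ k, ∑ l, (∑ q, inducedConn G f k a q x * inducedInv G f q l x) • T k l x
      = ∑ k, ∑ l, inducedInv G f k l x • ∑ q, inducedConn G f q a k x • T q l x := by
    simp only [Finset.sum_smul, Finset.smul_sum, smul_smul]
    simp only [← Fintype.sum_prod_type']
    exact Finset.sum_nbij' (fun (k, l, q) => (q, l, k)) (fun (k, l, q) => (q, l, k))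
      (by simp) (by simp) (by simp) (by simp) (fun _ _ => by rw [mul_comm])
  have h2 : ∑ k, ∑ l, (∑ q, inducedConn G f l a q x * inducedInv G f k q x) • T k l x
      = ∑ k, ∑ l, inducedInv G f k l x • ∑ q, inducedConn G f q a l x • T k q x := by
    simp only [Finset.sum_smul, Finset.smul_sum, smul_smul]
    simp only [← Fintype.sum_prod_type']
    exact Finset.sum_nbij' (fun (k, l, q) => (k, q, l)) (fun (k, l, q) => (k, q, l))
      (by simp) (by simp) (by simp) (by simp) (fun _ _ => by rw [mul_comm])
  rw [h1, h2]
  abel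

lemma meanCurvature_eq : meanCurvature G f
    = fun x => ∑ k, ∑ l, inducedInv G f k l x • secondFF G f k l x := by
  funext x A
  simp [meanCurvature]

lemma smoothField_meanCurvature (hf : IsImmersionOn G f U W) :
    SmoothField U (meanCurvature G f) := by
  rw [meanCurvature_eq]
  exact SmoothField.sum fun k => SmoothField.sum fun l =>
    SmoothField.smul (contDiffOn_inducedInv hf k l) (smoothField_secondFF hf k l)

lemma isNormal_meanCurvature (hf : IsImmersionOn G f U W) (hx : x ∈ U) :
    IsNormal G f x (meanCurvature G f x) := by
  intro l
  simp [meanCurvature_eq, inner_sum_right, inner_smul_right, fun i j => isNormal_secondFF hf hx i j l]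

lemma covDeriv_meanCurvature (hf : IsImmersionOn G f U W) (hx : x ∈ U) (i : Fin m) :
    covDeriv G f i (meanCurvature G f) x
      = ∑ k, ∑ l, inducedInv G f k l x • ambientDerivSFF G f i k l x := by
  rw [meanCurvature_eq, covDeriv_trace hf hx (smoothField_secondFF hf)]
  rfl

/-- The ambient Hessian of the mean curvature vector. -/
lemma covDeriv_covDeriv_meanCurvature (hf : IsImmersionOn G f U W) (hx : x ∈ U) (j i : Fin m) :
    covDeriv G f j (covDeriv G f i (meanCurvature G f)) x
        - ∑ q, inducedConn G f q j i x • covDeriv G f q (meanCurvature G f) x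
      = ∑ k, ∑ l, inducedInv G f k l x • ambientDeriv2SFF G f j i k l x := by
  rw [covDeriv_congr hf.isOpen hx fun z hz => covDeriv_meanCurvature hf hz i,
    covDeriv_trace hf hx (smoothField_ambientDerivSFF hf i)]
  simp only [covDeriv_meanCurvature hf hx, ambientDeriv2SFF, smul_sub, Finset.sum_sub_distrib]
  congr 1
  simp only [Finset.smul_sum, smul_smul]
  simp only [← Fintype.sum_prod_type']
  exact Finset.sum_nbij' (fun (q, k, l) => (k, l, q)) (fun (k, l, q) => (q, k, l))
    (by simp) (by simp) (by simp) (by simp) (fun _ _ => by rw [mul_comm])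

/-- The scalar product `g^{ik} g^{jl} ⟨T_{ij}, T'_{kl}⟩` of two-tensors with values in the vector
fields along `f`. -/
def tensorInner (G : Coord n → Matrix (Fin n) (Fin n) ℝ) (f : Coord m → Coord n)
    (T T' : Fin m → Fin m → Coord m → Fin n → ℝ) (x : Coord m) : ℝ :=
  ∑ i, ∑ j, ∑ k, ∑ l, inducedInv G f i k x * inducedInv G f j l x
    * inner G (f x) (T i j x) (T' k l x)

lemma contDiffOn_tensorInner (hf : IsImmersionOn G f U W)
    {T T' : Fin m → Fin m → Coord m → Fin n → ℝ} (hT : ∀ i j, SmoothField U (T i j))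
    (hT' : ∀ i j, SmoothField U (T' i j)) : ContDiffOn ℝ ∞ (tensorInner G f T T') U :=
  ContDiffOn.sum fun i _ => ContDiffOn.sum fun j _ => ContDiffOn.sum fun k _ =>
    ContDiffOn.sum fun l _ => ((contDiffOn_inducedInv hf i k).mul
      (contDiffOn_inducedInv hf j l)).mul (contDiffOn_inner hf.toIsMapOn (hT i j) (hT' k l))

/-- Product rule with values differentiated by the ambient connection, so that no projection is
needed even if the tensors are not normal. -/
lemma partialDeriv_tensorInner (hf : IsImmersionOn G f U W) (hx : x ∈ U)
    {T T' : Fin m → Fin m → Coord m → Fin n → ℝ} (hT : ∀ i j, SmoothField U (T i j))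
    (hT' : ∀ i j, SmoothField U (T' i j)) (a : Fin m) :
    partialDeriv a (tensorInner G f T T') x
      = tensorInner G f (tensorDeriv G f T a) T' x + tensorInner G f T (tensorDeriv G f T' a) x := by
  have hm := hf.toIsMapOn
  have hI := fun i j => diffAt hf.isOpen (contDiffOn_inducedInv hf i j) hx
  have hS := fun i j k l => diffAt hf.isOpen (contDiffOn_inner hm (hT i j) (hT' k l)) hx
  have hIS := fun i j k l => ((hI i k).fun_mul (hI j l)).fun_mul (hS i j k l)
  have h : partialDeriv a (tensorInner G f T T') x
      = ∑ i, ∑ j, ∑ k, ∑ l, ((partialDeriv a (inducedInv G f i k) x * inducedInv G f j l x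
          + inducedInv G f i k x * partialDeriv a (inducedInv G f j l) x)
            * inner G (f x) (T i j x) (T' k l x)
        + inducedInv G f i k x * inducedInv G f j l x
          * (inner G (f x) (covDeriv G f a (T i j) x) (T' k l x)
            + inner G (f x) (T i j x) (covDeriv G f a (T' k l) x))) := by
    unfold tensorInner
    rw [partialDeriv_sum fun i => .fun_sum fun j _ => .fun_sum fun k _ => .fun_sum fun l _ =>
      hIS i j k l]
    refine Finset.sum_congr rfl fun i _ => ?_
    rw [partialDeriv_sum fun j => .fun_sum fun k _ => .fun_sum fun l _ => hIS i j k l]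
    refine Finset.sum_congr rfl fun j _ => ?_
    rw [partialDeriv_sum fun k => .fun_sum fun l _ => hIS i j k l]
    refine Finset.sum_congr rfl fun k _ => ?_
    rw [partialDeriv_sum fun l => hIS i j k l]
    refine Finset.sum_congr rfl fun l _ => ?_
    rw [partialDeriv_mul ((hI i k).fun_mul (hI j l)) (hS i j k l),
      partialDeriv_mul (hI i k) (hI j l), partialDeriv_inner hm hx (hT i j) (hT' k l)]
  -- The two inverse metrics yield four Γ terms, each matching the correction on one of the four
  -- indices.
  have r1 : ∑ i, ∑ j, ∑ k, ∑ l, (∑ q, inducedConn G f i a q x * inducedInv G f q k x)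
        * inducedInv G f j l x * inner G (f x) (T i j x) (T' k l x)
      = ∑ i, ∑ j, ∑ k, ∑ l, inducedInv G f i k x * inducedInv G f j l x
        * ∑ q, inducedConn G f q a i x * inner G (f x) (T q j x) (T' k l x) := by
    simp only [Finset.sum_mul, Finset.mul_sum]
    simp only [← Fintype.sum_prod_type']
    exact Finset.sum_nbij' (fun (i, j, k, l, q) => (q, j, k, l, i))
      (fun (i, j, k, l, q) => (q, j, k, l, i)) (by simp) (by simp) (by simp) (by simp)
      (fun _ _ => by ring)
  have r2 : ∑ i, ∑ j, ∑ k, ∑ l, (∑ q, inducedConn G f k a q x * inducedInv G f i q x)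
        * inducedInv G f j l x * inner G (f x) (T i j x) (T' k l x)
      = ∑ i, ∑ j, ∑ k, ∑ l, inducedInv G f i k x * inducedInv G f j l x
        * ∑ q, inducedConn G f q a k x * inner G (f x) (T i j x) (T' q l x) := by
    simp only [Finset.sum_mul, Finset.mul_sum]
    simp only [← Fintype.sum_prod_type']
    exact Finset.sum_nbij' (fun (i, j, k, l, q) => (i, j, q, l, k))
      (fun (i, j, k, l, q) => (i, j, q, l, k)) (by simp) (by simp) (by simp) (by simp)
      (fun _ _ => by ring)
  have r3 : ∑ i, ∑ j, ∑ k, ∑ l, inducedInv G f i k x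
        * (∑ q, inducedConn G f j a q x * inducedInv G f q l x)
        * inner G (f x) (T i j x) (T' k l x)
      = ∑ i, ∑ j, ∑ k, ∑ l, inducedInv G f i k x * inducedInv G f j l x
        * ∑ q, inducedConn G f q a j x * inner G (f x) (T i q x) (T' k l x) := by
    simp only [Finset.sum_mul, Finset.mul_sum]
    simp only [← Fintype.sum_prod_type']
    exact Finset.sum_nbij' (fun (i, j, k, l, q) => (i, q, k, l, j))
      (fun (i, j, k, l, q) => (i, q, k, l, j)) (by simp) (by simp) (by simp) (by simp)
      (fun _ _ => by ring)
  have r4 : ∑ i, ∑ j, ∑ k, ∑ l, inducedInv G f i k x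
        * (∑ q, inducedConn G f l a q x * inducedInv G f j q x)
        * inner G (f x) (T i j x) (T' k l x)
      = ∑ i, ∑ j, ∑ k, ∑ l, inducedInv G f i k x * inducedInv G f j l x
        * ∑ q, inducedConn G f q a l x * inner G (f x) (T i j x) (T' k q x) := by
    simp only [Finset.sum_mul, Finset.mul_sum]
    simp only [← Fintype.sum_prod_type']
    exact Finset.sum_nbij' (fun (i, j, k, l, q) => (i, j, k, q, l))
      (fun (i, j, k, l, q) => (i, j, k, q, l)) (by simp) (by simp) (by simp) (by simp)
      (fun _ _ => by ring)
  rw [h]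
  simp only [tensorInner, tensorDeriv, inner_sub_left, inner_sub_right, inner_sum_left,
    inner_sum_right, inner_smul_left, inner_smul_right, mul_sub, Finset.sum_sub_distrib,
    Finset.sum_add_distrib, mul_add, add_mul, partialDeriv_inducedInv hf hx, sub_mul, neg_mul,
    mul_neg, Finset.sum_neg_distrib]
  rw [r1, r2, r3, r4]
  ring

end Equations

/-! ### The equation of Simons at a point where the coordinate vectors are orthonormal -/

section Simons

variable {m n r : ℕ} {G : Coord n → Matrix (Fin n) (Fin n) ℝ} {f : Coord m → Coord n}
  {U : Set (Coord m)} {W : Set (Coord n)} {x : Coord m}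

lemma inner_tangent_of_eq_one (hg : inducedMetric G f x = 1) (i j : Fin m) :
    inner G (f x) (tangent f i x) (tangent f j x) = if i = j then 1 else 0 := by
  have := congrFun (congrFun hg i) j
  rwa [Matrix.one_apply] at this

lemma inducedInv_of_eq_one (hg : inducedMetric G f x = 1) (i j : Fin m) :
    inducedInv G f i j x = if i = j then 1 else 0 := by
  rw [inducedInv, hg, inv_one, Matrix.one_apply]

lemma inducedRiemann_of_eq_one (hf : IsImmersionOn G f U W) (hx : x ∈ U)
    (hg : inducedMetric G f x = 1) (q k i j : Fin m) :
    inducedRiemann G f q k i j x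
      = - curvatureOn G (f x) (tangent f k x) (tangent f i x) (tangent f j x) (tangent f q x)
        + inner G (f x) (secondFF G f i j x) (secondFF G f k q x)
        - inner G (f x) (secondFF G f k j x) (secondFF G f i q x) := by
  rw [← sum_inducedRiemann_mul hf hx]
  simp [inner_tangent_of_eq_one hg]

lemma meanCurvature_of_eq_one (hg : inducedMetric G f x = 1) :
    meanCurvature G f x = ∑ k, secondFF G f k k x := by
  rw [meanCurvature_eq]
  simp [inducedInv_of_eq_one hg]

lemma IsNormalFrame.isNormal (hf : IsMapOn G f U W) (hx : x ∈ U) {ν : Fin r → Fin n → ℝ}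
    (hν : IsNormalFrame G f x ν) (α : Fin r) : IsNormal G f x (ν α) := fun l => by
  rw [inner_comm hf.metric (hf.mapsTo x hx)]
  exact hν.normal α l

/-- Expansion of a normal vector in an orthonormal normal frame. -/
lemma IsNormalFrame.sum_inner_smul (hmn : m + r = n) (hf : IsMapOn G f U W) (hx : x ∈ U)
    (hg : inducedMetric G f x = 1) {ν : Fin r → Fin n → ℝ} (hν : IsNormalFrame G f x ν)
    {v : Fin n → ℝ} (hv : IsNormal G f x v) :
    v = ∑ α, MCF.inner G (f x) v (ν α) • ν α := by
  -- Tangent and normal vectors together are orthonormal, hence independent, and m + r = n makes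
  -- them a basis; the tangential coefficients of a normal vector vanish.
  let b : Fin m ⊕ Fin r → Fin n → ℝ := Sum.elim (fun i => tangent f i x) ν
  have hb : ∀ c d, MCF.inner G (f x) (b c) (b d) = if c = d then 1 else 0 := by
    rintro (i | α) (j | β)
    · simpa [b] using inner_tangent_of_eq_one hg i j
    · simpa [b] using hν.isNormal hf hx β i
    · simpa [b] using hν.normal α j
    · simpa [b] using hν.orthonormal α β
  have hc : ∀ (a : Fin m ⊕ Fin r → ℝ) (d), MCF.inner G (f x) (∑ c, a c • b c) (b d) = a d := by
    intro a d
    rw [inner_sum_left]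
    simp [inner_smul_left, hb]
  have hli : LinearIndependent ℝ b := by
    rw [Fintype.linearIndependent_iff]
    intro a ha d
    rw [← hc a d, ha, inner_eq]
    simp
  have hcard : Fintype.card (Fin m ⊕ Fin r) = Module.finrank ℝ (Fin n → ℝ) := by simp [hmn]
  have hspan : v ∈ Submodule.span ℝ (range b) := by
    rw [hli.span_eq_top_of_card_eq_finrank' hcard]
    trivial
  obtain ⟨a, ha⟩ := (Submodule.mem_span_range_iff_exists_fun ℝ).1 hspan
  have h1 : ∀ i, a (Sum.inl i) = 0 := fun i => by
    rw [← hc a, ha, inner_comm hf.metric (hf.mapsTo x hx)]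
    exact hv i
  have h2 : ∀ α, a (Sum.inr α) = MCF.inner G (f x) v (ν α) := fun α => by
    rw [← hc a, ha]
    rfl
  conv_lhs => rw [← ha, Fintype.sum_sum_type]
  simp [h1, h2, b]

lemma IsNormalFrame.inner_eq_sum (hmn : m + r = n) (hf : IsMapOn G f U W) (hx : x ∈ U)
    (hg : inducedMetric G f x = 1) {ν : Fin r → Fin n → ℝ} (hν : IsNormalFrame G f x ν)
    {v : Fin n → ℝ} (hv : IsNormal G f x v) (w : Fin n → ℝ) :
    MCF.inner G (f x) v w = ∑ α, MCF.inner G (f x) v (ν α) * MCF.inner G (f x) (ν α) w := by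
  conv_lhs => rw [hν.sum_inner_smul hmn hf hx hg hv]
  rw [inner_sum_left]
  simp only [inner_smul_left]

lemma hCoeff_symm (hf : IsMapOn G f U W) (hx : x ∈ U) (ν : Fin r → Fin n → ℝ) (α : Fin r)
    (i j : Fin m) : hCoeff G f x ν α i j = hCoeff G f x ν α j i := by
  rw [hCoeff, secondFF_symm hf hx, ← hCoeff]

/-- The trace of the commutation formulas for the second fundamental form. -/
lemma sum_ambientDeriv2SFF (hf : IsImmersionOn G f U W) (hx : x ∈ U)
    {ν : Fin n → ℝ} (hν : IsNormal G f x ν) (i j : Fin m) :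
    ∑ k, inner G (f x) (ambientDeriv2SFF G f j i k k x) ν
      = ∑ k, inner G (f x) (ambientDeriv2SFF G f k k i j x) ν
        + ∑ k, covDerivCurvatureOn G (f x) (tangent f k x) ν (tangent f i x) (tangent f j x)
            (tangent f k x)
        + ∑ k, covDerivCurvatureOn G (f x) (tangent f j x) ν (tangent f k x) (tangent f i x)
            (tangent f k x)
        + ∑ k, curvatureOn G (f x) (secondFF G f k k x) (tangent f j x) (tangent f i x) ν
        + 2 * ∑ k, curvatureOn G (f x) ν (secondFF G f i k x) (tangent f j x) (tangent f k x)
        + 2 * ∑ k, curvatureOn G (f x) ν (secondFF G f j k x) (tangent f i x) (tangent f k x)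
        + ∑ k, curvatureOn G (f x) ν (tangent f k x) (secondFF G f i j x) (tangent f k x)
        + 2 * ∑ k, ∑ q, inducedRiemann G f q k j i x * inner G (f x) (secondFF G f k q x) ν
        + ∑ k, ∑ q, inducedRiemann G f q k j k x * inner G (f x) (secondFF G f q i x) ν
        + ∑ k, ∑ q, inducedRiemann G f q k i k x * inner G (f x) (secondFF G f j q x) ν := by
  have hm := hf.toIsMapOn
  have hG := hf.metric
  have hy := hf.mapsTo x hx
  simp only [Finset.mul_sum (a := (2 : ℝ)), ← Finset.sum_add_distrib]
  refine Finset.sum_congr rfl fun k _ => ?_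
  have s1 := ambientDeriv2SFF_symm hm hx k k i j
  have s2 := ambientDeriv2SFF_symm hm hx j k k i
  -- The three moves ∇_k∇_k A_ji → ∇_k∇_j A_ki → ∇_j∇_k A_ki → ∇_j∇_i A_kk, valid for each fixed
  -- `k`.
  have c1 := inner_ambientDeriv2SFF_sub hf hx hν k k j i
  have c2 := congrArg (fun v => inner G (f x) v ν) (ambientDeriv2SFF_sub hf hx k j k i)
  have c3 := inner_ambientDeriv2SFF_sub hf hx hν j k i k
  simp only [inner_sub_left, inner_neg_left, inner_sum_left, inner_smul_left,
    inner_curvatureVec] at c2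
  rw [← s1] at c1
  rw [s2] at c2
  -- The terms K(∂_k, A_jk, ∂_i, ν) from `c1` and K(A_jk, ∂_i, ∂_k, ν) from `c3` combine into a
  -- second copy of K(∂_k, ∂_i, A_jk, ν). This produces one of the factors 2; the other comes from
  -- `c1` and `c2` together.
  have b := curvatureOn_bianchi hG hy (tangent f k x) (secondFF G f j k x) (tangent f i x) ν
  have b1 := curvatureOn_swap (G := G) (y := f x) (tangent f i x) (tangent f k x)
    (secondFF G f j k x) ν
  rw [secondFF_symm hm hx k j, secondFF_symm hm hx k i] at c1
  rw [secondFF_symm hm hx k i] at c2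
  rw [secondFF_symm hm hx j i] at c3
  rw [covDerivCurvatureOn_reverse hG hy _ ν, covDerivCurvatureOn_reverse hG hy _ ν,
    curvatureOn_reverse hG hy ν, curvatureOn_reverse hG hy ν, curvatureOn_reverse hG hy ν]
  rw [← Finset.mul_sum]
  linarith

/-- The cubic terms of the evolution equation. -/
lemma cubic_terms (h : Fin r → Fin m → Fin m → ℝ) (hs : ∀ α i j, h α i j = h α j i)
    (α : Fin r) (i j : Fin m) :
    - ∑ q, h α i q * ∑ γ, (h γ q j * ∑ k, h γ k k - ∑ k, h γ q k * h γ j k)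
      - ∑ q, ∑ k, h α q k * ∑ γ, (h γ q j * h γ i k - h γ q k * h γ i j)
      - ∑ β, ∑ k, h β i k * ∑ l, (h β l j * h α l k - h β l k * h α l j)
      - ∑ β, ∑ k, h α j k * h β i k * ∑ k, h β k k
    = - ∑ k, ∑ q, (∑ γ, h γ i j * h γ k q) * h α k q
      + 2 * ∑ k, ∑ q, (∑ γ, h γ j i * h γ k q - ∑ γ, h γ k i * h γ j q) * h α k q
      + ∑ k, ∑ q, (∑ γ, h γ j k * h γ k q - ∑ γ, h γ k k * h γ j q) * h α q i
      + ∑ k, ∑ q, (∑ γ, h γ i k * h γ k q - ∑ γ, h γ k k * h γ i q) * h α j q := by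
  -- On the right of the claim, the first term is the gap between ambient and normal Laplacians and
  -- the other three come from the Gauss equation. All contractions are brought to the summation
  -- order k, q, γ and matched by the symmetry of `h`.
  have e1 : ∑ q, ∑ γ, ∑ k, h α i q * (h γ q j * h γ k k)
      = ∑ k, ∑ q, ∑ γ, h γ k k * h γ j q * h α q i := by
    simp only [← Fintype.sum_prod_type']
    exact Finset.sum_nbij' (fun (q, γ, k) => (k, q, γ)) (fun (k, q, γ) => (q, γ, k))
      (by simp) (by simp) (by simp) (by simp) fun (q, γ, k) _ => by
        simp only [hs α i q, hs γ q j]; ring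
  have e2 : ∑ q, ∑ γ, ∑ k, h α i q * (h γ q k * h γ j k)
      = ∑ k, ∑ q, ∑ γ, h γ j k * h γ k q * h α q i := by
    simp only [← Fintype.sum_prod_type']
    exact Finset.sum_nbij' (fun (q, γ, k) => (k, q, γ)) (fun (k, q, γ) => (q, γ, k))
      (by simp) (by simp) (by simp) (by simp) fun (q, γ, k) _ => by
        simp only [hs α i q, hs γ q k]; ring
  have e3 : ∑ q, ∑ k, ∑ γ, h α q k * (h γ q j * h γ i k)
      = ∑ k, ∑ q, ∑ γ, h γ k i * h γ j q * h α k q := by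
    simp only [← Fintype.sum_prod_type']
    exact Finset.sum_nbij' (fun (q, k, γ) => (k, q, γ)) (fun (k, q, γ) => (q, k, γ))
      (by simp) (by simp) (by simp) (by simp) fun (q, k, γ) _ => by
        simp only [hs α q k, hs γ q j, hs γ i k]; ring
  have e4 : ∑ q, ∑ k, ∑ γ, h α q k * (h γ q k * h γ i j)
      = ∑ k, ∑ q, ∑ γ, h γ i j * h γ k q * h α k q := by
    simp only [← Fintype.sum_prod_type']
    exact Finset.sum_congr rfl fun _ _ => by ring
  have e5 : ∑ β, ∑ k, ∑ l, h β i k * (h β l j * h α l k)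
      = ∑ k, ∑ q, ∑ γ, h γ k i * h γ j q * h α k q := by
    simp only [← Fintype.sum_prod_type']
    exact Finset.sum_nbij' (fun (γ, k, q) => (k, q, γ)) (fun (k, q, γ) => (γ, k, q))
      (by simp) (by simp) (by simp) (by simp) fun (γ, k, q) _ => by
        simp only [hs α q k, hs γ q j, hs γ i k]; ring
  have e6 : ∑ β, ∑ k, ∑ l, h β i k * (h β l k * h α l j)
      = ∑ k, ∑ q, ∑ γ, h γ i k * h γ k q * h α j q := by
    simp only [← Fintype.sum_prod_type']
    exact Finset.sum_nbij' (fun (γ, k, q) => (k, q, γ)) (fun (k, q, γ) => (γ, k, q))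
      (by simp) (by simp) (by simp) (by simp) fun (γ, k, q) _ => by
        simp only [hs α q j, hs γ q k]; ring
  have e7 : ∑ β, ∑ k, ∑ l, h α j k * h β i k * h β l l
      = ∑ k, ∑ q, ∑ γ, h γ k k * h γ i q * h α j q := by
    simp only [← Fintype.sum_prod_type']
    exact Finset.sum_nbij' (fun (γ, q, k) => (k, q, γ)) (fun (k, q, γ) => (γ, q, k))
      (by simp) (by simp) (by simp) (by simp) fun _ _ => by ring
  have e8 : ∑ k, ∑ q, ∑ γ, h γ j i * h γ k q * h α k q
      = ∑ k, ∑ q, ∑ γ, h γ i j * h γ k q * h α k q := by simp only [fun γ => hs γ j i]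
  simp only [Finset.mul_sum, mul_sub, Finset.sum_sub_distrib, sub_mul, Finset.sum_mul]
  simp only [← Finset.mul_sum (a := (2 : ℝ))]
  rw [e1, e2, e3, e4, e5, e6, e7, e8]
  ring

/-- The equation of Simons: the ambient Hessian of the mean curvature vector in terms of the
Laplacian of the second fundamental form. -/
lemma simons (hmn : m + r = n) (hf : IsImmersionOn G f U W) (hx : x ∈ U)
    (hg : inducedMetric G f x = 1) {ν : Fin r → Fin n → ℝ} (hν : IsNormalFrame G f x ν)
    (α : Fin r) (i j : Fin m) :
    inner G (f x) (covDeriv G f j (covDeriv G f i (meanCurvature G f)) x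
        - ∑ q, inducedConn G f q j i x • covDeriv G f q (meanCurvature G f) x) (ν α)
      - curvatureOn G (f x) (meanCurvature G f x) (tangent f j x) (tangent f i x) (ν α)
    = hEvolution G f x ν 0 α i j := by
  have hm := hf.toIsMapOn
  have hG := hf.metric
  have hy := hf.mapsTo x hx
  have hα := hν.isNormal hm hx α
  have hA := fun i j => isNormal_secondFF hf hx i j
  have hexp : ∀ i j, secondFF G f i j x = ∑ β, hCoeff G f x ν β i j • ν β := fun i j =>
    hν.sum_inner_smul hmn hm hx hg (hA i j)
  have hsym := hCoeff_symm hm hx ν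
  have hS : ∀ i j k l, inner G (f x) (secondFF G f i j x) (secondFF G f k l x)
      = ∑ γ, hCoeff G f x ν γ i j * hCoeff G f x ν γ k l := fun i j k l => by
    rw [hν.inner_eq_sum hmn hm hx hg (hA i j)]
    refine Finset.sum_congr rfl fun γ _ => ?_
    rw [inner_comm hG hy (ν γ)]
    rfl
  have hlap : inner G (f x) (laplacianSFF G f i j x) (ν α)
      = ∑ k, inner G (f x) (ambientDeriv2SFF G f k k i j x) (ν α)
        + ∑ k, ∑ q, (∑ γ, hCoeff G f x ν γ i j * hCoeff G f x ν γ k q)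
          * hCoeff G f x ν α k q := by
    have h1 : laplacianSFF G f i j x
        = ∑ k, ∑ l, inducedInv G f k l x • covDeriv2SFF G f l k i j x := by
      funext B
      simp [laplacianSFF]
    rw [h1]
    simp only [inducedInv_of_eq_one hg, ite_smul, one_smul, zero_smul, Finset.sum_ite_eq,
      Finset.mem_univ, if_true, inner_sum_left, inner_covDeriv2SFF hf hx hα, ite_mul, one_mul,
      zero_mul, Finset.sum_add_distrib, hS]
    rfl
  have h1 : inner G (f x) (covDeriv G f j (covDeriv G f i (meanCurvature G f)) x
        - ∑ q, inducedConn G f q j i x • covDeriv G f q (meanCurvature G f) x) (ν α)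
      = ∑ k, inner G (f x) (ambientDeriv2SFF G f j i k k x) (ν α) := by
    rw [covDeriv_covDeriv_meanCurvature hf hx]
    simp [inducedInv_of_eq_one hg, inner_sum_left]
  -- This is the trace term appearing in `sum_ambientDeriv2SFF`, so it cancels from the left side.
  have h2 : curvatureOn G (f x) (meanCurvature G f x) (tangent f j x) (tangent f i x) (ν α)
      = ∑ k, curvatureOn G (f x) (secondFF G f k k x) (tangent f j x) (tangent f i x) (ν α) := by
    rw [meanCurvature_of_eq_one hg]
    have := map_sum_smul_of_isLinearMap (isLinearMap_curvatureOn₁ G (f x) (tangent f j x)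
      (tangent f i x) (ν α)) Finset.univ (fun _ => (1 : ℝ)) (fun k => secondFF G f k k x)
    simpa only [one_smul, one_mul] using this
  have k2 : ∀ i j, ∑ k, curvatureOn G (f x) (ν α) (secondFF G f i k x) (tangent f j x)
        (tangent f k x)
      = ∑ β, ∑ k, curvatureOn G (f x) (ν α) (ν β) (tangent f j x) (tangent f k x)
        * hCoeff G f x ν β i k := by
    intro i j
    rw [Finset.sum_comm]
    refine Finset.sum_congr rfl fun k _ => ?_
    rw [hexp, map_sum_smul_of_isLinearMap (isLinearMap_curvatureOn₂ G _ _ _ _)]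
    exact Finset.sum_congr rfl fun β _ => mul_comm _ _
  have k3 : ∑ k, curvatureOn G (f x) (ν α) (tangent f k x) (secondFF G f i j x) (tangent f k x)
      = ∑ β, ∑ k, curvatureOn G (f x) (ν α) (tangent f k x) (ν β) (tangent f k x)
        * hCoeff G f x ν β i j := by
    rw [Finset.sum_comm]
    refine Finset.sum_congr rfl fun k _ => ?_
    rw [hexp, map_sum_smul_of_isLinearMap (isLinearMap_curvatureOn₃ G _ _ _ _)]
    exact Finset.sum_congr rfl fun β _ => mul_comm _ _
  -- The Gauss equation delivers K on tangent vectors in its own slot order; reversal and a renaming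
  -- of the summed indices give the order of the evolution equation.
  have k4 : ∑ k, ∑ q, curvatureOn G (f x) (tangent f k x) (tangent f j x) (tangent f i x)
        (tangent f q x) * hCoeff G f x ν α k q
      = ∑ l, ∑ k, curvatureOn G (f x) (tangent f l x) (tangent f i x) (tangent f j x)
        (tangent f k x) * hCoeff G f x ν α l k := by
    rw [Finset.sum_comm]
    refine Finset.sum_congr rfl fun l _ => Finset.sum_congr rfl fun k _ => ?_
    rw [curvatureOn_reverse hG hy, hsym]
  have k5 : ∀ i j, ∑ k, ∑ q, curvatureOn G (f x) (tangent f k x) (tangent f i x) (tangent f k x)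
        (tangent f q x) * hCoeff G f x ν α q j
      = ∑ l, ∑ k, curvatureOn G (f x) (tangent f l x) (tangent f k x) (tangent f i x)
        (tangent f k x) * hCoeff G f x ν α l j := by
    intro i j
    rw [Finset.sum_comm]
    refine Finset.sum_congr rfl fun l _ => Finset.sum_congr rfl fun k _ => ?_
    rw [curvatureOn_reverse hG hy]
  have hc := cubic_terms (hCoeff G f x ν) hsym α i j
  -- The argument `0` switches off the frame rotation term, as no motion of the frame is involved
  -- here.
  have hz : ∀ β, inner G (f x) (ν β) ((0 : Fin r → Fin n → ℝ) α) = 0 := fun β => by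
    simp [inner_eq]
  have hh : ∀ i j, inner G (f x) (secondFF G f i j x) (ν α) = hCoeff G f x ν α i j :=
    fun _ _ => rfl
  have k6 := k5 i j
  simp only [fun q => hsym α q j] at k6
  simp only [hEvolution]
  rw [h1, h2, sum_ambientDeriv2SFF hf hx hα, hlap]
  simp only [inducedRiemann_of_eq_one hf hx hg, hh, hz, mul_zero, Finset.sum_const_zero,
    hS, k2, k3]
  simp only [sub_mul, add_mul, neg_mul, Finset.sum_sub_distrib, Finset.sum_add_distrib,
    Finset.sum_neg_distrib, fun l => hsym α l j] at hc ⊢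
  rw [k4, k5 j i, k6]
  linarith

end Simons

/-! ### The Laplacian of the squared norm of the second fundamental form -/

section NormSq

variable {m n r : ℕ} {G : Coord n → Matrix (Fin n) (Fin n) ℝ} {f : Coord m → Coord n}
  {U : Set (Coord m)} {W : Set (Coord n)} {x : Coord m}

lemma tensorInner_of_eq_one (hg : inducedMetric G f x = 1)
    (T T' : Fin m → Fin m → Coord m → Fin n → ℝ) :
    tensorInner G f T T' x = ∑ i, ∑ j, inner G (f x) (T i j x) (T' i j x) := by
  simp [tensorInner, inducedInv_of_eq_one hg, ite_mul]

/-- Two applications of the product rule for ambient derivatives; the Γ^q_{kk} term of the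
Laplace–Beltrami operator is the missing correction that turns the iterated derivative into
`ambientDeriv2SFF`. The metric is set to the identity only after differentiating. -/
lemma laplaceBeltrami_normSqSFF (hf : IsImmersionOn G f U W) (hx : x ∈ U)
    (hg : inducedMetric G f x = 1) :
    laplaceBeltrami G f (normSqSFF G f) x
      = 2 * ∑ k, ∑ i, ∑ j, (inner G (f x) (ambientDeriv2SFF G f k k i j x) (secondFF G f i j x)
        + inner G (f x) (ambientDerivSFF G f k i j x) (ambientDerivSFF G f k i j x)) := by
  have hm := hf.toIsMapOn
  have hA := smoothField_secondFF hf
  have hB := smoothField_ambientDerivSFF hf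
  have hcomm := inner_comm hf.metric (hf.mapsTo x hx)
  have h1 : ∀ l, ∀ z ∈ U, partialDeriv l (normSqSFF G f) z
      = tensorInner G f (ambientDerivSFF G f l) (secondFF G f) z
        + tensorInner G f (secondFF G f) (ambientDerivSFF G f l) z := fun l z hz =>
    partialDeriv_tensorInner hf hz hA hA l
  have h2 : ∀ k, partialDeriv k (partialDeriv k (normSqSFF G f)) x
      = tensorInner G f (tensorDeriv G f (ambientDerivSFF G f k) k) (secondFF G f) x
        + tensorInner G f (ambientDerivSFF G f k) (ambientDerivSFF G f k) x
        + (tensorInner G f (ambientDerivSFF G f k) (ambientDerivSFF G f k) x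
        + tensorInner G f (secondFF G f) (tensorDeriv G f (ambientDerivSFF G f k) k) x) := by
    intro k
    rw [partialDeriv_congr hf.isOpen hx (h1 k),
      partialDeriv_add (diffAt hf.isOpen (contDiffOn_tensorInner hf (hB k) hA) hx)
        (diffAt hf.isOpen (contDiffOn_tensorInner hf hA (hB k)) hx),
      partialDeriv_tensorInner hf hx (hB k) hA, partialDeriv_tensorInner hf hx hA (hB k)]
    rfl
  simp only [laplaceBeltrami, inducedInv_of_eq_one hg, ite_mul, one_mul, zero_mul,
    Finset.sum_ite_eq, Finset.mem_univ, if_true, h2, fun q => h1 q x hx,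
    tensorInner_of_eq_one hg]
  rw [Finset.mul_sum]
  refine Finset.sum_congr rfl fun k _ => ?_
  have h3 : ∑ q, inducedConn G f q k k x
      * (∑ i, ∑ j, inner G (f x) (ambientDerivSFF G f q i j x) (secondFF G f i j x)
        + ∑ i, ∑ j, inner G (f x) (secondFF G f i j x) (ambientDerivSFF G f q i j x))
      = 2 * ∑ i, ∑ j, inner G (f x) (∑ q, inducedConn G f q k k x • ambientDerivSFF G f q i j x)
        (secondFF G f i j x) := by
    simp only [inner_sum_left, inner_smul_left, hcomm (secondFF G f _ _ x), ← two_mul,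
      Finset.mul_sum]
    simp only [← Fintype.sum_prod_type']
    exact Finset.sum_nbij' (fun (q, i, j) => (i, j, q)) (fun (i, j, q) => (q, i, j))
      (by simp) (by simp) (by simp) (by simp) fun _ _ => by ring
  rw [h3]
  simp only [hcomm (secondFF G f _ _ x), ambientDeriv2SFF, inner_sub_left, Finset.sum_add_distrib,
    Finset.sum_sub_distrib]
  ring

/-- Pythagoras: the normal derivative is the ambient one without its tangential part, whose
components are −⟨A_ij, A_kp⟩. -/
lemma normSqCovDerivSFF_of_eq_one (hf : IsImmersionOn G f U W) (hx : x ∈ U)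
    (hg : inducedMetric G f x = 1) :
    normSqCovDerivSFF G f x = ∑ k, ∑ i, ∑ j,
      (inner G (f x) (ambientDerivSFF G f k i j x) (ambientDerivSFF G f k i j x)
        - ∑ p, inner G (f x) (secondFF G f i j x) (secondFF G f k p x) ^ 2) := by
  have hcomm := inner_comm hf.metric (hf.mapsTo x hx)
  simp only [normSqCovDerivSFF, inducedInv_of_eq_one hg, ite_mul, one_mul, zero_mul,
    mul_ite, mul_one, mul_zero, Finset.sum_ite_eq, Finset.mem_univ, if_true,
    covDerivSFF_eq hf hx]
  refine Finset.sum_congr rfl fun k _ => Finset.sum_congr rfl fun i _ =>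
    Finset.sum_congr rfl fun j _ => ?_
  simp only [inner_add_left, inner_add_right, inner_sum_left, inner_sum_right, inner_smul_left,
    inner_smul_right, inner_ambientDerivSFF_tangent hf hx,
    hcomm (tangent f _ x) (ambientDerivSFF G f _ _ _ x), inner_tangent_of_eq_one hg, mul_ite,
    mul_one, mul_zero, Finset.sum_ite_eq', Finset.mem_univ, if_true, mul_neg,
    Finset.sum_neg_distrib, neg_add_cancel, Finset.sum_const_zero, add_zero, pow_two]
  ring

/-- The Bochner formula for the second fundamental form. -/
lemma laplaceBeltrami_sub_normSqCovDerivSFF (hmn : m + r = n) (hf : IsImmersionOn G f U W)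
    (hx : x ∈ U) (hg : inducedMetric G f x = 1) {ν : Fin r → Fin n → ℝ}
    (hν : IsNormalFrame G f x ν) :
    laplaceBeltrami G f (normSqSFF G f) x - 2 * normSqCovDerivSFF G f x
      = 2 * ∑ α, ∑ i, ∑ j, inner G (f x) (laplacianSFF G f i j x) (ν α)
        * hCoeff G f x ν α i j := by
  have hcomm := inner_comm hf.metric (hf.mapsTo x hx)
  -- A_ij is itself normal, so `inner_covDeriv2SFF` applies with ν = A_ij and its correction becomes
  -- a sum of squares. The same squares are lost in |∇A|², which makes the Bochner formula hold
  -- without remainder.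
  have h1 : ∀ i j, ∑ α, inner G (f x) (laplacianSFF G f i j x) (ν α) * hCoeff G f x ν α i j
      = ∑ k, (inner G (f x) (ambientDeriv2SFF G f k k i j x) (secondFF G f i j x)
        + ∑ p, inner G (f x) (secondFF G f i j x) (secondFF G f k p x) ^ 2) := by
    intro i j
    have hA := isNormal_secondFF hf hx i j
    have h2 : laplacianSFF G f i j x
        = ∑ k, ∑ l, inducedInv G f k l x • covDeriv2SFF G f l k i j x := by
      funext B
      simp [laplacianSFF]
    trans inner G (f x) (laplacianSFF G f i j x) (secondFF G f i j x)
    · rw [hcomm (laplacianSFF G f i j x), hν.inner_eq_sum hmn hf.toIsMapOn hx hg hA]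
      refine Finset.sum_congr rfl fun α _ => ?_
      rw [hcomm (ν α), mul_comm]
      rfl
    · rw [h2]
      simp only [inducedInv_of_eq_one hg, ite_smul, one_smul, zero_smul, Finset.sum_ite_eq,
        Finset.mem_univ, if_true, inner_sum_left, inner_covDeriv2SFF hf hx hA, ite_mul, one_mul,
        zero_mul]
      refine Finset.sum_congr rfl fun k _ => ?_
      congr 1
      refine Finset.sum_congr rfl fun p _ => ?_
      rw [hcomm (secondFF G f k p x), pow_two]
  have h3 : ∑ α, ∑ i, ∑ j, inner G (f x) (laplacianSFF G f i j x) (ν α) * hCoeff G f x ν α i j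
      = ∑ k, ∑ i, ∑ j, (inner G (f x) (ambientDeriv2SFF G f k k i j x) (secondFF G f i j x)
        + ∑ p, inner G (f x) (secondFF G f i j x) (secondFF G f k p x) ^ 2) := by
    trans ∑ i, ∑ j, ∑ α, inner G (f x) (laplacianSFF G f i j x) (ν α) * hCoeff G f x ν α i j
    · simp only [← Fintype.sum_prod_type']
      exact Finset.sum_nbij' (fun (α, i, j) => (i, j, α)) (fun (i, j, α) => (α, i, j))
        (by simp) (by simp) (by simp) (by simp) fun _ _ => rfl
    · simp only [h1]
      simp only [← Fintype.sum_prod_type']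
      exact Finset.sum_nbij' (fun (i, j, k) => (k, i, j)) (fun (k, i, j) => (i, j, k))
        (by simp) (by simp) (by simp) (by simp) fun _ _ => rfl
  rw [h3, laplaceBeltrami_normSqSFF hf hx hg, normSqCovDerivSFF_of_eq_one hf hx hg]
  simp only [Finset.sum_add_distrib, Finset.sum_sub_distrib]
  ring

/-- The quartic terms of the evolution equation. -/
lemma quartic_terms (h : Fin r → Fin m → Fin m → ℝ) (hs : ∀ α i j, h α i j = h α j i) :
    4 * ∑ i, ∑ j, ∑ k, (∑ β, h β i k * ∑ l, h β l l) * (∑ α, h α i j * h α k j)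
      + 2 * ∑ α, ∑ i, ∑ j,
        (- ∑ q, h α i q * ∑ γ, (h γ q j * ∑ k, h γ k k - ∑ k, h γ q k * h γ j k)
        - ∑ q, ∑ k, h α q k * ∑ γ, (h γ q j * h γ i k - h γ q k * h γ i j)
        - ∑ β, ∑ k, h β i k * ∑ l, (h β l j * h α l k - h β l k * h α l j)
        - ∑ β, ∑ k, h α j k * h β i k * ∑ k, h β k k) * h α i j
    = 2 * ∑ α, ∑ γ, ∑ i, ∑ q, (∑ k, (h α i k * h γ q k - h α q k * h γ i k)) ^ 2
      + 2 * ∑ i, ∑ j, ∑ q, ∑ k, (∑ α, h α i j * h α q k) ^ 2 := by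
  -- Four contractions occur. The type `a` contains the trace of `h` and cancels, 4 − 2 − 2 = 0; `b`
  -- and `c` are the diagonal and mixed products of the commutator square, each found twice on both
  -- sides; `d` is the last sum of squares.
  have a1 : ∑ i, ∑ j, ∑ k, (∑ β, h β i k * ∑ l, h β l l) * (∑ α, h α i j * h α k j)
      = ∑ α, ∑ β, ∑ i, ∑ j, ∑ k, ∑ l, h β i k * h β l l * h α i j * h α k j := by
    simp only [Finset.sum_mul, Finset.mul_sum]
    simp only [← Fintype.sum_prod_type']
    exact Finset.sum_nbij' (fun (i, j, k, α, β, l) => (α, β, i, j, k, l))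
      (fun (α, β, i, j, k, l) => (i, j, k, α, β, l)) (by simp) (by simp) (by simp) (by simp)
      fun _ _ => by ring
  have a2 : ∑ α, ∑ i, ∑ j, (∑ q, ∑ γ, ∑ k, h α i q * (h γ q j * h γ k k)) * h α i j
      = ∑ α, ∑ β, ∑ i, ∑ j, ∑ k, ∑ l, h β i k * h β l l * h α i j * h α k j := by
    simp only [Finset.sum_mul]
    simp only [← Fintype.sum_prod_type']
    exact Finset.sum_nbij' (fun (α, i, j, q, γ, k) => (α, γ, q, i, j, k))
      (fun (α, γ, q, i, j, k) => (α, i, j, q, γ, k)) (by simp) (by simp) (by simp) (by simp)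
      fun (α, i, j, q, γ, k) _ => by simp only [hs α i q, hs α i j]; ring
  have a3 : ∑ α, ∑ i, ∑ j, (∑ β, ∑ k, ∑ l, h α j k * h β i k * h β l l) * h α i j
      = ∑ α, ∑ β, ∑ i, ∑ j, ∑ k, ∑ l, h β i k * h β l l * h α i j * h α k j := by
    simp only [Finset.sum_mul]
    simp only [← Fintype.sum_prod_type']
    exact Finset.sum_nbij' (fun (α, i, j, β, k, l) => (α, β, i, j, k, l))
      (fun (α, β, i, j, k, l) => (α, i, j, β, k, l)) (by simp) (by simp) (by simp) (by simp)
      fun (α, i, j, β, k, l) _ => by simp only [hs α j k]; ring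
  have b1 : ∑ α, ∑ i, ∑ j, (∑ q, ∑ γ, ∑ k, h α i q * (h γ q k * h γ j k)) * h α i j
      = ∑ α, ∑ γ, ∑ i, ∑ q, ∑ k, ∑ l, h α i k * h γ q k * (h α i l * h γ q l) := by
    simp only [Finset.sum_mul]
    simp only [← Fintype.sum_prod_type']
    exact Finset.sum_nbij' (fun (α, i, j, q, γ, k) => (α, γ, i, k, q, j))
      (fun (α, γ, i, k, q, j) => (α, i, j, q, γ, k)) (by simp) (by simp) (by simp) (by simp)
      fun (α, i, j, q, γ, k) _ => by simp only [hs γ k q, hs γ k j]; ring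
  have b2 : ∑ α, ∑ i, ∑ j, (∑ β, ∑ k, ∑ l, h β i k * (h β l k * h α l j)) * h α i j
      = ∑ α, ∑ γ, ∑ i, ∑ q, ∑ k, ∑ l, h α i k * h γ q k * (h α i l * h γ q l) := by
    simp only [Finset.sum_mul]
    simp only [← Fintype.sum_prod_type']
    exact Finset.sum_nbij' (fun (α, i, j, β, k, l) => (α, β, j, k, i, l))
      (fun (α, β, j, k, i, l) => (α, i, j, β, k, l)) (by simp) (by simp) (by simp) (by simp)
      fun (α, i, j, β, k, l) _ => by
        simp only [hs β k i, hs β k l, hs α j i, hs α j l]; ring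
  have b3 : ∑ α, ∑ γ, ∑ i, ∑ q, ∑ k, ∑ l, h α q k * h γ i k * (h α q l * h γ i l)
      = ∑ α, ∑ γ, ∑ i, ∑ q, ∑ k, ∑ l, h α i k * h γ q k * (h α i l * h γ q l) :=
    Finset.sum_congr rfl fun _ _ => Finset.sum_congr rfl fun _ _ => Finset.sum_comm
  have c1 : ∑ α, ∑ i, ∑ j, (∑ q, ∑ k, ∑ γ, h α q k * (h γ q j * h γ i k)) * h α i j
      = ∑ α, ∑ γ, ∑ i, ∑ q, ∑ k, ∑ l, h α i k * h γ q k * (h α q l * h γ i l) := by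
    simp only [Finset.sum_mul]
    simp only [← Fintype.sum_prod_type']
    exact Finset.sum_nbij' (fun (α, i, j, q, k, γ) => (α, γ, i, q, j, k))
      (fun (α, γ, i, q, j, k) => (α, i, j, q, k, γ)) (by simp) (by simp) (by simp) (by simp)
      fun _ _ => by ring
  have c2 : ∑ α, ∑ i, ∑ j, (∑ β, ∑ k, ∑ l, h β i k * (h β l j * h α l k)) * h α i j
      = ∑ α, ∑ γ, ∑ i, ∑ q, ∑ k, ∑ l, h α i k * h γ q k * (h α q l * h γ i l) := by
    simp only [Finset.sum_mul]
    simp only [← Fintype.sum_prod_type']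
    exact Finset.sum_nbij' (fun (α, i, j, β, k, l) => (α, β, i, l, j, k))
      (fun (α, β, i, l, j, k) => (α, i, j, β, k, l)) (by simp) (by simp) (by simp) (by simp)
      fun _ _ => by ring
  have c3 : ∑ α, ∑ γ, ∑ i, ∑ q, ∑ k, ∑ l, h α q k * h γ i k * (h α i l * h γ q l)
      = ∑ α, ∑ γ, ∑ i, ∑ q, ∑ k, ∑ l, h α i k * h γ q k * (h α q l * h γ i l) :=
    Finset.sum_congr rfl fun _ _ => Finset.sum_congr rfl fun _ _ => Finset.sum_comm
  have d1 : ∑ α, ∑ i, ∑ j, (∑ q, ∑ k, ∑ γ, h α q k * (h γ q k * h γ i j)) * h α i j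
      = ∑ i, ∑ j, ∑ q, ∑ k, ∑ α, ∑ γ, h α i j * h α q k * (h γ i j * h γ q k) := by
    simp only [Finset.sum_mul]
    simp only [← Fintype.sum_prod_type']
    exact Finset.sum_nbij' (fun (α, i, j, q, k, γ) => (i, j, q, k, α, γ))
      (fun (i, j, q, k, α, γ) => (α, i, j, q, k, γ)) (by simp) (by simp) (by simp) (by simp)
      fun _ _ => by ring
  have hsq : ∀ α γ i q, (∑ k, (h α i k * h γ q k - h α q k * h γ i k)) ^ 2
      = ∑ k, ∑ l, h α i k * h γ q k * (h α i l * h γ q l)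
        + ∑ k, ∑ l, h α q k * h γ i k * (h α q l * h γ i l)
        - ∑ k, ∑ l, h α i k * h γ q k * (h α q l * h γ i l)
        - ∑ k, ∑ l, h α q k * h γ i k * (h α i l * h γ q l) := by
    intro α γ i q
    simp only [← Finset.sum_mul_sum, Finset.sum_sub_distrib]
    ring
  have hsq' : ∀ i j q k, (∑ α, h α i j * h α q k) ^ 2
      = ∑ α, ∑ γ, h α i j * h α q k * (h γ i j * h γ q k) := by
    intro i j q k
    rw [pow_two, Finset.sum_mul_sum]
  have hE : ∀ α i j,
      - ∑ q, h α i q * ∑ γ, (h γ q j * ∑ k, h γ k k - ∑ k, h γ q k * h γ j k)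
        - ∑ q, ∑ k, h α q k * ∑ γ, (h γ q j * h γ i k - h γ q k * h γ i j)
        - ∑ β, ∑ k, h β i k * ∑ l, (h β l j * h α l k - h β l k * h α l j)
        - ∑ β, ∑ k, h α j k * h β i k * ∑ k, h β k k
      = - ∑ q, ∑ γ, ∑ k, h α i q * (h γ q j * h γ k k)
        + ∑ q, ∑ γ, ∑ k, h α i q * (h γ q k * h γ j k)
        - ∑ q, ∑ k, ∑ γ, h α q k * (h γ q j * h γ i k)
        + ∑ q, ∑ k, ∑ γ, h α q k * (h γ q k * h γ i j)
        - ∑ β, ∑ k, ∑ l, h β i k * (h β l j * h α l k)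
        + ∑ β, ∑ k, ∑ l, h β i k * (h β l k * h α l j)
        - ∑ β, ∑ k, ∑ l, h α j k * h β i k * h β l l := by
    intro α i j
    simp only [Finset.mul_sum, mul_sub, Finset.sum_sub_distrib]
    ring
  rw [a1]
  simp only [hsq, hsq', hE]
  simp only [Finset.sum_sub_distrib, Finset.sum_add_distrib, sub_mul, add_mul,
    neg_mul, Finset.sum_neg_distrib]
  rw [a2, a3, b1, b2, b3, c1, c2, c3, d1]
  ring

end NormSq

/-- The evolution equation of `|A|²` follows from that of `h_{αij}` and of the induced metric. -/
lemma normSqEvolution_eq {m n r : ℕ} {G : Coord n → Matrix (Fin n) (Fin n) ℝ}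
    {f : Coord m → Coord n} {U : Set (Coord m)} {W : Set (Coord n)} {x : Coord m}
    (hmn : m + r = n) (hf : IsImmersionOn G f U W) (hx : x ∈ U) (hg : inducedMetric G f x = 1)
    {ν : Fin r → Fin n → ℝ} (hν : IsNormalFrame G f x ν) :
    4 * ∑ i, ∑ j, ∑ k, (∑ β, hCoeff G f x ν β i k * ∑ l, hCoeff G f x ν β l l)
        * (∑ α, hCoeff G f x ν α i j * hCoeff G f x ν α k j)
      + 2 * ∑ α, ∑ i, ∑ j, hEvolution G f x ν 0 α i j * hCoeff G f x ν α i j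
    = normSqEvolution G f x ν := by
  have hs := hCoeff_symm hf.toIsMapOn hx ν
  have hq := quartic_terms (hCoeff G f x ν) hs
  have hb := laplaceBeltrami_sub_normSqCovDerivSFF hmn hf hx hg hν
  have hz : ∀ α β, inner G (f x) (ν β) ((0 : Fin r → Fin n → ℝ) α) = 0 := fun α β => by
    simp [inner_eq]
  -- Contracted with the symmetric h_{αij}, terms that differ by exchanging `i` and `j` agree.
  -- Together with the factor 2 from differentiating a square, this gives the coefficients 8 here
  -- and −4 in `k2`.
  have k1 : ∑ α, ∑ i, ∑ j, (∑ β, ∑ k, curvatureOn G (f x) (ν α) (ν β) (tangent f i x)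
        (tangent f k x) * hCoeff G f x ν β j k) * hCoeff G f x ν α i j
      = ∑ α, ∑ i, ∑ j, (∑ β, ∑ k, curvatureOn G (f x) (ν α) (ν β) (tangent f j x)
        (tangent f k x) * hCoeff G f x ν β i k) * hCoeff G f x ν α i j := by
    refine Finset.sum_congr rfl fun α _ => ?_
    rw [Finset.sum_comm]
    refine Finset.sum_congr rfl fun i _ => Finset.sum_congr rfl fun j _ => ?_
    rw [hs α i j]
  have k2 : ∑ α, ∑ i, ∑ j, (∑ l, ∑ k, curvatureOn G (f x) (tangent f l x) (tangent f k x)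
        (tangent f j x) (tangent f k x) * hCoeff G f x ν α l i) * hCoeff G f x ν α i j
      = ∑ α, ∑ i, ∑ j, (∑ l, ∑ k, curvatureOn G (f x) (tangent f l x) (tangent f k x)
        (tangent f i x) (tangent f k x) * hCoeff G f x ν α l j) * hCoeff G f x ν α i j := by
    refine Finset.sum_congr rfl fun α _ => ?_
    rw [Finset.sum_comm]
    refine Finset.sum_congr rfl fun i _ => Finset.sum_congr rfl fun j _ => ?_
    rw [hs α i j]
  have hE : ∀ α i j, hEvolution G f x ν 0 α i j * hCoeff G f x ν α i j
      = inner G (f x) (laplacianSFF G f i j x) (ν α) * hCoeff G f x ν α i j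
      + (∑ k, (covDerivCurvatureOn G (f x) (tangent f k x) (ν α) (tangent f i x) (tangent f j x)
          (tangent f k x) + covDerivCurvatureOn G (f x) (tangent f j x) (ν α) (tangent f k x)
          (tangent f i x) (tangent f k x))) * hCoeff G f x ν α i j
      - 2 * ((∑ l, ∑ k, curvatureOn G (f x) (tangent f l x) (tangent f i x) (tangent f j x)
          (tangent f k x) * hCoeff G f x ν α l k) * hCoeff G f x ν α i j)
      + 2 * ((∑ β, ∑ k, curvatureOn G (f x) (ν α) (ν β) (tangent f j x)
          (tangent f k x) * hCoeff G f x ν β i k) * hCoeff G f x ν α i j)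
      + 2 * ((∑ β, ∑ k, curvatureOn G (f x) (ν α) (ν β) (tangent f i x)
          (tangent f k x) * hCoeff G f x ν β j k) * hCoeff G f x ν α i j)
      - (∑ l, ∑ k, curvatureOn G (f x) (tangent f l x) (tangent f k x) (tangent f i x)
          (tangent f k x) * hCoeff G f x ν α l j) * hCoeff G f x ν α i j
      - (∑ l, ∑ k, curvatureOn G (f x) (tangent f l x) (tangent f k x) (tangent f j x)
          (tangent f k x) * hCoeff G f x ν α l i) * hCoeff G f x ν α i j
      + (∑ β, ∑ k, curvatureOn G (f x) (ν α) (tangent f k x) (ν β) (tangent f k x)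
          * hCoeff G f x ν β i j) * hCoeff G f x ν α i j
      + (- ∑ q, hCoeff G f x ν α i q * ∑ γ, (hCoeff G f x ν γ q j * ∑ k, hCoeff G f x ν γ k k
            - ∑ k, hCoeff G f x ν γ q k * hCoeff G f x ν γ j k)
        - ∑ q, ∑ k, hCoeff G f x ν α q k * ∑ γ, (hCoeff G f x ν γ q j * hCoeff G f x ν γ i k
            - hCoeff G f x ν γ q k * hCoeff G f x ν γ i j)
        - ∑ β, ∑ k, hCoeff G f x ν β i k * ∑ l, (hCoeff G f x ν β l j * hCoeff G f x ν α l k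
            - hCoeff G f x ν β l k * hCoeff G f x ν α l j)
        - ∑ β, ∑ k, hCoeff G f x ν α j k * hCoeff G f x ν β i k * ∑ k, hCoeff G f x ν β k k)
          * hCoeff G f x ν α i j := by
    intro α i j
    simp only [hEvolution, hz, mul_zero, Finset.sum_const_zero]
    rw [Finset.sum_add_distrib (f := fun k => covDerivCurvatureOn G (f x) (tangent f k x) (ν α)
      (tangent f i x) (tangent f j x) (tangent f k x))]
    ring
  simp only [hE, Finset.sum_add_distrib (s := (Finset.univ : Finset (Fin m))) (ι := Fin m),
    Finset.sum_add_distrib (s := (Finset.univ : Finset (Fin r))) (ι := Fin r),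
    Finset.sum_sub_distrib, ← Finset.mul_sum (a := (2 : ℝ))] at hq ⊢
  rw [k1, k2]
  simp only [normSqEvolution, Finset.sum_add_distrib]
  rw [hb]
  simp only [Finset.sum_mul, Finset.sum_sub_distrib] at hq ⊢
  linarith

/-! ### Time derivatives -/

section Time

/-- Time derivatives commute with space derivatives; the time interval may contain an end point. -/
lemma hasDerivWithinAt_partialDeriv {m : ℕ} {U : Set (Coord m)} (hU : IsOpen U) {J : Set ℝ}
    (hJ : UniqueDiffOn ℝ J) (hJc : J ⊆ closure (interior J)) {u : ℝ → Coord m → ℝ}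
    (hu : ContDiffOn ℝ ∞ (fun q : Coord m × ℝ => u q.2 q.1) (U ×ˢ J)) {t : ℝ} (ht : t ∈ J)
    {v : Coord m → ℝ} (hv : ∀ x ∈ U, HasDerivWithinAt (fun s => u s x) (v x) J t) (i : Fin m) :
    ContDiffOn ℝ ∞ (fun q : Coord m × ℝ => partialDeriv i (u q.2) q.1) (U ×ˢ J) ∧
    ∀ x ∈ U, HasDerivWithinAt (fun s => partialDeriv i (u s) x) (partialDeriv i v x) J t := by
  set û : Coord m × ℝ → ℝ := fun q => u q.2 q.1 with hû
  have hS : UniqueDiffOn ℝ (U ×ˢ J) := hU.uniqueDiffOn.prod hJ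
  set D := fderivWithin ℝ û (U ×ˢ J) with hD
  have hDs : ContDiffOn ℝ ∞ D (U ×ˢ J) := hu.fderivWithin hS (by simp)
  have hd : ∀ q ∈ U ×ˢ J, HasFDerivWithinAt û (D q) (U ×ˢ J) q := fun q hq =>
    ((hu q hq).differentiableWithinAt (by simp)).hasFDerivWithinAt
  have hd2 : ∀ q ∈ U ×ˢ J,
      HasFDerivWithinAt D (fderivWithin ℝ D (U ×ˢ J) q) (U ×ˢ J) q := fun q hq =>
    ((hDs q hq).differentiableWithinAt (by simp)).hasFDerivWithinAt
  have hin1 : ∀ x s, HasFDerivWithinAt (fun z : Coord m => (z, s))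
      (ContinuousLinearMap.inl ℝ (Coord m) ℝ) U x := fun x s =>
    (hasFDerivAt_prodMk_left x s).hasFDerivWithinAt
  have hin2 : ∀ (x : Coord m) s, HasDerivWithinAt (fun s : ℝ => (x, s)) ((0 : Coord m), (1 : ℝ))
      J s := fun x s =>
    ((hasDerivAt_const s x).prodMk (hasDerivAt_id s)).hasDerivWithinAt
  have hsp : ∀ q ∈ U ×ˢ J, partialDeriv i (u q.2) q.1 = D q (EuclideanSpace.single i 1, 0) := by
    rintro ⟨x, s⟩ ⟨hx, hs⟩
    have h1 := (hd (x, s) ⟨hx, hs⟩).comp x (hin1 x s)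
      fun z hz => (⟨hz, hs⟩ : (z, s) ∈ U ×ˢ J)
    have h2 := (h1.hasFDerivAt (hU.mem_nhds hx)).fderiv
    change fderiv ℝ (u s) x = _ at h2
    simp only [partialDeriv, h2]
    simp
  -- Derivatives within `J` are unique, so the given velocity is the time component of the joint
  -- derivative and can be differentiated in space.
  have htm : ∀ x ∈ U, v x = D (x, t) (0, 1) := by
    intro x hx
    have h1 := (hd (x, t) ⟨hx, ht⟩).comp_hasDerivWithinAt t (hin2 x t)
      fun s hs => (⟨hx, hs⟩ : (x, s) ∈ U ×ˢ J)
    exact (hJ t ht).eq_deriv _ (hv x hx) h1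
  refine ⟨(hDs.clm_apply contDiffOn_const).congr hsp, fun x hx => ?_⟩
  have hq : (x, t) ∈ U ×ˢ J := ⟨hx, ht⟩
  have hev : ∀ w : Coord m × ℝ, HasFDerivWithinAt (fun q => D q w)
      ((ContinuousLinearMap.apply ℝ ℝ w).comp (fderivWithin ℝ D (U ×ˢ J) (x, t))) (U ×ˢ J)
      (x, t) := fun w =>
    (ContinuousLinearMap.apply ℝ ℝ w).hasFDerivAt.comp_hasFDerivWithinAt (x, t) (hd2 _ hq)
  have h1 := (hev (EuclideanSpace.single i 1, 0)).comp_hasDerivWithinAt t (hin2 x t)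
      fun s hs => (⟨hx, hs⟩ : (x, s) ∈ U ×ˢ J)
  have h2 : partialDeriv i v x = fderivWithin ℝ D (U ×ˢ J) (x, t)
      (EuclideanSpace.single i 1, 0) (0, 1) := by
    rw [partialDeriv_congr hU hx htm]
    have h3 := (hev (0, 1)).comp x (hin1 x t)
      fun z hz => (⟨hz, ht⟩ : (z, t) ∈ U ×ˢ J)
    have h4 := (h3.hasFDerivAt (hU.mem_nhds hx)).fderiv
    change fderiv ℝ (fun z => D (z, t) (0, 1)) x = _ at h4
    simp only [partialDeriv, h4]
    simp
  -- At an end point of `J` the second derivative within the product is symmetric because the point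
  -- is a limit of interior points; this covers t = 0.
  have hcl : (x, t) ∈ closure (interior (U ×ˢ J)) := by
    rw [interior_prod_eq, closure_prod_eq, hU.interior_eq]
    exact ⟨subset_closure hx, hJc ht⟩
  have hsymm := (hu (x, t) hq).isSymmSndFDerivWithinAt
    (by simpa using (WithTop.coe_le_coe.2 le_top : ((2 : ℕ∞) : WithTop ℕ∞) ≤ ∞)) hS hcl hq
  rw [h2, hsymm.eq]
  refine HasDerivWithinAt.congr h1 (fun s hs => ?_) ?_
  · exact hsp (x, s) ⟨hx, hs⟩
  · exact hsp (x, t) hq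

variable {m n : ℕ} {G : Coord n → Matrix (Fin n) (Fin n) ℝ} {f : ℝ → Coord m → Coord n}
  {U : Set (Coord m)} {W : Set (Coord n)} {J : Set ℝ} {t : ℝ} {x : Coord m}

/-- A family of maps, smooth in space and time, moving at time `t` with velocity the mean curvature
vector. -/
structure IsFlowAt (G : Coord n → Matrix (Fin n) (Fin n) ℝ) (f : ℝ → Coord m → Coord n)
    (U : Set (Coord m)) (W : Set (Coord n)) (J : Set ℝ) (t : ℝ) : Prop
    extends IsImmersionOn G (f t) U W where
  uniqueDiffOn : UniqueDiffOn ℝ J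
  subset_closure : J ⊆ closure (interior J)
  mem : t ∈ J
  mapsTo_all : ∀ s ∈ J, ∀ x ∈ U, f s x ∈ W
  smooth_all : ContDiffOn ℝ ∞ (fun q : Coord m × ℝ => f q.2 q.1) (U ×ˢ J)
  flow : ∀ x ∈ U, ∀ A, HasDerivWithinAt (fun s => f s x A) (meanCurvature G (f t) x A) J t

/-- At times other than `t` only torsion-freeness is needed, and that requires no immersion. -/
lemma IsFlowAt.isMapOn (hf : IsFlowAt G f U W J t) {s : ℝ} (hs : s ∈ J) :
    IsMapOn G (f s) U W where
  metric := hf.metric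
  isOpen := hf.isOpen
  mapsTo := hf.mapsTo_all s hs
  smooth := hf.smooth_all.comp (f := fun x => (x, s)) (by fun_prop) fun x hx => ⟨hx, hs⟩

lemma IsFlowAt.hasDerivWithinAt_tangent (hf : IsFlowAt G f U W J t) (i : Fin m) (A : Fin n) :
    ContDiffOn ℝ ∞ (fun q : Coord m × ℝ => tangent (f q.2) i q.1 A) (U ×ˢ J) ∧
    ∀ x ∈ U, HasDerivWithinAt (fun s => tangent (f s) i x A)
      (fieldDeriv i (meanCurvature G (f t)) x A) J t :=
  hasDerivWithinAt_partialDeriv hf.isOpen hf.uniqueDiffOn hf.subset_closure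
    (u := fun s x => f s x A) (contDiffOn_piLp _ |>.1 hf.smooth_all A) hf.mem
    (fun x hx => hf.flow x hx A) i

/-- The covariant time derivative of the coordinate vectors. -/
lemma IsFlowAt.hasCovDerivWithinAt_tangent (hf : IsFlowAt G f U W J t) (hx : x ∈ U) (i : Fin m) :
    HasCovDerivWithinAt G (fun s => f s x) (meanCurvature G (f t) x)
      (fun s => tangent (f s) i x) (covDeriv G (f t) i (meanCurvature G (f t)) x) J t := by
  intro A
  convert (hf.hasDerivWithinAt_tangent i A).2 x hx using 1
  rw [covDeriv_eq, christoffelOn_comm hf.metric (hf.mapsTo x hx) (tangent (f t) i x), Pi.add_apply,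
    add_sub_cancel_right]

/-- The covariant time derivative of the ambient second derivatives. -/
lemma IsFlowAt.hasCovDerivWithinAt_covDeriv_tangent (hf : IsFlowAt G f U W J t) (hx : x ∈ U)
    (i j : Fin m) :
    HasCovDerivWithinAt G (fun s => f s x) (meanCurvature G (f t) x)
      (fun s => covDeriv G (f s) i (tangent (f s) j) x)
      (covDeriv G (f t) i (covDeriv G (f t) j (meanCurvature G (f t))) x
        - curvatureVec G (f t x) (meanCurvature G (f t) x) (tangent (f t) i x)
          (tangent (f t) j x)) J t := by
  intro A
  have hG := hf.metric
  have hy := hf.mapsTo x hx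
  have hm := hf.toIsMapOn
  have hE := fun i A => (hf.hasDerivWithinAt_tangent i A).2 x hx
  have h1 : HasDerivWithinAt (fun s => fieldDeriv i (tangent (f s) j) x A)
      (fieldDeriv i (fieldDeriv j (meanCurvature G (f t))) x A) J t :=
    (hasDerivWithinAt_partialDeriv hf.isOpen hf.uniqueDiffOn hf.subset_closure
      (u := fun s x => tangent (f s) j x A) (hf.hasDerivWithinAt_tangent j A).1 hf.mem
      (hf.hasDerivWithinAt_tangent j A).2 i).2 x hx
  have h2 := hasDerivWithinAt_christoffelOn hG (c := fun s => f s x) hy (hf.flow x hx)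
    (hE i) (hE j) A
  refine (h1.fun_add h2).congr_deriv ?_
  beta_reduce
  -- The commutator of D_t and ∇_i: the curvature identity with H in the role of a coordinate
  -- vector, the time direction being a further coordinate.
  have hK := congrFun (curvatureVec_eq (G := G) (y := f t x) (meanCurvature G (f t) x)
    (tangent (f t) i x) (tangent (f t) j x)) A
  rw [covDeriv_covDeriv_eq hm hx (smoothField_meanCurvature hf.toIsImmersionOn), covDeriv_eq,
    christoffelOn_add_right, christoffelDerivOn_comm hG hy _ (tangent (f t) j x),
    christoffelOn_comm hG hy (fieldDeriv i (tangent (f t) j) x),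
    christoffelOn_comm hG hy (tangent (f t) j x) (fieldDeriv i _ x),
    christoffelOn_comm hG hy (tangent (f t) j x) (meanCurvature G (f t) x)]
  simp only [Pi.add_apply, Pi.sub_apply, Pi.neg_apply] at hK ⊢
  linarith

lemma HasCovDerivWithinAt.sub {c : ℝ → Coord n} {c' : Fin n → ℝ} {V X : ℝ → Fin n → ℝ}
    {V' X' : Fin n → ℝ} (hV : HasCovDerivWithinAt G c c' V V' J t)
    (hX : HasCovDerivWithinAt G c c' X X' J t) :
    HasCovDerivWithinAt G c c' (fun s => V s - X s) (V' - X') J t := by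
  intro A
  refine ((hV A).fun_sub (hX A)).congr_deriv ?_
  rw [christoffelOn_sub_right]
  simp only [Pi.sub_apply]
  ring

lemma HasCovDerivWithinAt.sum_smul {ι : Type*} {s : Finset ι} {c : ℝ → Coord n} {c' : Fin n → ℝ}
    {V : ι → ℝ → Fin n → ℝ} {V' : ι → Fin n → ℝ} {a : ι → ℝ → ℝ} {a' : ι → ℝ}
    (ha : ∀ k, HasDerivWithinAt (a k) (a' k) J t)
    (hV : ∀ k, HasCovDerivWithinAt G c c' (V k) (V' k) J t) :
    HasCovDerivWithinAt G c c' (fun τ => ∑ k ∈ s, a k τ • V k τ)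
      (∑ k ∈ s, a' k • V k t + ∑ k ∈ s, a k t • V' k) J t := by
  intro A
  have h : HasDerivWithinAt (fun τ => ∑ k ∈ s, a k τ * V k τ A)
      (∑ k ∈ s, (a' k * V k t A + a k t * (V' k A - christoffelOn G (c t) c' (V k t) A))) J t :=
    HasDerivWithinAt.fun_sum fun k _ => (ha k).fun_mul (hV k A)
  convert h using 1
  · funext τ
    simp
  · simp only [christoffelOn_sum_right, christoffelOn_smul_right, Pi.add_apply, Finset.sum_apply,
      Pi.smul_apply, smul_eq_mul, Finset.sum_add_distrib, mul_sub, Finset.sum_sub_distrib]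
    ring

/-- The evolution of the induced metric. -/
lemma IsFlowAt.hasDerivWithinAt_inducedMetric (hf : IsFlowAt G f U W J t) (hx : x ∈ U)
    (i j : Fin m) :
    HasDerivWithinAt (fun s => inducedMetric G (f s) x i j)
      (-2 * inner G (f t x) (meanCurvature G (f t) x) (secondFF G (f t) i j x)) J t := by
  have hI := hf.toIsImmersionOn
  have h := HasCovDerivWithinAt.inner hf.metric (c := fun s => f s x) (hf.mapsTo x hx)
    (hf.flow x hx) (hf.hasCovDerivWithinAt_tangent hx i) (hf.hasCovDerivWithinAt_tangent hx j)
  have hw := inner_covDeriv_of_isNormal hf.toIsMapOn hx (smoothField_meanCurvature hI)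
    fun z hz => isNormal_meanCurvature hI hz
  rw [hw, inner_comm hf.metric (hf.mapsTo x hx) (tangent (f t) i x), hw,
    secondFF_symm hf.toIsMapOn hx j i] at h
  exact h.congr_deriv (by ring)

/-- The evolution of the inverse of the induced metric. -/
lemma IsFlowAt.hasDerivWithinAt_inducedInv (hf : IsFlowAt G f U W J t) (hx : x ∈ U)
    (hg : inducedMetric G (f t) x = 1) (i j : Fin m) :
    HasDerivWithinAt (fun s => inducedInv G (f s) i j x)
      (2 * inner G (f t x) (meanCurvature G (f t) x) (secondFF G (f t) i j x)) J t := by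
  have hgd := hf.hasDerivWithinAt_inducedMetric hx
  have hM : DifferentiableWithinAt ℝ
      (fun s => (fun a b => inducedMetric G (f s) x a b : Fin m → Fin m → ℝ)) J t :=
    differentiableWithinAt_pi.2 fun a => differentiableWithinAt_pi.2 fun b =>
      (hgd a b).differentiableWithinAt
  have hdet := hf.det_ne x hx
  have hId : ∀ a b, DifferentiableWithinAt ℝ (fun s => inducedInv G (f s) a b x) J t :=
    fun a b => DifferentiableAt.comp_differentiableWithinAt
      (f := fun s => (fun a b => inducedMetric G (f s) x a b : Fin m → Fin m → ℝ)) t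
      ((contDiffAt_inv_apply a b hdet).differentiableAt (by simp)) hM
  have hcont : ContinuousWithinAt (fun s => (inducedMetric G (f s) x).det) J t :=
    ((contDiff_det m).continuous.continuousAt).comp_continuousWithinAt hM.continuousWithinAt
  -- Nondegeneracy is assumed at time `t` only and persists nearby by continuity; hence g⁻¹g = 1
  -- near `t` can be differentiated.
  have hev : ∀ᶠ s in 𝓝[J] t, (inducedMetric G (f s) x).det ≠ 0 :=
    hcont.eventually_ne hdet
  have hone : (fun s => ∑ k, inducedInv G (f s) i k x * inducedMetric G (f s) x k j)
      =ᶠ[𝓝[J] t] fun _ => (1 : Matrix (Fin m) (Fin m) ℝ) i j := by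
    filter_upwards [hev] with s hs
    rw [← Matrix.nonsing_inv_mul _ hs.isUnit, Matrix.mul_apply]
    rfl
  have h1 : HasDerivWithinAt (fun s => ∑ k, inducedInv G (f s) i k x * inducedMetric G (f s) x k j)
      (∑ k, (derivWithin (fun s => inducedInv G (f s) i k x) J t * inducedMetric G (f t) x k j
        + inducedInv G (f t) i k x
          * (-2 * inner G (f t x) (meanCurvature G (f t) x) (secondFF G (f t) k j x)))) J t :=
    HasDerivWithinAt.fun_sum fun k _ => (hId i k).hasDerivWithinAt.fun_mul (hgd k j)
  have h2 := (hf.uniqueDiffOn t hf.mem).eq_deriv _ h1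
    ((hasDerivWithinAt_const t J ((1 : Matrix (Fin m) (Fin m) ℝ) i j)).congr_of_eventuallyEq hone
      (hone.self_of_nhdsWithin hf.mem))
  rw [Finset.sum_add_distrib] at h2
  simp only [hg, Matrix.one_apply, inducedInv_of_eq_one hg, mul_ite, mul_one, mul_zero, ite_mul,
    one_mul, zero_mul, Finset.sum_ite_eq, Finset.sum_ite_eq', Finset.mem_univ, if_true] at h2
  exact (hId i j).hasDerivWithinAt.congr_deriv (by linarith)

/-- The normal part of the covariant time derivative of the second fundamental form. -/
lemma IsFlowAt.exists_hasCovDerivWithinAt_secondFF (hf : IsFlowAt G f U W J t) (hx : x ∈ U)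
    (hg : inducedMetric G (f t) x = 1) (i j : Fin m) :
    ∃ A' : Fin n → ℝ,
      HasCovDerivWithinAt G (fun s => f s x) (meanCurvature G (f t) x)
        (fun s => secondFF G (f s) i j x) A' J t ∧
      ∀ ν, IsNormal G (f t) x ν → inner G (f t x) A' ν
        = inner G (f t x) (covDeriv G (f t) j (covDeriv G (f t) i (meanCurvature G (f t))) x
          - ∑ q, inducedConn G (f t) q j i x • covDeriv G (f t) q (meanCurvature G (f t)) x) ν
        - curvatureOn G (f t x) (meanCurvature G (f t) x) (tangent (f t) j x)
          (tangent (f t) i x) ν := by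
  have hE := hf.hasCovDerivWithinAt_tangent hx
  have hD : HasCovDerivWithinAt G (fun s => f s x) (meanCurvature G (f t) x)
      (fun s => covDeriv G (f s) i (tangent (f s) j) x)
      (covDeriv G (f t) j (covDeriv G (f t) i (meanCurvature G (f t))) x
        - curvatureVec G (f t x) (meanCurvature G (f t) x) (tangent (f t) j x)
          (tangent (f t) i x)) J t := by
    intro A
    -- Exchanging `i` and `j` at every time yields the Hessian of H in the order ∇_j ∇_i used by
    -- `simons`.
    have h := hf.hasCovDerivWithinAt_covDeriv_tangent hx j i A
    beta_reduce at h
    rw [covDeriv_tangent_comm hf.toIsMapOn hx j i] at h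
    refine h.congr (fun s hs => ?_) ?_
    · beta_reduce
      rw [covDeriv_tangent_comm (hf.isMapOn hs) hx i j]
    · beta_reduce
      rw [covDeriv_tangent_comm hf.toIsMapOn hx i j]
  -- Differentiability suffices: the time derivatives of the connection coefficients multiply
  -- tangent vectors and vanish against ν.
  have hΓ : ∀ k, DifferentiableWithinAt ℝ (fun s => inducedConn G (f s) k i j x) J t := by
    intro k
    simp only [inducedConn, tangentialCoeff]
    exact DifferentiableWithinAt.fun_sum fun l _ =>
      (hf.hasDerivWithinAt_inducedInv hx hg k l).differentiableWithinAt.fun_mul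
        (HasCovDerivWithinAt.inner hf.metric (c := fun s => f s x) (hf.mapsTo x hx)
          (hf.flow x hx) hD (hE l)).differentiableWithinAt
  have h := hD.sub (HasCovDerivWithinAt.sum_smul (s := Finset.univ)
    (fun k => (hΓ k).hasDerivWithinAt) hE)
  have he : (fun s => secondFF G (f s) i j x) = fun s => covDeriv G (f s) i (tangent (f s) j) x
      - ∑ k, inducedConn G (f s) k i j x • tangent (f s) k x := by
    funext s
    rw [secondFF_eq]
  rw [← he] at h
  refine ⟨_, h, fun ν hν => ?_⟩
  simp only [inner_sub_left, inner_add_left, inner_sum_tangent hν, inner_curvatureVec,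
    fun q => inducedConn_symm hf.toIsMapOn hx q i j]
  ring

end Time

/-! ### The evolution equations in local coordinates -/

section Evolution

variable {m n r : ℕ} {G : Coord n → Matrix (Fin n) (Fin n) ℝ} {f : ℝ → Coord m → Coord n}
  {U : Set (Coord m)} {W : Set (Coord n)} {J : Set ℝ} {t : ℝ} {x : Coord m}

lemma hEvolution_eq_add (f : Coord m → Coord n) (x : Coord m) (ν dν : Fin r → Fin n → ℝ)
    (α : Fin r) (i j : Fin m) :
    hEvolution G f x ν dν α i j = hEvolution G f x ν 0 α i j
      + ∑ β, hCoeff G f x ν β i j * inner G (f x) (ν β) (dν α) := by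
  have hz : ∀ β, inner G (f x) (ν β) ((0 : Fin r → Fin n → ℝ) α) = 0 := fun β => by
    simp [inner_eq]
  simp only [hEvolution, hz, mul_zero, Finset.sum_const_zero, add_zero]

/-- The evolution equation of the coefficients of the second fundamental form. -/
lemma IsFlowAt.hasDerivWithinAt_hCoeff (hmn : m + r = n) (hf : IsFlowAt G f U W J t) (hx : x ∈ U)
    (hg : inducedMetric G (f t) x = 1) {e : Fin r → ℝ → Fin n → ℝ} {dν : Fin r → Fin n → ℝ}
    (hν : IsNormalFrame G (f t) x (fun α => e α t))
    (he : ∀ α, HasCovDerivWithinAt G (fun s => f s x) (meanCurvature G (f t) x) (e α) (dν α) J t)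
    (α : Fin r) (i j : Fin m) :
    HasDerivWithinAt (fun s => hCoeff G (f s) x (fun β => e β s) α i j)
      (hEvolution G (f t) x (fun β => e β t) dν α i j) J t := by
  have hI := hf.toIsImmersionOn
  have hm := hf.toIsMapOn
  obtain ⟨A', hA', hn⟩ := hf.exists_hasCovDerivWithinAt_secondFF hx hg i j
  have h := HasCovDerivWithinAt.inner hf.metric (c := fun s => f s x) (hf.mapsTo x hx)
    (hf.flow x hx) hA' (he α)
  refine h.congr_deriv ?_
  rw [hn _ (hν.isNormal hm hx α), simons hmn hI hx hg hν, hEvolution_eq_add (f t) x _ dν,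
    hν.inner_eq_sum hmn hm hx hg (isNormal_secondFF hI hx i j)]
  rfl

/-- The evolution equation of the squared norm of the second fundamental form. -/
lemma IsFlowAt.hasDerivWithinAt_normSqSFF (hmn : m + r = n) (hf : IsFlowAt G f U W J t)
    (hx : x ∈ U) (hg : inducedMetric G (f t) x = 1) {ν : Fin r → Fin n → ℝ}
    (hν : IsNormalFrame G (f t) x ν) :
    HasDerivWithinAt (fun s => normSqSFF G (f s) x) (normSqEvolution G (f t) x ν) J t := by
  have hI := hf.toIsImmersionOn
  have hm := hf.toIsMapOn
  have hcomm := inner_comm hf.metric (hf.mapsTo x hx)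
  choose A' hA' hn using hf.exists_hasCovDerivWithinAt_secondFF hx hg
  have hinv := hf.hasDerivWithinAt_inducedInv hx hg
  have hA := isNormal_secondFF hI hx
  have hsum := fun i j w => hν.inner_eq_sum hmn hm hx hg (hA i j) w
  have hS : ∀ i j k l, inner G (f t x) (secondFF G (f t) i j x) (secondFF G (f t) k l x)
      = ∑ α, hCoeff G (f t) x ν α i j * hCoeff G (f t) x ν α k l := fun i j k l => by
    rw [hsum]
    refine Finset.sum_congr rfl fun α _ => ?_
    rw [hcomm (ν α)]
    rfl
  have hH : ∀ i k, inner G (f t x) (meanCurvature G (f t) x) (secondFF G (f t) i k x)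
      = ∑ β, hCoeff G (f t) x ν β i k * ∑ l, hCoeff G (f t) x ν β l l := fun i k => by
    rw [meanCurvature_of_eq_one hg, inner_sum_left]
    simp only [hS, Finset.mul_sum]
    rw [Finset.sum_comm]
    simp only [mul_comm]
  -- Pairing with the normal vector A_ij sees only the normal part of its time derivative, so
  -- `simons` applies without a moving frame.
  have hA'A : ∀ i j, inner G (f t x) (A' i j) (secondFF G (f t) i j x)
      = ∑ α, hEvolution G (f t) x ν 0 α i j * hCoeff G (f t) x ν α i j := fun i j => by
    rw [hcomm, hsum]
    refine Finset.sum_congr rfl fun α _ => ?_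
    rw [hcomm (ν α), hn i j _ (hν.isNormal hm hx α), simons hmn hI hx hg hν, mul_comm]
    rfl
  have h : HasDerivWithinAt (fun s => normSqSFF G (f s) x)
      (∑ i, ∑ j, ∑ k, ∑ l, (((2 * inner G (f t x) (meanCurvature G (f t) x)
            (secondFF G (f t) i k x)) * inducedInv G (f t) j l x
          + inducedInv G (f t) i k x * (2 * inner G (f t x) (meanCurvature G (f t) x)
            (secondFF G (f t) j l x)))
            * inner G (f t x) (secondFF G (f t) i j x) (secondFF G (f t) k l x)
        + inducedInv G (f t) i k x * inducedInv G (f t) j l x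
          * (inner G (f t x) (A' i j) (secondFF G (f t) k l x)
            + inner G (f t x) (secondFF G (f t) i j x) (A' k l)))) J t := by
    refine HasDerivWithinAt.fun_sum fun i _ => HasDerivWithinAt.fun_sum fun j _ =>
      HasDerivWithinAt.fun_sum fun k _ => HasDerivWithinAt.fun_sum fun l _ => ?_
    exact ((hinv i k).fun_mul (hinv j l)).fun_mul (HasCovDerivWithinAt.inner hf.metric
      (c := fun s => f s x) (hf.mapsTo x hx) (hf.flow x hx) (hA' i j) (hA' k l))
  refine h.congr_deriv ?_
  rw [← normSqEvolution_eq hmn hI hx hg hν]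
  have e1 : ∑ α, ∑ i, ∑ j, hEvolution G (f t) x ν 0 α i j * hCoeff G (f t) x ν α i j
      = ∑ i, ∑ j, inner G (f t x) (A' i j) (secondFF G (f t) i j x) := by
    simp only [hA'A]
    simp only [← Fintype.sum_prod_type']
    exact Finset.sum_nbij' (fun (α, i, j) => (i, j, α)) (fun (i, j, α) => (α, i, j))
      (by simp) (by simp) (by simp) (by simp) fun _ _ => rfl
  -- The two inverse metric factors contribute equally, which makes the coefficient 4 in
  -- `normSqEvolution_eq`.
  have e2 : ∑ i, ∑ j, ∑ l, inner G (f t x) (meanCurvature G (f t) x) (secondFF G (f t) j l x)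
        * inner G (f t x) (secondFF G (f t) i j x) (secondFF G (f t) i l x)
      = ∑ i, ∑ j, ∑ k, inner G (f t x) (meanCurvature G (f t) x) (secondFF G (f t) i k x)
        * inner G (f t x) (secondFF G (f t) i j x) (secondFF G (f t) k j x) := by
    rw [Finset.sum_comm]
    refine Finset.sum_congr rfl fun i _ => Finset.sum_congr rfl fun j _ =>
      Finset.sum_congr rfl fun k _ => ?_
    rw [secondFF_symm hm hx j i, secondFF_symm hm hx j k]
  rw [e1]
  simp only [← hH, ← hS]
  simp only [inducedInv_of_eq_one hg, add_mul, mul_add, Finset.sum_add_distrib, ite_mul, mul_ite,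
    one_mul, mul_one, zero_mul, mul_zero, Finset.sum_ite_eq, Finset.mem_univ, if_true,
    Finset.sum_ite_irrel, Finset.sum_const_zero, mul_assoc, ← Finset.mul_sum,
    hcomm (secondFF G (f t) _ _ x) (A' _ _), e2]
  ring

end Evolution

/-! ### Reduction to local coordinates -/

lemma openPartialHomeomorph_mdifferentiable {n : ℕ} {M : Type*} [TopologicalSpace M]
    [ChartedSpace (Coord n) M] {ψ : OpenPartialHomeomorph M (Coord n)}
    (hψ : ψ ∈ IsManifold.maximalAtlas (𝓡 n) ∞ M) : ψ.MDifferentiable (𝓡 n) (𝓡 n) :=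
  ⟨(contMDiffOn_of_mem_maximalAtlas hψ).mdifferentiableOn (by simp),
    (contMDiffOn_symm_of_mem_maximalAtlas hψ).mdifferentiableOn (by simp)⟩

lemma bilin_apply_eq_sum {n : ℕ} {E : Type*} [AddCommGroup E] [Module ℝ E] [TopologicalSpace E]
    [IsTopologicalAddGroup E] [ContinuousSMul ℝ E] (L : Coord n →L[ℝ] E)
    (b : E →L[ℝ] E →L[ℝ] ℝ) (v : Fin n → ℝ) :
    b (L (WithLp.toLp 2 v)) (L (WithLp.toLp 2 v)) = ∑ A, v A * ∑ B,
      b (L (EuclideanSpace.single A 1)) (L (EuclideanSpace.single B 1)) * v B := by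
  have hexp : (WithLp.toLp 2 v : Coord n) = ∑ A, v A • EuclideanSpace.single A (1 : ℝ) := by
    conv_lhs => rw [← (EuclideanSpace.basisFun (Fin n) ℝ).sum_repr (WithLp.toLp 2 v)]
    simp
  rw [hexp]
  simp only [map_sum, map_smul, sum_apply, smul_apply, smul_eq_mul, Finset.mul_sum]
  rw [Finset.sum_comm]
  exact Finset.sum_congr rfl fun A _ => Finset.sum_congr rfl fun B _ => by ring

section Reduction

variable {m n : ℕ} {S : Type*} [TopologicalSpace S] [ChartedSpace (Coord m) S]
  {M : Type*} [TopologicalSpace M] [ChartedSpace (Coord n) M] [IsManifold (𝓡 n) ∞ M]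

/-- The coordinate vector fields of a chart are smooth. -/
lemma contMDiffOn_coordinateField {ψ : OpenPartialHomeomorph M (Coord n)}
    (hψ : ψ ∈ IsManifold.maximalAtlas (𝓡 n) ∞ M) (v : Coord n) :
    ContMDiffOn (𝓡 n) ((𝓡 n).prod 𝓘(ℝ, Coord n)) ∞
      (fun y => Bundle.TotalSpace.mk' (Coord n) (E := fun y : M => TangentSpace (𝓡 n) y)
        (ψ.symm y) (mfderiv (𝓡 n) (𝓡 n) ψ.symm y v)) ψ.target := by
  have h1 := (contMDiffOn_symm_of_mem_maximalAtlas hψ).contMDiffOn_tangentMapWithin (m := ∞)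
    (by simp) ψ.open_target.uniqueMDiffOn
  have h2 : ContMDiffOn (𝓡 n) (𝓡 n).tangent ∞
      (fun y : Coord n => (⟨y, v⟩ : TangentBundle (𝓡 n) (Coord n))) ψ.target :=
    contMDiffOn_vectorSpace_iff_contDiffOn.2 contDiffOn_const
  refine (h1.comp h2 fun y hy => hy).congr fun y hy => ?_
  simp only [Function.comp, tangentMapWithin]
  rw [mfderivWithin_of_isOpen ψ.open_target hy]

/-- A Riemannian metric written in a chart. -/
lemma isMetricOn_metricInChart
    (g : Bundle.ContMDiffRiemannianMetric (𝓡 n) ∞ (Coord n) (fun y : M => TangentSpace (𝓡 n) y))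
    {ψ : OpenPartialHomeomorph M (Coord n)} (hψ : ψ ∈ IsManifold.maximalAtlas (𝓡 n) ∞ M) :
    IsMetricOn (metricInChart g ψ) ψ.target where
  isOpen := ψ.open_target
  smooth A B := by
    rw [← contMDiffOn_iff_contDiffOn]
    intro y hy
    have h : ContMDiffWithinAt (𝓡 n) ((𝓡 n).prod 𝓘(ℝ)) ∞
        (fun y => Bundle.TotalSpace.mk' ℝ (E := Bundle.Trivial M ℝ) (ψ.symm y)
          (g.inner (ψ.symm y) (mfderiv (𝓡 n) (𝓡 n) ψ.symm y (EuclideanSpace.single A 1))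
            (mfderiv (𝓡 n) (𝓡 n) ψ.symm y (EuclideanSpace.single B 1)))) ψ.target y := by
      apply ContMDiffWithinAt.clm_bundle_apply₂ (F₁ := Coord n) (F₂ := Coord n)
      · exact ContMDiffAt.comp_contMDiffWithinAt y g.contMDiff.contMDiffAt
          (contMDiffOn_symm_of_mem_maximalAtlas hψ y hy)
      · exact contMDiffOn_coordinateField hψ _ y hy
      · exact contMDiffOn_coordinateField hψ _ y hy
    simp only [Bundle.contMDiffWithinAt_totalSpace] at h
    exact h.2
  symm y _ A B := g.symm _ _ _
  det_ne y hy hdet := by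
    -- A kernel vector would push forward to a nonzero tangent vector of zero length, since the
    -- derivative of the inverse chart is injective.
    obtain ⟨v, hv, hGv⟩ := Matrix.exists_mulVec_eq_zero_iff.2 hdet
    set L := mfderiv (𝓡 n) (𝓡 n) ψ.symm y with hL
    have hinj : ∀ w, L w = 0 → w = 0 := fun w hw => by
      have h := (openPartialHomeomorph_mdifferentiable hψ).comp_symm_deriv hy
      have h' := congrArg (fun T => T w) h
      simp only [ContinuousLinearMap.comp_apply, ← hL, hw, map_zero] at h'
      exact h'.symm
    have hw : WithLp.toLp 2 v ≠ (0 : Coord n) := fun h => hv (by simpa using h)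
    have hpos := g.pos (ψ.symm y) (L (WithLp.toLp 2 v)) fun h => hw (hinj _ h)
    have hval : g.inner (ψ.symm y) (L (WithLp.toLp 2 v)) (L (WithLp.toLp 2 v))
        = ∑ A, v A * (metricInChart g ψ y).mulVec v A :=
      bilin_apply_eq_sum (E := TangentSpace (𝓡 n) (ψ.symm y)) L (g.inner (ψ.symm y)) v
    rw [hval, hGv] at hpos
    simp at hpos

/-- A mean curvature flow written in charts near a point where the coordinate vectors are
orthonormal. -/
lemma IsMeanCurvatureFlow.exists_isFlowAt
    {g : Bundle.ContMDiffRiemannianMetric (𝓡 n) ∞ (Coord n) (fun y : M => TangentSpace (𝓡 n) y)}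
    {T : ℝ} {F : S → ℝ → M} (hF : IsMeanCurvatureFlow (m := m) g T F)
    {φ : OpenPartialHomeomorph S (Coord m)} (hφ : φ ∈ IsManifold.maximalAtlas (𝓡 m) ∞ S)
    {ψ : OpenPartialHomeomorph M (Coord n)} (hψ : ψ ∈ IsManifold.maximalAtlas (𝓡 n) ∞ M)
    {p : S} (hp : p ∈ φ.source) {t : ℝ} (ht : t ∈ Ico 0 T) (hpt : F p t ∈ ψ.source)
    (hdet : (inducedMetric (metricInChart g ψ) (inCharts φ ψ F t) (φ p)).det ≠ 0) :
    ∃ U, ∃ N ∈ 𝓝 t, φ p ∈ U ∧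
      IsFlowAt (metricInChart g ψ) (inCharts φ ψ F) U ψ.target (Ico 0 T ∩ N) t := by
  have hG := isMetricOn_metricInChart g hψ
  have hk : ContMDiffOn ((𝓡 m).prod 𝓘(ℝ, ℝ)) (𝓡 n) ∞
      (fun q : Coord m × ℝ => F (φ.symm q.1) q.2) (φ.target ×ˢ Ico 0 T) := by
    refine hF.smooth.comp (f := fun q : Coord m × ℝ => (φ.symm q.1, q.2))
      (ContMDiffOn.prodMk ?_ contMDiff_snd.contMDiffOn) fun q hq => ⟨mem_univ _, hq.2⟩
    exact (contMDiffOn_symm_of_mem_maximalAtlas hφ).comp contMDiff_fst.contMDiffOn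
      fun q hq => hq.1
  have hq0 : (φ p, t) ∈ φ.target ×ˢ Ico 0 T := ⟨φ.map_source hp, ht⟩
  have hnhds : (fun q : Coord m × ℝ => F (φ.symm q.1) q.2) ⁻¹' ψ.source
      ∈ 𝓝[φ.target ×ˢ Ico 0 T] (φ p, t) := by
    refine (hk.continuousOn _ hq0).preimage_mem_nhdsWithin (ψ.open_source.mem_nhds ?_)
    simpa [φ.left_inv hp] using hpt
  obtain ⟨O, hO, hOsub⟩ := mem_nhdsWithin_iff_exists_mem_nhds_inter.1 hnhds
  obtain ⟨U₀, hU₀, N₀, hN₀, hprod⟩ := mem_nhds_prod_iff.1 hO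
  obtain ⟨U₁, hU₁, hU₁o, hpU₁⟩ := mem_nhds_iff.1 hU₀
  obtain ⟨ε, hε, hball⟩ := Metric.mem_nhds_iff.1 hN₀
  rw [Real.ball_eq_Ioo] at hball
  set J := Ico 0 T ∩ Ioo (t - ε) (t + ε) with hJ
  have hJt : t ∈ J := ⟨ht, by constructor <;> linarith⟩
  have hsrc : ∀ x ∈ U₁ ∩ φ.target, ∀ s ∈ J, F (φ.symm x) s ∈ ψ.source := fun x hx s hs =>
    hOsub (show (x, s) ∈ O ∩ φ.target ×ˢ Ico 0 T from
      ⟨hprod ⟨hU₁ hx.1, hball hs.2⟩, ⟨hx.2, hs.1⟩⟩)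
  have hJint : (interior J).Nonempty := by
    -- A point to the right of `t` is interior even when t = 0. Convexity then gives unique
    -- derivatives on `J` and density of its interior.
    refine ⟨t + min ε (T - t) / 2, ?_⟩
    have h1 : 0 < min ε (T - t) := lt_min hε (by linarith [ht.2])
    have h2 := min_le_left ε (T - t)
    have h3 := min_le_right ε (T - t)
    rw [hJ, interior_inter, interior_Ico, interior_Ioo]
    exact ⟨⟨by linarith [ht.1], by linarith⟩, ⟨by linarith, by linarith⟩⟩
  have hJconv : Convex ℝ J := (convex_Ico 0 T).inter (convex_Ioo _ _)
  have hsmooth : ContDiffOn ℝ ∞ (fun q : Coord m × ℝ => inCharts φ ψ F q.2 q.1)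
      ((U₁ ∩ φ.target) ×ˢ J) := by
    have h : ContMDiffOn ((𝓡 m).prod 𝓘(ℝ, ℝ)) (𝓡 n) ∞
        (fun q : Coord m × ℝ => ψ (F (φ.symm q.1) q.2)) ((U₁ ∩ φ.target) ×ˢ J) :=
      (contMDiffOn_of_mem_maximalAtlas hψ).comp
        (f := fun q : Coord m × ℝ => F (φ.symm q.1) q.2)
        (hk.mono (prod_mono inter_subset_right inter_subset_left))
        fun q hq => hsrc q.1 hq.1 q.2 hq.2
    rw [← contMDiffOn_iff_contDiffOn, modelWithCornersSelf_prod, ← chartedSpaceSelf_prod]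
    exact h
  have hmap : IsMapOn (metricInChart g ψ) (inCharts φ ψ F t) (U₁ ∩ φ.target) ψ.target :=
    { metric := hG
      isOpen := hU₁o.inter φ.open_target
      mapsTo := fun x hx => ψ.map_source (hsrc x hx t hJt)
      smooth := hsmooth.comp (f := fun x => (x, t)) (by fun_prop) fun x hx => ⟨hx, hJt⟩ }
  have hcont : ContinuousOn
      (fun x => (inducedMetric (metricInChart g ψ) (inCharts φ ψ F t) x).det)
      (U₁ ∩ φ.target) :=
    (contDiff_det m).continuous.comp_continuousOn (continuousOn_pi.2 fun a =>
      continuousOn_pi.2 fun b => (contDiffOn_inducedMetric hmap a b).continuousOn)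
  -- Shrinks the domain to where the induced metric at time `t` stays invertible; orthonormality is
  -- kept only at the base point.
  have hUo := hcont.isOpen_inter_preimage hmap.isOpen (isOpen_ne (x := (0 : ℝ)))
  refine ⟨U₁ ∩ φ.target ∩
      (fun x => (inducedMetric (metricInChart g ψ) (inCharts φ ψ F t) x).det) ⁻¹' {y | y ≠ 0},
    Ioo (t - ε) (t + ε), Ioo_mem_nhds (by linarith) (by linarith),
    ⟨⟨hpU₁, φ.map_source hp⟩, hdet⟩, ?_⟩
  exact
    { metric := hG
      isOpen := hUo
      mapsTo := fun x hx => hmap.mapsTo x hx.1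
      smooth := hmap.smooth.mono inter_subset_left
      det_ne := fun x hx => hx.2
      uniqueDiffOn := uniqueDiffOn_convex hJconv hJint
      subset_closure := by
        rw [hJconv.closure_interior_eq_closure_of_nonempty_interior hJint]
        exact subset_closure
      mem := hJt
      mapsTo_all := fun s hs x hx => ψ.map_source (hsrc x hx.1 s hs)
      smooth_all := hsmooth.mono (prod_mono inter_subset_left subset_rfl)
      flow := fun x hx A => by
        have h := hF.flow φ hφ ψ hψ (φ.symm x) (φ.map_target hx.1.2) t ht
          (hsrc x hx.1 t hJt) A
        rw [φ.right_inv hx.1.2] at h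
        exact h.mono inter_subset_left }

end Reduction

end MCF

end

/-- Evolution of the second fundamental form along a mean curvature flow, at a point `(p, t)`, in
local coordinates `φ` of the source that are orthonormal at `(p, t)` and any local coordinates `ψ`
of the target. The first part is the equation of `h_{αij} = ⟨A(∂ᵢ, ∂ⱼ), e_α⟩` for an orthonormal
frame `e_α` of the normal spaces along the trajectory of `p`; the second is the equation of `|A|²`,
written in an orthonormal basis `ν` of the normal space at `(p, t)`. -/
theorem mainTheorem10 {m n r : ℕ} (hmn : m + r = n)
    {S : Type*} [TopologicalSpace S] [ChartedSpace (MCF.Coord m) S] [IsManifold (𝓡 m) ∞ S]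
    {M : Type*} [TopologicalSpace M] [ChartedSpace (MCF.Coord n) M] [IsManifold (𝓡 n) ∞ M]
    (g : Bundle.ContMDiffRiemannianMetric (𝓡 n) ∞ (MCF.Coord n)
      (fun y : M => TangentSpace (𝓡 n) y))
    (T : ℝ) (F : S → ℝ → M) (hF : MCF.IsMeanCurvatureFlow (m := m) g T F)
    (φ : OpenPartialHomeomorph S (MCF.Coord m)) (hφ : φ ∈ IsManifold.maximalAtlas (𝓡 m) ∞ S)
    (ψ : OpenPartialHomeomorph M (MCF.Coord n)) (hψ : ψ ∈ IsManifold.maximalAtlas (𝓡 n) ∞ M)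
    (p : S) (hp : p ∈ φ.source) (t : ℝ) (ht : t ∈ Ico 0 T) (hpt : F p t ∈ ψ.source)
    (horth : MCF.inducedMetric (MCF.metricInChart g ψ) (MCF.inCharts φ ψ F t) (φ p) = 1) :
    (∀ e : Fin r → ℝ → Fin n → ℝ,
      (∀ᶠ s in 𝓝[Ico 0 T] t, MCF.IsNormalFrame (MCF.metricInChart g ψ) (MCF.inCharts φ ψ F s)
        (φ p) (fun α => e α s)) →
      (∀ α A, DifferentiableWithinAt ℝ (fun s => e α s A) (Ico 0 T) t) →
      ∀ (α : Fin r) (i j : Fin m),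
        HasDerivWithinAt
          (fun s => MCF.hCoeff (MCF.metricInChart g ψ) (MCF.inCharts φ ψ F s) (φ p)
            (fun β => e β s) α i j)
          (MCF.hEvolution (MCF.metricInChart g ψ) (MCF.inCharts φ ψ F t) (φ p)
            (fun β => e β t)
            (fun β => MCF.covDerivTime (MCF.metricInChart g ψ) (Ico 0 T) (ψ (F p t))
              (MCF.meanCurvature (MCF.metricInChart g ψ) (MCF.inCharts φ ψ F t) (φ p)) (e β) t)
            α i j)
          (Ico 0 T) t) ∧
    (∀ ν : Fin r → Fin n → ℝ,
      MCF.IsNormalFrame (MCF.metricInChart g ψ) (MCF.inCharts φ ψ F t) (φ p) ν →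
        HasDerivWithinAt
          (fun s => MCF.normSqSFF (MCF.metricInChart g ψ) (MCF.inCharts φ ψ F s) (φ p))
          (MCF.normSqEvolution (MCF.metricInChart g ψ) (MCF.inCharts φ ψ F t) (φ p) ν)
          (Ico 0 T) t) := by
  obtain ⟨U, N, hN, hpU, hf⟩ := hF.exists_isFlowAt hφ hψ hp ht hpt (by rw [horth]; simp)
  have hbase : ∀ s, MCF.inCharts φ ψ F s (φ p) = ψ (F p s) := fun s => by
    rw [MCF.inCharts, φ.left_inv hp]
  refine ⟨fun e he hd α i j => ?_, fun ν hν => ?_⟩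
  -- Derivatives within [0, T) are local in time, so the short interval on which the charts apply is
  -- enough.
  · refine (hasDerivWithinAt_inter hN).1 (hf.hasDerivWithinAt_hCoeff hmn hpU horth
      (he.self_of_nhdsWithin ht) (fun β A => ?_) α i j)
    refine ((hd β A).hasDerivWithinAt.mono Set.inter_subset_left).congr_deriv ?_
    beta_reduce
    rw [hbase]
    -- `covDerivTime` adds to the componentwise derivative exactly the Christoffel term that
    -- `HasCovDerivWithinAt` subtracts.
    exact (add_sub_cancel_right _ _).symm
  · exact (hasDerivWithinAt_inter hN).1 (hf.hasDerivWithinAt_normSqSFF hmn hpU horth hν)
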